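/- **Setting.** Let $E\subset\mathbb R$ be finite. A random variable $X$ with values in $E$, with $p(x)=\mathbb P[X=x]$, is *sub-Gaussian with parameter* $K$ if $\mathbb P[|X-\mathbb E X|\ge t]\le 2\exp(-t^2/(2K^2))$ for all $t\ge 0$. A *quantum random variable* encoding $X$ is a unitary $O_X$ on a finite-dimensional space (garbage register) $\otimes$ (value register with basis $|x\rangle$, $x\in E$) such that $O_X|\mathbf 0\rangle=\sum_{x\in E}\sqrt{p(x)}\,|\psi_x\rangle|x\rangle$ for some unit vectors $\psi_x$, where $|\mathbf 0\rangle$ is a fixed computational basis state. A *quantum experiment* is one use of $O_X$ or $O_X^\dagger$ or a controlled version of one of them. Given quantum random variables $O_{X_1},\dots,O_{X_T}$ on the same space and a real $\mu$ with $|\mathbb E X_i-\mu|\le\delta$ for all $i$, an algorithm *solves the non-identical mean estimation problem* with repetition parameter $m$ and accuracy $\epsilon$ if it uses at most $m$ quantum experiments on each $O_{X_i}$ and outputs a number within $\epsilon$ of $\mu$ with probability at least $2/3$. **Fixed-point search.** For a unitary $A$ and an orthogonal projector $\Pi$ on a finite-dimensional space put $S_0(\alpha)=I-(1-e^{-i\alpha})|0\rangle\langle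 0|$, $S_\Pi(\beta)=I-(1-e^{i\beta})\Pi$. A *fixed-point search* assigns to each $\eta\in(0,\frac12]$ a list of $O(\log(1/\eta))$ pairs of angles $(\alpha_1,\beta_1),\dots,(\alpha_l,\beta_l)$ such that, whenever $\Pi A|0\rangle=\lambda|\phi\rangle$ with $\lambda\ge 1/\sqrt2$ and $|\phi\rangle$ a unit vector, the state $\mathrm{Fix}(A,\Pi,\eta)|0\rangle$ is, up to a global phase, within $\eta$ of $|\phi\rangle$, where $\mathrm{Fix}(A,\Pi,\eta)=A S_0(\alpha_l)A^\dagger S_\Pi(\beta_l)\cdots A S_0(\alpha_1)A^\dagger S_\Pi(\beta_1)A$. **Algorithm** (parameters $K,\epsilon$, positive constants $\kappa_1,\kappa_2$, and a fixed-point search $\mathrm{Fix}$). Put $\Delta=K\max\{\sqrt{4\log(128K/\epsilon)},\sqrt{2\log(32K/\epsilon)}\}$, $H=K+\Delta$, $L=-H$, $N=\lceil 8\log 20\rceil$, $M=\lfloor\kappa_1(H-L)/\epsilon\rfloor$, $\epsilon'=\kappa_2\,\epsilon^2/(H-L)^2$. 1. Perform $N$ classical experiments (apply $O_{X_i}$ to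 $|\mathbf 0\rangle$ and measure the value register), each on an arbitrarily chosen oracle, and let $\hat\mu$ be the average of the samples. 2. $O_{\tilde X_i}$ applies $O_{X_i}$, writes $x-\hat\mu$ into a blank register, and copies that value into a second blank register if it lies in $[L,H]$ (otherwise the second register stays in its blank state, which represents $0$). $U_i$ applies $O_{\tilde X_i}$ and then rotates a fresh qubit by $|v\rangle|0\rangle\mapsto|v\rangle\big(\sqrt{\tfrac{v-L}{H-L}}|1\rangle+\sqrt{\tfrac{H-v}{H-L}}|0\rangle\big)$, where $v$ is the truncated value. $V_i=(U_i^\dagger\otimes I)(I\otimes\mathrm{CNOT})(U_i\otimes I)$, the target of the CNOT being a further qubit, and $S_i=\mathrm{Fix}(V_i,\ |\mathbf 0\rangle|0\rangle\langle 0|\langle\mathbf 0|\otimes I,\ \epsilon')$. 3. Run amplitude estimation for the amplitude of $|1\rangle$ of the last qubit, with a phase register of dimension $M+1$: apply the quantum Fourier transform to the phase register in state $|0\rangle$, apply $S_{r(0)}$ to the other registers, apply for $k=1,\dots,M$ the operator $Q_k=-S_{r(k)}(I-2|\mathbf 0\rangle\langle\mathbf 0|)S_{r(k)}^\dagger(I-2\,I\otimes|1\rangle\langle1|)$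 controlled on the phase register being in some $|j\rangle$ with $j\ge k$, apply the inverse Fourier transform, and measure the phase register; call the outcome $y$. The indices $r(0),\dots,r(M)\in\{1,\dots,T\}$ are arbitrary. 4. With $\tilde p=\sin^2(\pi y/(M+1))$ and $\tilde q=\frac{\tilde p-\sqrt{\tilde p(1-\tilde p)}}{2\tilde p-1}$ (read as $\frac12$ at $\tilde p=\frac12$), output $\tilde q(H-L)+L+\hat\mu$. **Theorem.** Write $Q(K,\epsilon)=\frac{K\sqrt{\log(K/\epsilon)}}{\epsilon}$. There are absolute constants $c,C,C',\kappa_1,\kappa_2>0$ and a fixed-point search such that the following holds for all reals $K,\epsilon$ with $0<\epsilon\le cK$. One has $\log Q(K,\epsilon)>0$. Let $m,T$ be natural numbers with $m\ge C\log Q(K,\epsilon)$ and $T\ge C\,Q(K,\epsilon)$, and fix the registers and $|\mathbf 0\rangle$. Then the oracles used in steps 1 and 3 of the Algorithm can be chosen so that each $O_{X_i}$ is used in at most $m$ quantum experiments. However they are so chosen, the Algorithm uses at most $C'\,Q(K,\epsilon)\log Q(K,\epsilon)$ quantum experiments in total, and for every $\delta<\epsilon/4$ it solves the non-identical mean estimation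 problem with repetition parameter $m$ and accuracy $\epsilon$ for all $X_1,\dots,X_T$ that are sub-Gaussian with parameter $K$: whenever $|\mathbb E X_i-\mu|\le\delta$ for all $i$, the output is within $\epsilon$ of $\mu$ with probability at least $2/3$. -/

import Mathlib

open scoped Matrix

noncomputable section

namespace QMean

/-! ## Finite random variables

A finite random variable with values in a finite set `E` of reals enters through its law, a weight
function `p : E → ℝ` in the standard simplex. -/

/-- Expectation of a finite random variable with law `p`. -/
def mean {E : Finset ℝ} (p : E → ℝ) : ℝ := ∑ x : E, p x * (x : ℝ)

/-- `P[|X - E X| ≥ t]` for a finite random variable with law `p`. -/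
def tail {E : Finset ℝ} (p : E → ℝ) (t : ℝ) : ℝ :=
  ∑ x : E, if t ≤ |(x : ℝ) - mean p| then p x else 0

/-- Sub-Gaussian with parameter `K`: `P[|X - E X| ≥ t] ≤ 2 exp (-t² / (2K²))` for all `t ≥ 0`. -/
def SubGaussian {E : Finset ℝ} (K : ℝ) (p : E → ℝ) : Prop :=
  ∀ t : ℝ, 0 ≤ t → tail p t ≤ 2 * Real.exp (-t ^ 2 / (2 * K ^ 2))

/-! ## Quantum random variables

The oracle register is (garbage register) ⊗ (value register), with computational basis `G × E`:
`G` is any finite set and the basis state `|x⟩` of the value register carries the real `x`. -/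

/-- The computational basis vector `|b⟩`. -/
def ket {n : Type*} [DecidableEq n] (b : n) : n → ℂ := Pi.single b 1

/-- `O |𝟎⟩ = ∑ₓ √(p x) |ψₓ⟩|x⟩` for some unit garbage states `ψₓ`, where `|𝟎⟩ = |z⟩`. -/
def Encodes {G : Type} [Fintype G] [DecidableEq G] {E : Finset ℝ} (z : G × E)
    (O : Matrix.unitaryGroup (G × E) ℂ) (p : E → ℝ) : Prop :=
  ∃ ψ : E → G → ℂ, (∀ x, ∑ g, ‖ψ x g‖ ^ 2 = 1) ∧
    ∀ g x, ((O : Matrix (G × E) (G × E) ℂ) *ᵥ ket z) (g, x) = (√(p x) : ℂ) * ψ x g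

/-! ## Quantum query algorithms with `T` oracles on an oracle register `H` and a work register `W`

(Both registers are given by their computational bases.) -/

/-- An elementary step: an oracle-independent unitary, or one quantum experiment, i.e. one use of
the `i`-th oracle or (if `inverse`) of its inverse, controlled by a predicate of the basis state of
the work register (`control = fun _ => true` is the uncontrolled oracle). -/
inductive Step (T : ℕ) (H W : Type) [Fintype H] [DecidableEq H] [Fintype W] [DecidableEq W] where
  | gate (U : Matrix.unitaryGroup (H × W) ℂ) : Step T H W
  | query (i : Fin T) (inverse : Bool) (control : W → Bool) : Step T H W

section Model

variable {T : ℕ} {H W : Type} [Fintype H] [DecidableEq H] [Fintype W] [DecidableEq W]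

/-- The unitary matrix performed by a step, given the oracles. -/
def Step.matrix (O : Fin T → Matrix.unitaryGroup H ℂ) :
    Step T H W → Matrix (H × W) (H × W) ℂ
  | .gate U => U
  | .query i inverse control => Matrix.blockDiagonal fun w =>
      if control w then
        ((if inverse then (O i)⁻¹ else O i : Matrix.unitaryGroup H ℂ) : Matrix H H ℂ)
      else 1

/-- The inverse step. -/
def Step.inv : Step T H W → Step T H W
  | .gate U => .gate U⁻¹
  | .query i inverse control => .query i (!inverse) control

/-- Number of quantum experiments on oracle `i` in a step. -/
def Step.queriesTo (i : Fin T) : Step T H W → ℕ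
  | .gate _ => 0
  | .query j _ _ => if j = i then 1 else 0

/-- Number of quantum experiments in a step. -/
def Step.queries : Step T H W → ℕ
  | .gate _ => 0
  | .query _ _ _ => 1

variable (T H W) in
/-- A circuit: a list of steps, the head of the list being performed first. -/
abbrev Circuit := List (Step T H W)

/-- The state to which a circuit takes the state `v`. -/
def Circuit.run (O : Fin T → Matrix.unitaryGroup H ℂ) (C : Circuit T H W) (v : H × W → ℂ) :
    H × W → ℂ :=
  C.foldl (fun u s => s.matrix O *ᵥ u) v

/-- The inverse circuit. -/
def Circuit.inv (C : Circuit T H W) : Circuit T H W := (C.map Step.inv).reverse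

variable (T H W) in
/-- A quantum query algorithm with real output: in each round it prepares `|𝟎⟩`, runs a circuit and
measures all registers in the computational basis; the next round may depend on the outcome. -/
inductive Algorithm where
  | output (r : ℝ) : Algorithm
  | round (C : Circuit T H W) (next : H × W → Algorithm) : Algorithm

/-- Probability that the output lies in `S`, by the Born rule; `b₀` is the initial basis state. -/
def Algorithm.prob (O : Fin T → Matrix.unitaryGroup H ℂ) (b₀ : H × W) (S : Set ℝ) :
    Algorithm T H W → ℝ
  | .output r => S.indicator (fun _ => 1) r
  | .round C next =>
      ∑ b, ‖Circuit.run O C (ket b₀) b‖ ^ 2 * Algorithm.prob O b₀ S (next b)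

/-- Number of quantum experiments on oracle `i` (maximum over the measurement outcomes). -/
def Algorithm.queriesTo (i : Fin T) : Algorithm T H W → ℕ
  | .output _ => 0
  | .round C next =>
      (C.map (Step.queriesTo i)).sum + Finset.univ.sup fun b => Algorithm.queriesTo i (next b)

/-- Total number of quantum experiments (maximum over the measurement outcomes). -/
def Algorithm.queries : Algorithm T H W → ℕ
  | .output _ => 0
  | .round C next =>
      (C.map Step.queries).sum + Finset.univ.sup fun b => Algorithm.queries (next b)

end Model

/-! ## Elementary gates -/

section Gates

variable {n A R : Type} [Fintype n] [DecidableEq n] [Fintype A] [DecidableEq A] [Fintype R]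
  [DecidableEq R]

/-- The gate acting on the tensor factor `A` by `U r` when the other factors are in the basis state
`r`; `e` identifies the computational basis `n` with `A × R`. -/
def onRegister (e : A × R ≃ n) (U : R → Matrix.unitaryGroup A ℂ) : Matrix.unitaryGroup n ℂ :=
  ⟨Matrix.reindex e e (Matrix.blockDiagonal fun r => (U r : Matrix A A ℂ)), by
    rw [Matrix.mem_unitaryGroup_iff, Matrix.star_eq_conjTranspose, Matrix.conjTranspose_reindex,
      Matrix.blockDiagonal_conjTranspose]
    simp only [Matrix.reindex_apply]
    rw [Matrix.submatrix_mul_equiv, ← Matrix.blockDiagonal_mul]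
    have h : (fun k => (U k : Matrix A A ℂ) * ((U k : Matrix A A ℂ))ᴴ) = 1 := by
      funext k
      exact Matrix.mem_unitaryGroup_iff.1 (U k).2
    rw [h, Matrix.blockDiagonal_one, Matrix.submatrix_one_equiv]⟩

/-- Permutation of basis states. -/
def permGate (σ : Equiv.Perm n) : Matrix.unitaryGroup n ℂ :=
  ⟨σ.permMatrix ℂ, by
    rw [Matrix.mem_unitaryGroup_iff, Matrix.star_eq_conjTranspose, Matrix.conjTranspose_permMatrix,
      ← Matrix.permMatrix_mul]
    simp⟩

/-- `|b⟩ ↦ exp (i f(b)) |b⟩`. -/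
def phaseGate (f : n → ℝ) : Matrix.unitaryGroup n ℂ :=
  ⟨Matrix.diagonal fun b => Complex.exp (f b * Complex.I), by
    rw [Matrix.mem_unitaryGroup_iff, Matrix.star_eq_conjTranspose, Matrix.diagonal_conjTranspose,
      Matrix.diagonal_mul_diagonal, ← Matrix.diagonal_one]
    congr 1
    funext b
    simp only [Pi.star_apply, RCLike.star_def]
    rw [Complex.mul_conj, Complex.normSq_eq_norm_sq, Complex.norm_exp_ofReal_mul_I]
    simp⟩

/-- The rotation `|0⟩ ↦ cos ω |0⟩ + sin ω |1⟩`, `|1⟩ ↦ - sin ω |0⟩ + cos ω |1⟩` of a qubit. -/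
def rotation (ω : ℝ) : Matrix.unitaryGroup (Fin 2) ℂ :=
  ⟨!![(Real.cos ω : ℂ), -(Real.sin ω : ℂ); (Real.sin ω : ℂ), (Real.cos ω : ℂ)], by
    have h : (Real.cos ω : ℂ) * Real.cos ω + Real.sin ω * Real.sin ω = 1 := by
      rw [← sq, ← sq]; exact_mod_cast Real.cos_sq_add_sin_sq ω
    rw [Matrix.mem_unitaryGroup_iff]
    ext i j
    fin_cases i <;> fin_cases j <;>
      simp only [Matrix.mul_apply, Fin.sum_univ_two, Matrix.star_apply, Matrix.one_apply] <;>
      simp [Complex.conj_ofReal, -Complex.ofReal_cos, -Complex.ofReal_sin] <;> first | linear_combination h | ring⟩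

/-- The quantum Fourier transform `|y⟩ ↦ (M+1)^(-1/2) ∑ⱼ exp (2πi jy/(M+1)) |j⟩` on `ℂ^(M+1)`. -/
def qft (M : ℕ) : Matrix.unitaryGroup (Fin (M + 1)) ℂ :=
  ⟨Matrix.of fun j y => Complex.exp (2 * Real.pi * Complex.I * (j : ℕ) * (y : ℕ) / ((M + 1 : ℕ) : ℂ))
      / (√((M + 1 : ℕ) : ℝ) : ℂ), by
    have hN : ((M + 1 : ℕ) : ℂ) ≠ 0 := by exact_mod_cast Nat.succ_ne_zero M
    have hs : (√((M + 1 : ℕ) : ℝ) : ℂ) * (√((M + 1 : ℕ) : ℝ) : ℂ) = ((M + 1 : ℕ) : ℂ) := by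
      rw [← Complex.ofReal_mul, Real.mul_self_sqrt (Nat.cast_nonneg _), Complex.ofReal_natCast]
    rw [Matrix.mem_unitaryGroup_iff]
    ext j k
    rw [Matrix.mul_apply]
    have hterm : ∀ y : Fin (M + 1),
        (Matrix.of fun (j y : Fin (M + 1)) => Complex.exp (2 * Real.pi * Complex.I * (j : ℕ) * (y : ℕ) /
          ((M + 1 : ℕ) : ℂ)) / (√((M + 1 : ℕ) : ℝ) : ℂ)) j y *
        (star (Matrix.of fun (j y : Fin (M + 1)) => Complex.exp (2 * Real.pi * Complex.I * (j : ℕ) * (y : ℕ) /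
          ((M + 1 : ℕ) : ℂ)) / (√((M + 1 : ℕ) : ℝ) : ℂ))) y k =
        Complex.exp (2 * Real.pi * Complex.I * (((j : ℕ) : ℂ) - ((k : ℕ) : ℂ)) /
          ((M + 1 : ℕ) : ℂ)) ^ (y : ℕ) / ((M + 1 : ℕ) : ℂ) := by
      intro y
      rw [Matrix.star_apply, Matrix.of_apply, Matrix.of_apply, star_div₀, RCLike.star_def,
        Complex.conj_ofReal, ← Complex.exp_conj, div_mul_div_comm, hs,
        ← Complex.exp_add, ← Complex.exp_nat_mul]
      congr 2
      simp only [map_div₀, map_mul, Complex.conj_ofReal, Complex.conj_I, map_natCast, map_ofNat]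
      ring
    rw [Finset.sum_congr rfl fun y _ => hterm y, ← Finset.sum_div,
      Fin.sum_univ_eq_sum_range (fun y => Complex.exp (2 * Real.pi * Complex.I *
        (((j : ℕ) : ℂ) - ((k : ℕ) : ℂ)) / ((M + 1 : ℕ) : ℂ)) ^ y) (M + 1)]
    by_cases hjk : j = k
    · subst hjk
      have : (((M + 1 : ℕ) : ℂ)) / ((M + 1 : ℕ) : ℂ) = 1 := div_self hN
      simpa using this
    · rw [Matrix.one_apply_ne hjk]
      have hne : Complex.exp (2 * Real.pi * Complex.I * (((j : ℕ) : ℂ) - ((k : ℕ) : ℂ)) /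
          ((M + 1 : ℕ) : ℂ)) ≠ 1 := by
        intro h1
        obtain ⟨n, hn⟩ := Complex.exp_eq_one_iff.1 h1
        have h2 : (((j : ℕ) : ℂ) - ((k : ℕ) : ℂ)) = n * ((M + 1 : ℕ) : ℂ) := by
          rw [div_eq_iff hN] at hn
          have : (2 * (Real.pi : ℂ) * Complex.I) ≠ 0 := Complex.two_pi_I_ne_zero
          apply mul_left_cancel₀ this
          linear_combination hn
        have h3 : ((j : ℕ) : ℤ) - ((k : ℕ) : ℤ) = n * ((M + 1 : ℕ) : ℤ) := by exact_mod_cast h2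
        have hj := j.2
        have hk := k.2
        have h4 : n = 0 := by
          by_contra h0
          have hj' : ((j : ℕ) : ℤ) < ((M + 1 : ℕ) : ℤ) := by exact_mod_cast hj
          have hk' : ((k : ℕ) : ℤ) < ((M + 1 : ℕ) : ℤ) := by exact_mod_cast hk
          have hj0 : (0 : ℤ) ≤ ((j : ℕ) : ℤ) := Int.natCast_nonneg _
          have hk0 : (0 : ℤ) ≤ ((k : ℕ) : ℤ) := Int.natCast_nonneg _
          rcases lt_or_gt_of_ne h0 with h | h <;> nlinarith
        rw [h4] at h3
        exact hjk (Fin.ext (by omega))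
      have hpow : Complex.exp (2 * Real.pi * Complex.I * (((j : ℕ) : ℂ) - ((k : ℕ) : ℂ)) /
          ((M + 1 : ℕ) : ℂ)) ^ (M + 1) = 1 := by
        rw [← Complex.exp_nat_mul, mul_div_cancel₀ _ hN, Complex.exp_eq_one_iff]
        exact ⟨(j : ℤ) - (k : ℤ), by push_cast; ring⟩
      rw [geom_sum_eq hne, hpow]
      simp⟩

end Gates

/-! ## Fixed-point search -/

section FixedPoint

variable {n : Type} [Fintype n] [DecidableEq n]

/-- One iteration `A S₀(α) A† S_P(β)` of the search, up to a global sign, where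
`S₀(α) = I - (1 - e^(-iα)) |z⟩⟨z|` and `S_P(β) = I - (1 - e^(iβ)) P`. -/
def searchStep (A : Matrix.unitaryGroup n ℂ) (z : n) (P : Matrix n n ℂ) (ang : ℝ × ℝ) :
    Matrix n n ℂ :=
  (A : Matrix n n ℂ) * (1 - (1 - Complex.exp (-ang.1 * Complex.I)) • Matrix.single z z 1) *
    ((A⁻¹ : Matrix.unitaryGroup n ℂ) : Matrix n n ℂ) *
    (1 - (1 - Complex.exp (ang.2 * Complex.I)) • P)

/-- The state prepared from `|z⟩` by `A` followed by the iterations with the given angles. -/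
def searchState (A : Matrix.unitaryGroup n ℂ) (z : n) (P : Matrix n n ℂ) (angles : List (ℝ × ℝ)) :
    n → ℂ :=
  angles.foldl (fun v ang => searchStep A z P ang *ᵥ v) ((A : Matrix n n ℂ) *ᵥ ket z)

end FixedPoint

/-- `fix η` is a list of angles of a fixed-point search with precision `η`: for every unitary `A`
and orthogonal projector `P` with `P A |z⟩ = l φ`, `φ` a unit vector and `l ≥ 1/√2`, the state
prepared is, up to a global phase, within `η` of `φ`; and there are `O(log (1/η))` iterations. -/
def IsFixedPointSearch (fix : ℝ → List (ℝ × ℝ)) : Prop :=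
  (∃ κ > (0 : ℝ), ∀ η : ℝ, 0 < η → η ≤ 1 / 2 → ((fix η).length : ℝ) ≤ κ * Real.log (1 / η)) ∧
  ∀ η : ℝ, 0 < η → η ≤ 1 / 2 →
    ∀ (n : Type) [Fintype n] [DecidableEq n] (A : Matrix.unitaryGroup n ℂ) (z : n)
      (P : Matrix n n ℂ) (l : ℝ) (φ : n → ℂ), P.IsHermitian → P * P = P → 1 / √2 ≤ l →
      ‖WithLp.toLp 2 φ‖ = 1 → P *ᵥ ((A : Matrix n n ℂ) *ᵥ ket z) = (l : ℂ) • φ →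
      ∃ ω : ℂ, ‖ω‖ = 1 ∧ ‖WithLp.toLp 2 (ω • φ - searchState A z P (fix η))‖ ≤ η

/-! ## The mean estimation algorithm -/

section Estimation

/-- The computational basis of the work register. It consists of a register for the shifted value
`x - s` (`none` is its blank state `|𝟎⟩`, and its basis state `some x` carries the number `x - s`),
a register of the same kind for the truncated value, two qubits, and the phase register with basis
`{0, …, M}`. -/
@[ext]
structure Work (E : Finset ℝ) (M : ℕ) : Type where
  shifted : Option E
  truncated : Option E
  rot : Fin 2
  flag : Fin 2
  phase : Fin (M + 1)
  deriving DecidableEq, Fintype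

/-- The blank basis state of the work register. -/
def blank (E : Finset ℝ) (M : ℕ) : Work E M := ⟨none, none, 0, 0, 0⟩

variable {T : ℕ} {G : Type} [Fintype G] [DecidableEq G] {E : Finset ℝ} {M : ℕ}

/-- The first value register as a tensor factor. -/
def regShift : Option E × ((G × E) × Option E × Fin 2 × Fin 2 × Fin (M + 1)) ≃ (G × E) × Work E M where
  toFun := fun ⟨a, h, b, q, q', j⟩ => ⟨h, ⟨a, b, q, q', j⟩⟩
  invFun := fun ⟨h, ⟨a, b, q, q', j⟩⟩ => ⟨a, h, b, q, q', j⟩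
  left_inv _ := rfl
  right_inv _ := rfl

/-- The second value register as a tensor factor. -/
def regTrunc : Option E × ((G × E) × Option E × Fin 2 × Fin 2 × Fin (M + 1)) ≃ (G × E) × Work E M where
  toFun := fun ⟨b, h, a, q, q', j⟩ => ⟨h, ⟨a, b, q, q', j⟩⟩
  invFun := fun ⟨h, ⟨a, b, q, q', j⟩⟩ => ⟨b, h, a, q, q', j⟩
  left_inv _ := rfl
  right_inv _ := rfl

/-- The first qubit as a tensor factor. -/
def regRot : Fin 2 × ((G × E) × Option E × Option E × Fin 2 × Fin (M + 1)) ≃ (G × E) × Work E M where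
  toFun := fun ⟨q, h, a, b, q', j⟩ => ⟨h, ⟨a, b, q, q', j⟩⟩
  invFun := fun ⟨h, ⟨a, b, q, q', j⟩⟩ => ⟨q, h, a, b, q', j⟩
  left_inv _ := rfl
  right_inv _ := rfl

/-- The second qubit as a tensor factor. -/
def regFlag : Fin 2 × ((G × E) × Option E × Option E × Fin 2 × Fin (M + 1)) ≃ (G × E) × Work E M where
  toFun := fun ⟨q', h, a, b, q, j⟩ => ⟨h, ⟨a, b, q, q', j⟩⟩
  invFun := fun ⟨h, ⟨a, b, q, q', j⟩⟩ => ⟨q', h, a, b, q, j⟩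
  left_inv _ := rfl
  right_inv _ := rfl

/-- The phase register as a tensor factor. -/
def regPhase : Fin (M + 1) × ((G × E) × Option E × Option E × Fin 2 × Fin 2) ≃ (G × E) × Work E M where
  toFun := fun ⟨j, h, a, b, q, q'⟩ => ⟨h, ⟨a, b, q, q', j⟩⟩
  invFun := fun ⟨h, ⟨a, b, q, q', j⟩⟩ => ⟨j, h, a, b, q, q'⟩
  left_inv _ := rfl
  right_inv _ := rfl

/-- The number carried by a value register, for the shift `s`. -/
def val (s : ℝ) : Option E → ℝ
  | none => 0
  | some x => (x : ℝ) - s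

/-- `|x⟩|𝟎⟩ ↦ |x⟩|x - s⟩`. -/
def shiftGate : Matrix.unitaryGroup ((G × E) × Work E M) ℂ :=
  onRegister regShift fun ⟨h, _⟩ => permGate (Equiv.swap none (some h.2))

/-- `|v⟩|𝟎⟩ ↦ |v⟩|v⟩` if `v ∈ [L, H]`, and `|v⟩|𝟎⟩ ↦ |v⟩|𝟎⟩` otherwise. -/
def truncGate (s L H : ℝ) : Matrix.unitaryGroup ((G × E) × Work E M) ℂ :=
  onRegister regTrunc fun ⟨_, a, _⟩ =>
    if L ≤ val s a ∧ val s a ≤ H then permGate (Equiv.swap none a) else 1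

/-- `|v⟩|0⟩ ↦ |v⟩ (√((v-L)/(H-L)) |1⟩ + √((H-v)/(H-L)) |0⟩)` for `v ∈ [L, H]`. -/
def rotGate (s L H : ℝ) : Matrix.unitaryGroup ((G × E) × Work E M) ℂ :=
  onRegister regRot fun ⟨_, _, b, _⟩ => rotation (Real.arcsin √((val s b - L) / (H - L)))

/-- CNOT, the first qubit controlling the second. -/
def cnotGate : Matrix.unitaryGroup ((G × E) × Work E M) ℂ :=
  onRegister regFlag fun ⟨_, _, _, q, _⟩ => if q = 1 then permGate (Equiv.swap 0 1) else 1

/-- The oracle `O_{X'}` of the shifted random variable `X' = X - s`. -/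
def shiftedOracle (i : Fin T) : Circuit T (G × E) (Work E M) :=
  [.query i false fun _ => true, .gate shiftGate]

/-- The oracle `O_{X̃}` of the random variable `X̃` that is `X'` if `X' ∈ [L, H]`, and `0` otherwise. -/
def truncatedOracle (s L H : ℝ) (i : Fin T) : Circuit T (G × E) (Work E M) :=
  shiftedOracle i ++ [.gate (truncGate s L H)]

/-- `U = (controlled rotation) O_{X̃}`. -/
def circuitU (s L H : ℝ) (i : Fin T) : Circuit T (G × E) (Work E M) :=
  truncatedOracle s L H i ++ [.gate (rotGate s L H)]

/-- `V = (U† ⊗ I) (I ⊗ CNOT) (U ⊗ I)`. -/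
def circuitV (s L H : ℝ) (i : Fin T) : Circuit T (G × E) (Work E M) :=
  circuitU s L H i ++ [.gate cnotGate] ++ (circuitU s L H i).inv

/-- The registers of `U` are in the state `|𝟎⟩|0⟩`. -/
abbrev IsZeroU (z : G × E) (b : (G × E) × Work E M) : Prop :=
  b.1 = z ∧ b.2.shifted = none ∧ b.2.truncated = none ∧ b.2.rot = 0

/-- The registers of `V` are in the state `|𝟎⟩|0⟩|0⟩`. -/
abbrev IsZeroV (z : G × E) (b : (G × E) × Work E M) : Prop :=
  IsZeroU z b ∧ b.2.flag = 0

/-- `S = Fix (V, |𝟎⟩|0⟩⟨0|⟨𝟎| ⊗ I)`, the fixed-point search with the given angles. -/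
def circuitS (z : G × E) (s L H : ℝ) (angles : List (ℝ × ℝ)) (i : Fin T) :
    Circuit T (G × E) (Work E M) :=
  circuitV s L H i ++ angles.flatMap fun ang =>
    [.gate (phaseGate fun b => if IsZeroU z b then ang.2 else 0)] ++
      (circuitV s L H i).inv ++
      [.gate (phaseGate fun b => if IsZeroV z b then -ang.1 else 0)] ++ circuitV s L H i

/-- The Grover operator `Q = - S (I - 2|𝟎⟩⟨𝟎|) S† (I - 2 · I ⊗ |1⟩⟨1|)`, controlled on the phase
register being in a state `|j⟩` with `j ≥ k`. -/
def circuitQ (z : G × E) (s L H : ℝ) (angles : List (ℝ × ℝ)) (k : ℕ) (i : Fin T) :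
    Circuit T (G × E) (Work E M) :=
  [.gate (phaseGate fun b => if k ≤ (b.2.phase : ℕ) ∧ b.2.flag = 0 then Real.pi else 0)] ++
    (circuitS z s L H angles i).inv ++
    [.gate (phaseGate fun b => if k ≤ (b.2.phase : ℕ) ∧ IsZeroV z b then Real.pi else 0)] ++
    circuitS z s L H angles i

/-- Amplitude estimation with a phase register of dimension `M + 1`, in which the initial use of `S`
is replaced by the one for the oracle `r 0`, and the `k`-th Grover operator, `1 ≤ k ≤ M`, is built
from the one for the oracle `r k`. -/
def ampCircuit (z : G × E) (s L H : ℝ) (angles : List (ℝ × ℝ)) (r : Fin (M + 1) → Fin T) :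
    Circuit T (G × E) (Work E M) :=
  [.gate (onRegister regPhase fun _ => qft M)] ++ circuitS z s L H angles (r 0) ++
    (List.finRange M).flatMap (fun k : Fin M => circuitQ z s L H angles ((k : ℕ) + 1) (r k.succ)) ++
    [.gate (onRegister regPhase fun _ => (qft M)⁻¹)]

/-- The map `p ↦ (p - √(p(1-p))) / (2p - 1)`, in the equivalent form `√p / (√p + √(1-p))`, which is
also defined at `p = 1/2`. -/
def invAmp (p : ℝ) : ℝ := √p / (√p + √(1 - p))

/-- The estimate of the mean of random variables bounded in `[L, H]` from the measured value `y` of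
the phase register: the amplitude estimate is `sin² (πy / (M+1))`. -/
def boundedEstimate (L H : ℝ) (y : Fin (M + 1)) : ℝ :=
  invAmp (Real.sin (Real.pi * (y : ℕ) / ((M + 1 : ℕ) : ℝ)) ^ 2) * (H - L) + L

/-- `Δ = K max {√(4 log (128K/ε)), √(2 log (32R/ε))}`. -/
def truncWidth (K ε R : ℝ) : ℝ :=
  K * max √(4 * Real.log (128 * K / ε)) √(2 * Real.log (32 * R / ε))

/-- The truncation range is `[-bound, bound]`, with `bound = R + Δ` and `R = K`. -/
def bound (K ε : ℝ) : ℝ := K + truncWidth K ε K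

/-- The number `⌈8 log 20⌉` of classical experiments. -/
def numSamples : ℕ := ⌈8 * Real.log 20⌉₊

/-- The amplitude estimation has a phase register of dimension `phaseDim + 1`, which is
`O((H - L)/ε)`. -/
def phaseDim (κ K ε : ℝ) : ℕ := ⌊κ * (2 * bound K ε) / ε⌋₊

/-- The precision `O(ε²/(H - L)²)` of the fixed-point searches. -/
def searchPrecision (κ K ε : ℝ) : ℝ := κ * (ε ^ 2 / (2 * bound K ε) ^ 2)

/-- Perform one classical experiment on each oracle of a list (apply it to `|𝟎⟩` and measure the
value register), and continue with the sum of `acc` and the samples. -/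
def sampleSum : List (Fin T) → ℝ → (ℝ → Algorithm T (G × E) (Work E M)) →
    Algorithm T (G × E) (Work E M)
  | [], acc, next => next acc
  | i :: l, acc, next =>
      .round [.query i false fun _ => true] fun b => sampleSum l (acc + (b.1.2 : ℝ)) next

/-- The algorithm for sub-Gaussian random variables. The classical experiments are performed on the
oracles `c 0, c 1, …`; their average `s` is the shift; the estimate of the mean of the shifted
random variables, obtained by truncation to `[-bound, bound]` and amplitude estimation with the
oracles `r 0, r 1, …`, is shifted back by `s`. -/
def subGaussianAlgorithm (fix : ℝ → List (ℝ × ℝ)) (κM κS K ε : ℝ) (z : G × E)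
    (c : Fin numSamples → Fin T) (r : Fin (phaseDim κM K ε + 1) → Fin T) :
    Algorithm T (G × E) (Work E (phaseDim κM K ε)) :=
  sampleSum (List.ofFn c) 0 fun total =>
    let s := total / numSamples
    .round (ampCircuit z s (-bound K ε) (bound K ε) (fix (searchPrecision κS K ε)) r) fun b =>
      .output (boundedEstimate (-bound K ε) (bound K ε) b.2.phase + s)

end Estimation

/-- The quantity `K √(log (K/ε)) / ε`. -/
def rate (K ε : ℝ) : ℝ := K * √(Real.log (K / ε)) / ε

/-- The algorithm solves the quantum non-identical mean estimation problem with repetition parameter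
`m`, accuracy `ε` and mean difference `δ` for sub-Gaussian random variables with parameter `K`. -/
def SolvesSubGaussian {T : ℕ} {G : Type} [Fintype G] [DecidableEq G] {E : Finset ℝ} {M : ℕ}
    (z : G × E) (A : Algorithm T (G × E) (Work E M)) (m : ℕ) (ε δ K : ℝ) : Prop :=
  (∀ i, A.queriesTo i ≤ m) ∧
  ∀ (μ : ℝ) (p : Fin T → E → ℝ) (O : Fin T → Matrix.unitaryGroup (G × E) ℂ),
    (∀ i, p i ∈ stdSimplex ℝ E) → (∀ i, Encodes z (O i) (p i)) → (∀ i, SubGaussian K (p i)) →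
    (∀ i, |mean (p i) - μ| ≤ δ) →
    2 / 3 ≤ A.prob O (z, blank E M) {x | |x - μ| ≤ ε}

end QMean

end

set_option linter.unusedSectionVars false

noncomputable section

namespace QMean

/-! The oracles encode different laws with unrelated garbage, so they cannot simply be interchanged
inside amplitude estimation. The remedy is to reduce each oracle to a qubit state that depends on
the truncated mean alone.

Let x be the mean of the shifted and truncated variable divided by H, so |x| ≤ 1. The components of
V|𝟎⟩ on the blank registers are (1 - x)/2 and (1 + x)/2 (`circuitV_entry`): a probability has become
an amplitude and the garbage is gone. This part has norm √((1 + x²)/2) ≥ 1/√2 for every x, which is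
what fixed-point search asks for, so S prepares, up to a phase and an error η, a qubit state on the
unit circle (`circuitS_close`). The search itself is Grover's π/3 recursion, where each level cubes
the amplitude off the target (`grover_step`).

Read a real qubit state Re c|0⟩ + Im c|1⟩ as the complex number c. With exact searches the Grover
operator of oracle i multiplies c by `amp (x i) ^ 2`, and the phases left by the searches cancel in
its reflection. In branch j of the phase register the state is thus close to a unit number c_j whose
successive ratios lie within B of ζ = `amp x₀ ^ 2`, with x₀ = (μ - s)/H (`groverOp_close`,
`idealAmp_succ`). Comparing c_j with ζ^j fails, since the bound MB on the accumulated drift is of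
order 10⁴. Instead, the sequence c is an approximate eigenvector of the cyclic shift, which the
Fourier transform turns into multiplication by the roots of unity χ_y. Hence the weight on {y : |χ_y
- ζ| ≥ d} is about (B/d)², whatever M is (`sum_qft_inv_le`). A trapezoidal window repairs the
wrap-around, and a real state contains both c and its conjugate, so ζ and its conjugate are both
admitted (`badPart_window_le`, `sum_bad_le`). A wrong estimate forces d = (7/5)ε/H, while δ < ε/4
and a bias of at most ε/100 give B = (52/100)ε/H. The ratio is small enough for success probability
3/4.

On the classical side, the tail bound gives an exponential moment, hence a variance bound and a
truncation bias far below ε. The shift s need only be within 39K of μ, because the constant c is so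
small that H ≥ 2001K. Averaging a quadratic lower bound over the samples (`le_prob_sampleSum`, in
effect Chebyshev) leaves 2/3. The costs follow by counting: one S uses O(log(1/η)) experiments, and
with injective choices of oracles each oracle serves at most one sample and one position of the
amplitude estimation. -/

/-! ## The `ℓ²` norm of a state -/

section L2

variable {n : Type*} [Fintype n]

/-- The `ℓ²` norm of a state. -/
def l2 (v : n → ℂ) : ℝ := ‖WithLp.toLp 2 v‖

theorem l2_sq (v : n → ℂ) : l2 v ^ 2 = ∑ i, ‖v i‖ ^ 2 := by
  rw [l2, EuclideanSpace.norm_sq_eq]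

theorem l2_nonneg (v : n → ℂ) : 0 ≤ l2 v := norm_nonneg _

theorem l2_add_le (v w : n → ℂ) : l2 (v + w) ≤ l2 v + l2 w := by
  rw [l2, WithLp.toLp_add]; exact norm_add_le _ _

theorem l2_smul (c : ℂ) (v : n → ℂ) : l2 (c • v) = ‖c‖ * l2 v := by
  rw [l2, WithLp.toLp_smul, norm_smul, l2]

theorem l2_sub_comm (v w : n → ℂ) : l2 (v - w) = l2 (w - v) := by
  rw [l2, l2, WithLp.toLp_sub, WithLp.toLp_sub, norm_sub_rev]

theorem l2_sub_le (u v w : n → ℂ) : l2 (u - w) ≤ l2 (u - v) + l2 (v - w) := by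
  have := l2_add_le (u - v) (v - w)
  rwa [sub_add_sub_cancel] at this

theorem l2_eq_of_sq {v : n → ℂ} {r : ℝ} (hr : 0 ≤ r) (h : l2 v ^ 2 = r ^ 2) : l2 v = r :=
  (sq_eq_sq₀ (l2_nonneg v) hr).1 h

theorem star_dotProduct_self (v : n → ℂ) : star v ⬝ᵥ v = ((l2 v ^ 2 : ℝ) : ℂ) := by
  rw [l2_sq, dotProduct]
  push_cast
  refine Finset.sum_congr rfl fun i _ => ?_
  simp [Complex.conj_mul']

theorem norm_star_dotProduct_le (v w : n → ℂ) : ‖star v ⬝ᵥ w‖ ≤ l2 v * l2 w := by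
  have h := norm_inner_le_norm (𝕜 := ℂ) (WithLp.toLp 2 v) (WithLp.toLp 2 w)
  rw [EuclideanSpace.inner_eq_star_dotProduct, dotProduct_comm] at h
  exact h

variable [DecidableEq n]

theorem star_mulVec_dotProduct (U : Matrix.unitaryGroup n ℂ) (v w : n → ℂ) :
    star ((U : Matrix n n ℂ) *ᵥ v) ⬝ᵥ ((U : Matrix n n ℂ) *ᵥ w) = star v ⬝ᵥ w := by
  rw [Matrix.star_mulVec, ← Matrix.dotProduct_mulVec, Matrix.mulVec_mulVec]
  have h := Matrix.mem_unitaryGroup_iff'.1 U.2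
  rw [Matrix.star_eq_conjTranspose] at h
  rw [h, Matrix.one_mulVec]

theorem l2_unitary (U : Matrix.unitaryGroup n ℂ) (v : n → ℂ) :
    l2 ((U : Matrix n n ℂ) *ᵥ v) = l2 v := by
  apply l2_eq_of_sq (l2_nonneg v)
  have h := star_mulVec_dotProduct U v v
  rw [star_dotProduct_self, star_dotProduct_self] at h
  exact_mod_cast h

theorem l2_ket (z : n) : l2 (ket z) = 1 := by
  apply l2_eq_of_sq zero_le_one
  rw [l2_sq, Finset.sum_eq_single z]
  · simp [ket]
  · intro b _ hb; simp [ket, hb]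
  · simp

theorem mul_single_mul_conjTranspose (V : Matrix n n ℂ) (z : n) :
    V * Matrix.single z z 1 * Vᴴ = Matrix.vecMulVec (V *ᵥ ket z) (star (V *ᵥ ket z)) := by
  rw [ket, Matrix.mulVec_single_one]
  ext i j
  simp [Matrix.mul_apply, Matrix.single_apply, Matrix.vecMulVec_apply, ite_and]

end L2

/-! ## Grover's `π/3` fixed-point search -/

section Grover

variable {n : Type} [Fintype n] [DecidableEq n]

/-- `A S₀(α) B S_P(β)`. -/
def searchBlock (A B : Matrix n n ℂ) (z : n) (P : Matrix n n ℂ) (α β : ℝ) : Matrix n n ℂ :=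
  A * (1 - (1 - Complex.exp (-α * Complex.I)) • Matrix.single z z 1) * B *
    (1 - (1 - Complex.exp (β * Complex.I)) • P)

theorem single_phase_conjTranspose (z : n) (α : ℝ) :
    ((1 : Matrix n n ℂ) - (1 - Complex.exp (-α * Complex.I)) • Matrix.single z z 1)ᴴ =
      1 - (1 - Complex.exp (-((-α : ℝ) : ℂ) * Complex.I)) • Matrix.single z z 1 := by
  simp [Matrix.conjTranspose_sub, ← Complex.exp_conj]

theorem proj_phase_conjTranspose {P : Matrix n n ℂ} (hP : P.IsHermitian) (β : ℝ) :
    ((1 : Matrix n n ℂ) - (1 - Complex.exp (β * Complex.I)) • P)ᴴ =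
      1 - (1 - Complex.exp (((-β : ℝ) : ℂ) * Complex.I)) • P := by
  simp [Matrix.conjTranspose_sub, Matrix.conjTranspose_smul, ← Complex.exp_conj, hP.eq]

theorem one_sub_smul_mul_conjTranspose {P : Matrix n n ℂ} (hP : P.IsHermitian) (hPP : P * P = P)
    {w : ℂ} (hw : ‖w‖ = 1) : (1 - (1 - w) • P) * (1 - (1 - w) • P)ᴴ = 1 := by
  have h1 : w * star w = 1 := by
    simp [Complex.mul_conj', hw]
  have h2 : (1 - star w) * (1 - w) = (1 - w) + (1 - star w) := by linear_combination h1
  rw [Matrix.conjTranspose_sub, Matrix.conjTranspose_smul, hP.eq, Matrix.conjTranspose_one,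
    mul_sub, sub_mul, Matrix.mul_smul, sub_mul, Matrix.smul_mul, Matrix.smul_mul, hPP, smul_sub, smul_smul,
    star_sub, star_one, h2, mul_one, one_mul, mul_one]
  module

/-- The operator of a list of search iterations, the head being performed first. -/
def searchOp (A : Matrix.unitaryGroup n ℂ) (z : n) (P : Matrix n n ℂ) :
    List (ℝ × ℝ) → Matrix n n ℂ
  | [] => 1
  | ang :: l => searchOp A z P l * searchBlock A (A : Matrix n n ℂ)ᴴ z P ang.1 ang.2

variable (A : Matrix.unitaryGroup n ℂ) (z : n) (P : Matrix n n ℂ)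

theorem searchOp_append (l l' : List (ℝ × ℝ)) :
    searchOp A z P (l ++ l') = searchOp A z P l' * searchOp A z P l := by
  induction l with
  | nil => simp [searchOp]
  | cons a l ih => simp [searchOp, ih, mul_assoc]

theorem searchOp_mem {P : Matrix n n ℂ} (hP : P.IsHermitian) (hPP : P * P = P)
    (l : List (ℝ × ℝ)) : searchOp A z P l ∈ Matrix.unitaryGroup n ℂ := by
  induction l with
  | nil => exact one_mem _
  | cons a l ih =>
    refine mul_mem ih (mul_mem (mul_mem (mul_mem A.2 ?_) (A⁻¹).2) ?_)
    · rw [Matrix.mem_unitaryGroup_iff, Matrix.star_eq_conjTranspose]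
      refine one_sub_smul_mul_conjTranspose ?_ ?_ ?_
      · simp [Matrix.IsHermitian]
      · simp
      · simpa using Complex.norm_exp_ofReal_mul_I (-a.1)
    · rw [Matrix.mem_unitaryGroup_iff, Matrix.star_eq_conjTranspose]
      exact one_sub_smul_mul_conjTranspose hP hPP (Complex.norm_exp_ofReal_mul_I a.2)

/-- The iterations that perform `A S₀(α) V† S_P(β)`, where `V` is the search with the iterations
`l`; the argument is the reversal of `l`. -/
def reflectList (α : ℝ) : List (ℝ × ℝ) → ℝ → List (ℝ × ℝ)
  | [], β => [(α, β)]
  | ang :: l, β => (-ang.1, β) :: reflectList α l (-ang.2)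

theorem length_reflectList (α β : ℝ) (l : List (ℝ × ℝ)) :
    (reflectList α l β).length = l.length + 1 := by
  induction l generalizing β with
  | nil => rfl
  | cons a l ih => simp [reflectList, ih]

/-- The adjoint of a product of blocks A S₀ A† S_P is again such a product after shifting the
brackets by one factor: each new block takes its S₀ from one old iteration and its S_P from the
neighbouring one, with negated angles. The recursion V ↦ V S₀ V† S_P V thus stays within lists of
angles. -/
theorem searchOp_reflectList {P : Matrix n n ℂ} (hP : P.IsHermitian) (α β : ℝ)
    (l : List (ℝ × ℝ)) :
    searchOp A z P (reflectList α l β) =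
      searchBlock A (searchOp A z P l.reverse * A.1)ᴴ z P α β := by
  induction l generalizing β with
  | nil => simp [reflectList, searchOp]
  | cons a l ih =>
    rw [reflectList, searchOp, ih, List.reverse_cons, searchOp_append]
    simp only [searchOp, searchBlock, Matrix.conjTranspose_mul, one_mul,
      Matrix.conjTranspose_conjTranspose, single_phase_conjTranspose,
      proj_phase_conjTranspose hP, mul_assoc]

/-- The iterations of the next level of the `π/3` search. -/
def nextList (l : List (ℝ × ℝ)) : List (ℝ × ℝ) :=
  l ++ (reflectList (-(Real.pi / 3)) l.reverse (Real.pi / 3) ++ l)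

/-- The iterations of the `k`-th level of the `π/3` search. -/
def groverList : ℕ → List (ℝ × ℝ)
  | 0 => []
  | k + 1 => nextList (groverList k)

theorem length_groverList (k : ℕ) : 2 * (groverList k).length + 1 = 3 ^ k := by
  induction k with
  | zero => rfl
  | succ k ih =>
    rw [groverList, nextList, List.length_append, List.length_append, length_reflectList,
      List.length_reverse, pow_succ]
    omega

theorem searchOp_nextList {P : Matrix n n ℂ} (hP : P.IsHermitian) (l : List (ℝ × ℝ)) :
    searchOp A z P (nextList l) * A.1 =
      searchBlock (searchOp A z P l * A.1) (searchOp A z P l * A.1)ᴴ z P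
        (-(Real.pi / 3)) (Real.pi / 3) * (searchOp A z P l * A.1) := by
  rw [nextList, searchOp_append, searchOp_append, searchOp_reflectList A z hP,
    List.reverse_reverse]
  simp only [searchBlock, mul_assoc]

/-- The reason for the angle π/3: with w = exp(iπ/3) this says (1 - w)² = -w. -/
theorem exp_pi_div_three : Complex.exp (Real.pi / 3 * Complex.I) ^ 2 =
    Complex.exp (Real.pi / 3 * Complex.I) - 1 := by
  have h : Complex.exp (Real.pi / 3 * Complex.I) = (1 / 2 : ℝ) + (√3 / 2 : ℝ) * Complex.I := by
    rw [Complex.exp_mul_I]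
    rw [← Real.cos_pi_div_three, ← Real.sin_pi_div_three]
    push_cast
    rfl
  rw [h]
  have h3 : ((√3 : ℝ) : ℂ) ^ 2 = 3 := by
    rw [← Complex.ofReal_pow, Real.sq_sqrt (by norm_num)]; simp
  push_cast
  linear_combination (1 / 4 : ℂ) * (Complex.I ^ 2 * h3) + (3 / 4 : ℂ) * Complex.I_sq

theorem searchBlock_mulVec (V : Matrix n n ℂ) (x : n → ℂ) (α β : ℝ) :
    searchBlock V Vᴴ z P α β *ᵥ x =
      V *ᵥ (Vᴴ *ᵥ (x - (1 - Complex.exp (β * Complex.I)) • (P *ᵥ x))) -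
      ((1 - Complex.exp (-α * Complex.I)) *
        (star (V *ᵥ ket z) ⬝ᵥ (x - (1 - Complex.exp (β * Complex.I)) • (P *ᵥ x)))) •
        (V *ᵥ ket z) := by
  have h : searchBlock V Vᴴ z P α β = (V * Vᴴ - (1 - Complex.exp (-α * Complex.I)) •
      (V * Matrix.single z z 1 * Vᴴ)) * (1 - (1 - Complex.exp (β * Complex.I)) • P) := by
    rw [searchBlock]
    congr 1
    rw [mul_sub, sub_mul, mul_one, Matrix.mul_smul, Matrix.smul_mul]
  rw [h, mul_single_mul_conjTranspose, ← Matrix.mulVec_mulVec, Matrix.sub_mulVec,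
    Matrix.sub_mulVec, Matrix.one_mulVec, Matrix.smul_mulVec, Matrix.smul_mulVec,
    Matrix.vecMulVec_mulVec, Matrix.mulVec_mulVec, op_smul_eq_smul, smul_smul]

/-- One level of the `π/3` search. -/
theorem grover_step {P : Matrix n n ℂ} (hP : P.IsHermitian) (hPP : P * P = P)
    {V : Matrix n n ℂ} (hV : V ∈ Matrix.unitaryGroup n ℂ) :
    let u := V *ᵥ ket z
    let u' := searchBlock V Vᴴ z P (-(Real.pi / 3)) (Real.pi / 3) *ᵥ u
    (∃ s : ℂ, P *ᵥ u' = s • (P *ᵥ u)) ∧ l2 (u' - P *ᵥ u') = l2 (u - P *ᵥ u) ^ 3 := by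
  intro u u'
  have hVV : V * Vᴴ = 1 := by
    rw [← Matrix.star_eq_conjTranspose]; exact Matrix.mem_unitaryGroup_iff.1 hV
  have hu : star u ⬝ᵥ u = 1 := by
    have : l2 u = 1 := by rw [← l2_ket z]; exact l2_unitary ⟨V, hV⟩ _
    rw [star_dotProduct_self, this]; simp
  have hPPu : P *ᵥ (P *ᵥ u) = P *ᵥ u := by rw [Matrix.mulVec_mulVec, hPP]
  have hPu : star (P *ᵥ u) ⬝ᵥ (P *ᵥ u) = star u ⬝ᵥ (P *ᵥ u) := by
    rw [Matrix.star_mulVec, ← Matrix.dotProduct_mulVec, hP.eq, hPPu]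
  have hPu' : star (P *ᵥ u) ⬝ᵥ u = star u ⬝ᵥ (P *ᵥ u) := by
    rw [Matrix.star_mulVec, ← Matrix.dotProduct_mulVec, hP.eq]
  have ht : star u ⬝ᵥ (P *ᵥ u) = 1 - ((l2 (u - P *ᵥ u) ^ 2 : ℝ) : ℂ) := by
    rw [← star_dotProduct_self, star_sub, sub_dotProduct, dotProduct_sub, dotProduct_sub, hPu,
      hPu', hu]
    ring
  set w : ℂ := Complex.exp (Real.pi / 3 * Complex.I) with hw
  have hw2 : w ^ 2 = w - 1 := exp_pi_div_three
  have hw1 : ‖w‖ = 1 := by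
    have := Complex.norm_exp_ofReal_mul_I (Real.pi / 3)
    rw [hw]; push_cast at this; exact this
  set τ : ℝ := l2 (u - P *ᵥ u) with hτ
  have hform : u' = (u - (1 - w) • (P *ᵥ u)) -
      ((1 - w) * (1 - (1 - w) * (1 - ((τ ^ 2 : ℝ) : ℂ)))) • u := by
    change searchBlock V Vᴴ z P (-(Real.pi / 3)) (Real.pi / 3) *ᵥ u = _
    rw [searchBlock_mulVec, Matrix.mulVec_mulVec, hVV, Matrix.one_mulVec]
    have e1 : Complex.exp (-((-(Real.pi / 3) : ℝ) : ℂ) * Complex.I) = w := by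
      rw [hw]; push_cast; ring_nf
    have e2 : Complex.exp (((Real.pi / 3 : ℝ) : ℂ) * Complex.I) = w := by
      rw [hw]; push_cast; ring_nf
    rw [e1, e2]
    change _ - ((1 - w) * (star u ⬝ᵥ (u - (1 - w) • (P *ᵥ u)))) • u = _
    rw [dotProduct_sub, dotProduct_smul, hu, ht, smul_eq_mul]
  have hPu'' : P *ᵥ u' = (w - (1 - w) * (1 - (1 - w) * (1 - ((τ ^ 2 : ℝ) : ℂ)))) • (P *ᵥ u) := by
    rw [hform, Matrix.mulVec_sub, Matrix.mulVec_sub, Matrix.mulVec_smul, Matrix.mulVec_smul, hPPu]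
    module
  refine ⟨⟨_, hPu''⟩, ?_⟩
  -- The factor 1 - (1 - w) + (1 - w)²(1 - τ²) collapses to wτ² because (1 - w)² = -w; its modulus
  -- τ² cubes the error.
  have hrest : u' - P *ᵥ u' = (w * ((τ ^ 2 : ℝ) : ℂ)) • (u - P *ᵥ u) := by
    rw [hPu'', hform]
    have : w * ((τ ^ 2 : ℝ) : ℂ) = 1 - (1 - w) * (1 - (1 - w) * (1 - ((τ ^ 2 : ℝ) : ℂ))) := by
      linear_combination (((τ ^ 2 : ℝ) : ℂ) - 1) * hw2
    rw [this]
    module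
  rw [hrest, l2_smul, norm_mul, hw1, Complex.norm_real, Real.norm_of_nonneg (sq_nonneg _)]
  ring

/-- The component in the range of P never leaves the line of φ, so only the norm of the other
component has to be tracked, and it is cubed at each level. -/
theorem grover_level {P : Matrix n n ℂ} (hP : P.IsHermitian) (hPP : P * P = P)
    {l : ℝ} {φ : n → ℂ} (h : P *ᵥ ((A : Matrix n n ℂ) *ᵥ ket z) = (l : ℂ) • φ) (k : ℕ) :
    let u := (searchOp A z P (groverList k) * A.1) *ᵥ ket z
    (∃ s : ℂ, P *ᵥ u = s • φ) ∧
      l2 (u - P *ᵥ u) = l2 ((A : Matrix n n ℂ) *ᵥ ket z - (l : ℂ) • φ) ^ 3 ^ k := by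
  induction k with
  | zero => simpa [groverList, searchOp, h] using ⟨(l : ℂ), rfl⟩
  | succ k ih =>
    obtain ⟨⟨s, hs⟩, h2⟩ := ih
    obtain ⟨⟨s', hs'⟩, h2'⟩ := grover_step z hP hPP
      (mul_mem (searchOp_mem A z hP hPP (groverList k)) A.2)
    intro u
    have hu : u = searchBlock (searchOp A z P (groverList k) * A.1)
        (searchOp A z P (groverList k) * A.1)ᴴ z P (-(Real.pi / 3)) (Real.pi / 3) *ᵥ
        ((searchOp A z P (groverList k) * A.1) *ᵥ ket z) := by
      change (searchOp A z P (nextList (groverList k)) * A.1) *ᵥ ket z = _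
      rw [searchOp_nextList A z hP, Matrix.mulVec_mulVec]
    rw [hu]
    refine ⟨⟨s' * s, by rw [hs', hs, smul_smul]⟩, ?_⟩
    rw [h2', h2, ← pow_mul, pow_succ]

theorem l2_sq_eq_add {P : Matrix n n ℂ} (hP : P.IsHermitian) (hPP : P * P = P) (u : n → ℂ) :
    l2 u ^ 2 = l2 (P *ᵥ u) ^ 2 + l2 (u - P *ᵥ u) ^ 2 := by
  have hPPu : P *ᵥ (P *ᵥ u) = P *ᵥ u := by rw [Matrix.mulVec_mulVec, hPP]
  have hPu : star (P *ᵥ u) ⬝ᵥ (P *ᵥ u) = star u ⬝ᵥ (P *ᵥ u) := by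
    rw [Matrix.star_mulVec, ← Matrix.dotProduct_mulVec, hP.eq, hPPu]
  have hPu' : star (P *ᵥ u) ⬝ᵥ u = star u ⬝ᵥ (P *ᵥ u) := by
    rw [Matrix.star_mulVec, ← Matrix.dotProduct_mulVec, hP.eq]
  have : ((l2 u ^ 2 : ℝ) : ℂ) =
      ((l2 (P *ᵥ u) ^ 2 : ℝ) : ℂ) + ((l2 (u - P *ᵥ u) ^ 2 : ℝ) : ℂ) := by
    rw [← star_dotProduct_self, ← star_dotProduct_self, ← star_dotProduct_self, star_sub,
      sub_dotProduct, dotProduct_sub, dotProduct_sub, hPu, hPu']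
    ring
  exact_mod_cast this

theorem searchState_eq (l : List (ℝ × ℝ)) :
    searchState A z P l = (searchOp A z P l * A.1) *ᵥ ket z := by
  rw [searchState, ← Matrix.mulVec_mulVec]
  generalize (A : Matrix n n ℂ) *ᵥ ket z = v
  induction l generalizing v with
  | nil => simp [searchOp]
  | cons a l ih =>
    rw [List.foldl_cons, ih, searchOp, ← Matrix.mulVec_mulVec]
    rfl

end Grover
/-- A state whose component off the line of `φ` is small is close to `φ` up to a phase. -/
theorem exists_phase_close {n : Type*} [Fintype n] {u φ : n → ℂ} {s : ℂ} {τ : ℝ}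
    (hφ : l2 φ = 1) (hsum : 1 = ‖s‖ ^ 2 + τ ^ 2) (hτ : l2 (u - s • φ) = τ) :
    ∃ ω : ℂ, ‖ω‖ = 1 ∧ l2 (ω • φ - u) ≤ 2 * τ := by
  have hτ0 : 0 ≤ τ := hτ ▸ l2_nonneg _
  obtain ⟨ω, hω, hsω⟩ : ∃ ω : ℂ, ‖ω‖ = 1 ∧ s = ‖s‖ * ω := by
    refine ⟨Complex.exp (s.arg * Complex.I), Complex.norm_exp_ofReal_mul_I _, ?_⟩
    exact (Complex.norm_mul_exp_arg_mul_I s).symm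
  refine ⟨ω, hω, ?_⟩
  have h1 := l2_sub_le (ω • φ) (s • φ) u
  rw [l2_sub_comm (s • φ) u, hτ, ← sub_smul, l2_smul, hφ, mul_one] at h1
  have h2 : ‖ω - s‖ = 1 - ‖s‖ := by
    have hs1 : ‖s‖ ≤ 1 := by nlinarith [norm_nonneg s, sq_nonneg τ]
    have : ω - s = ((1 - ‖s‖ : ℝ) : ℂ) * ω := by
      nth_rewrite 1 [hsω]; push_cast; ring
    rw [this, norm_mul, hω, mul_one, Complex.norm_real, Real.norm_of_nonneg (by linarith)]
  -- Indeed 1 - |s| ≤ 1 - |s|² = τ² ≤ τ.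
  have h3 : 1 - ‖s‖ ≤ τ := by
    have hs1 : ‖s‖ ≤ 1 := by nlinarith [norm_nonneg s, sq_nonneg τ]
    have hτ1 : τ ≤ 1 := by nlinarith [norm_nonneg s]
    nlinarith [norm_nonneg s]
  linarith

/-- Enough levels for precision `η`. -/
theorem exists_level {η : ℝ} (h0 : 0 < η) (h1 : η ≤ 1 / 2) :
    ∃ k : ℕ, (1 / √2) ^ 3 ^ k ≤ η / 2 ∧
      ((groverList k).length : ℝ) ≤ 9 / Real.log 2 * Real.log (1 / η) := by
  have hl2 : 0 < Real.log 2 := Real.log_pos (by norm_num)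
  have hlog : Real.log 2 ≤ Real.log (1 / η) := by
    apply Real.log_le_log (by norm_num)
    rw [le_div_iff₀ h0]; linarith
  -- With 3^(k+1) > y the error is at most exp(-2 log(1/η)) = η² ≤ η/2, while 3^k ≤ y keeps the list
  -- of length O(log(1/η)).
  set y : ℝ := 4 * (Real.log (1 / η) / Real.log 2) with hy
  have hr1 : 1 ≤ Real.log (1 / η) / Real.log 2 := (one_le_div hl2).2 hlog
  have hy1 : 1 ≤ y := by linarith
  obtain ⟨k, hk1, hk2⟩ := exists_nat_pow_near hy1 (by norm_num : (1 : ℝ) < 3)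
  refine ⟨k + 1, ?_, ?_⟩
  · have hs2 : (1 / √2 : ℝ) = Real.exp (-(Real.log 2 / 2)) := by
      rw [Real.exp_neg, ← Real.log_sqrt (by norm_num), Real.exp_log (by positivity), one_div]
    have : η / 2 = Real.exp (-(Real.log (1 / η) + Real.log 2)) := by
      rw [neg_add, Real.exp_add, one_div, Real.log_inv, neg_neg, Real.exp_log h0, Real.exp_neg,
        Real.exp_log (by norm_num)]
      rfl
    rw [hs2, this, ← Real.exp_nat_mul]
    apply Real.exp_le_exp.2
    push_cast
    have h4 : y * Real.log 2 = 4 * Real.log (1 / η) := by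
      rw [hy]; field_simp
    nlinarith
  · have hlen : (2 * ((groverList (k + 1)).length : ℝ) + 1) = 3 ^ (k + 1) := by
      exact_mod_cast length_groverList (k + 1)
    rw [pow_succ] at hlen
    have : 9 / Real.log 2 * Real.log (1 / η) = 9 / 4 * y := by rw [hy]; ring
    rw [this]
    linarith

theorem exists_isFixedPointSearch : ∃ fix, IsFixedPointSearch fix := by
  have key : ∀ η : ℝ, ∃ l : List (ℝ × ℝ), 0 < η → η ≤ 1 / 2 → ∃ k : ℕ, l = groverList k ∧
      (1 / √2) ^ 3 ^ k ≤ η / 2 ∧ (l.length : ℝ) ≤ 9 / Real.log 2 * Real.log (1 / η) := by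
    intro η
    by_cases h : 0 < η ∧ η ≤ 1 / 2
    · obtain ⟨k, h1, h2⟩ := exists_level h.1 h.2
      exact ⟨groverList k, fun _ _ => ⟨k, rfl, h1, h2⟩⟩
    · exact ⟨[], fun h0 h1 => absurd ⟨h0, h1⟩ h⟩
  choose fix hfix using key
  refine ⟨fix, ⟨9 / Real.log 2, div_pos (by norm_num) (Real.log_pos (by norm_num)),
    fun η h0 h1 => ?_⟩, ?_⟩
  · obtain ⟨k, -, -, h⟩ := hfix η h0 h1
    exact h
  · intro η h0 h1 n _ _ A z P l φ hP hPP hl hφ h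
    obtain ⟨k, hk, hk1, -⟩ := hfix η h0 h1
    change l2 φ = 1 at hφ
    have hs2 : (0 : ℝ) < 1 / √2 := by positivity
    obtain ⟨⟨s, hs⟩, h2⟩ := grover_level A z hP hPP h k
    rw [hk, searchState_eq]
    set u := (searchOp A z P (groverList k) * A.1) *ᵥ ket z with hu
    have hτ : l2 ((A : Matrix n n ℂ) *ᵥ ket z - (l : ℂ) • φ) ≤ 1 / √2 := by
      have h3 := l2_sq_eq_add hP hPP ((A : Matrix n n ℂ) *ᵥ ket z)
      rw [h, l2_unitary, l2_ket, l2_smul, hφ, Complex.norm_real, mul_one] at h3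
      apply le_of_sq_le_sq _ hs2.le
      have h4 : (1 / √2) ^ 2 ≤ ‖l‖ ^ 2 := by
        gcongr
        rw [Real.norm_of_nonneg (by linarith)]
        exact hl
      have h5 : (1 / √2 : ℝ) ^ 2 = 1 / 2 := by
        rw [div_pow, Real.sq_sqrt (by norm_num)]; norm_num
      rw [h5] at h4 ⊢
      linarith
    have hu1 : l2 u = 1 := by
      rw [← l2_ket z]
      exact l2_unitary ⟨_, mul_mem (searchOp_mem A z hP hPP (groverList k)) A.2⟩ _
    have h3 := l2_sq_eq_add hP hPP u
    rw [hu1, hs, l2_smul, hφ, mul_one, one_pow] at h3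
    rw [hs] at h2
    obtain ⟨ω, hω, hclose⟩ := exists_phase_close hφ h3 rfl
    refine ⟨ω, hω, hclose.trans ?_⟩
    have h6 : l2 (u - s • φ) ≤ (1 / √2) ^ 3 ^ k := by
      rw [h2]
      exact pow_le_pow_left₀ (l2_nonneg _) hτ _
    linarith

/-! ## Gates on a register -/

section Register

variable {n A R : Type} [Fintype n] [DecidableEq n] [Fintype A] [DecidableEq A] [Fintype R]
  [DecidableEq R]

theorem unitary_ext_mulVec {U V : Matrix.unitaryGroup n ℂ}
    (h : ∀ v b, ((U : Matrix n n ℂ) *ᵥ v) b = ((V : Matrix n n ℂ) *ᵥ v) b) : U = V := by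
  apply Subtype.ext
  ext i j
  have := h (Pi.single j 1) i
  rwa [Matrix.mulVec_single_one, Matrix.mulVec_single_one] at this

theorem onRegister_mulVec (e : A × R ≃ n) (U : R → Matrix.unitaryGroup A ℂ) (v : n → ℂ) (a : A)
    (r : R) : ((onRegister e U : Matrix n n ℂ) *ᵥ v) (e (a, r)) =
      ((U r : Matrix A A ℂ) *ᵥ fun a' => v (e (a', r))) a := by
  simp only [onRegister, Matrix.mulVec, dotProduct, Matrix.reindex_apply, Matrix.submatrix_apply,
    Equiv.symm_apply_apply]
  rw [← Equiv.sum_comp e, Fintype.sum_prod_type]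
  refine Finset.sum_congr rfl fun a' _ => ?_
  rw [Finset.sum_eq_single r]
  · simp
  · intro r' _ hr
    rw [Equiv.symm_apply_apply, Matrix.blockDiagonal_apply_ne _ _ _ hr.symm, zero_mul]
  · simp

theorem onRegister_refl_mulVec (U : R → Matrix.unitaryGroup A ℂ) (v : A × R → ℂ) (a : A) (r : R) :
    ((onRegister (Equiv.refl (A × R)) U).1 *ᵥ v) (a, r) =
      ((U r : Matrix A A ℂ) *ᵥ fun a' => v (a', r)) a :=
  onRegister_mulVec (Equiv.refl _) U v a r

theorem onRegister_mul (e : A × R ≃ n) (U V : R → Matrix.unitaryGroup A ℂ) :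
    onRegister e U * onRegister e V = onRegister e fun r => U r * V r := by
  refine unitary_ext_mulVec fun v b => ?_
  obtain ⟨⟨a, r⟩, rfl⟩ := e.surjective b
  rw [Submonoid.coe_mul, ← Matrix.mulVec_mulVec, onRegister_mulVec, onRegister_mulVec,
    Submonoid.coe_mul, ← Matrix.mulVec_mulVec]
  simp only [onRegister_mulVec]

theorem onRegister_one (e : A × R ≃ n) : onRegister e (fun _ => 1) = 1 := by
  refine unitary_ext_mulVec fun v b => ?_
  obtain ⟨⟨a, r⟩, rfl⟩ := e.surjective b
  rw [onRegister_mulVec]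
  simp

theorem onRegister_inv (e : A × R ≃ n) (U : R → Matrix.unitaryGroup A ℂ) :
    (onRegister e U)⁻¹ = onRegister e fun r => (U r)⁻¹ := by
  rw [inv_eq_iff_mul_eq_one, onRegister_mul]
  simp [onRegister_one]

theorem permGate_mulVec (σ : Equiv.Perm n) (v : n → ℂ) (b : n) :
    ((permGate σ : Matrix n n ℂ) *ᵥ v) b = v (σ b) := by
  rw [permGate, Matrix.permMatrix_mulVec]
  rfl

theorem phaseGate_mulVec (f : n → ℝ) (v : n → ℂ) (b : n) :
    ((phaseGate f : Matrix n n ℂ) *ᵥ v) b = Complex.exp (f b * Complex.I) * v b := by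
  rw [phaseGate, Matrix.mulVec_diagonal]

end Register

/-! ## The unitary of a circuit -/

section CircuitOp

variable {T : ℕ} {H W : Type} [Fintype H] [DecidableEq H] [Fintype W] [DecidableEq W]
  (O : Fin T → Matrix.unitaryGroup H ℂ)

/-- The unitary performed by a step. -/
def Step.op : Step T H W → Matrix.unitaryGroup (H × W) ℂ
  | .gate U => U
  | .query i inverse control => onRegister (Equiv.refl _) fun w =>
      if control w then (if inverse then (O i)⁻¹ else O i) else 1

theorem Step.matrix_eq (s : Step T H W) : s.matrix O = s.op O := by
  cases s with
  | gate U => rfl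
  | query i inverse control =>
    simp only [Step.matrix, Step.op, onRegister, Matrix.reindex_apply, Equiv.refl_symm,
      Equiv.coe_refl, Matrix.submatrix_id_id]
    congr 1
    funext w
    split_ifs <;> rfl

theorem Step.op_inv (s : Step T H W) : s.inv.op O = (s.op O)⁻¹ := by
  cases s with
  | gate U => rfl
  | query i inverse control =>
    simp only [Step.inv, Step.op, onRegister_inv]
    congr 1
    funext w
    cases inverse <;> by_cases h : control w = true <;> simp [h]

/-- The unitary performed by a circuit. -/
def Circuit.op (C : Circuit T H W) : Matrix.unitaryGroup (H × W) ℂ :=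
  (C.map (Step.op O)).reverse.prod

theorem Circuit.op_nil : Circuit.op O ([] : Circuit T H W) = 1 := rfl

theorem Circuit.op_singleton (s : Step T H W) : Circuit.op O [s] = s.op O := by
  simp [Circuit.op]

theorem Circuit.op_append (C D : Circuit T H W) :
    Circuit.op O (C ++ D) = Circuit.op O D * Circuit.op O C := by
  simp [Circuit.op]

theorem Circuit.op_cons (s : Step T H W) (C : Circuit T H W) :
    Circuit.op O (s :: C) = Circuit.op O C * s.op O := by
  simp [Circuit.op]

theorem Circuit.op_inv (C : Circuit T H W) : Circuit.op O C.inv = (Circuit.op O C)⁻¹ := by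
  induction C with
  | nil => simp [Circuit.inv, Circuit.op]
  | cons s C ih =>
    have h : Circuit.inv (s :: C) = Circuit.inv C ++ [s.inv] := by
      simp [Circuit.inv]
    rw [h, Circuit.op_append, ih, Circuit.op_singleton, Circuit.op_cons, mul_inv_rev, Step.op_inv]

theorem Circuit.run_eq (C : Circuit T H W) (v : H × W → ℂ) :
    Circuit.run O C v = (Circuit.op O C : Matrix (H × W) (H × W) ℂ) *ᵥ v := by
  induction C generalizing v with
  | nil => simp [Circuit.run, Circuit.op_nil]
  | cons s C ih =>
    have h : Circuit.run O (s :: C) v = Circuit.run O C (s.matrix O *ᵥ v) := rfl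
    rw [h, ih, Circuit.op_cons, Submonoid.coe_mul, ← Matrix.mulVec_mulVec, Step.matrix_eq]

end CircuitOp

/-! ## Splitting off the phase register -/

section Lift

variable {T : ℕ} {G : Type} [Fintype G] [DecidableEq G] {E : Finset ℝ} {M : ℕ}

variable (G E) in
/-- The computational basis without the phase register. -/
abbrev Core : Type := (G × E) × Work E 0

/-- The phase register and the other registers. -/
def join : Core G E × Fin (M + 1) ≃ (G × E) × Work E M where
  toFun := fun ⟨⟨h, w⟩, j⟩ => ⟨h, ⟨w.shifted, w.truncated, w.rot, w.flag, j⟩⟩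
  invFun := fun ⟨h, w⟩ => ⟨⟨h, ⟨w.shifted, w.truncated, w.rot, w.flag, 0⟩⟩, w.phase⟩
  left_inv := by
    rintro ⟨⟨h, ⟨a, b, q, q', i⟩⟩, j⟩
    have : i = 0 := Subsingleton.elim (α := Fin 1) _ _
    rw [this]
  right_inv _ := rfl

/-- A unitary of the other registers, controlled by the phase register. -/
abbrev lift (F : Fin (M + 1) → Matrix.unitaryGroup (Core G E) ℂ) :
    Matrix.unitaryGroup ((G × E) × Work E M) ℂ := onRegister join F

theorem shiftGate_mulVec (v : (G × E) × Work E M → ℂ) (h : G × E) (a b : Option E) (q q' : Fin 2)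
    (j : Fin (M + 1)) : ((shiftGate : Matrix.unitaryGroup ((G × E) × Work E M) ℂ).1 *ᵥ v)
      (h, ⟨a, b, q, q', j⟩) = v (h, ⟨Equiv.swap none (some h.2) a, b, q, q', j⟩) := by
  change ((onRegister regShift _).1 *ᵥ v) (regShift (a, (h, b, q, q', j))) = _
  rw [onRegister_mulVec, permGate_mulVec]
  rfl

theorem truncGate_mulVec (s L H : ℝ) (v : (G × E) × Work E M → ℂ) (h : G × E) (a b : Option E)
    (q q' : Fin 2) (j : Fin (M + 1)) :
    ((truncGate s L H : Matrix.unitaryGroup ((G × E) × Work E M) ℂ).1 *ᵥ v)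
      (h, ⟨a, b, q, q', j⟩) = v (h, ⟨a, if L ≤ val s a ∧ val s a ≤ H then
        Equiv.swap none a b else b, q, q', j⟩) := by
  change ((onRegister regTrunc _).1 *ᵥ v) (regTrunc (b, (h, a, q, q', j))) = _
  rw [onRegister_mulVec]
  split_ifs with hc
  · simp only [hc, and_self, if_true]
    rw [permGate_mulVec]
    rfl
  · simp only [hc, if_false]
    rw [OneMemClass.coe_one, Matrix.one_mulVec]
    rfl

theorem rotGate_mulVec (s L H : ℝ) (v : (G × E) × Work E M → ℂ) (h : G × E) (a b : Option E)
    (q q' : Fin 2) (j : Fin (M + 1)) :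
    ((rotGate s L H : Matrix.unitaryGroup ((G × E) × Work E M) ℂ).1 *ᵥ v)
      (h, ⟨a, b, q, q', j⟩) = ((rotation (Real.arcsin √((val s b - L) / (H - L)))).1 *ᵥ
        fun k => v (h, ⟨a, b, k, q', j⟩)) q := by
  change ((onRegister regRot _).1 *ᵥ v) (regRot (q, (h, a, b, q', j))) = _
  rw [onRegister_mulVec]
  rfl

theorem cnotGate_mulVec (v : (G × E) × Work E M → ℂ) (h : G × E) (a b : Option E) (q q' : Fin 2)
    (j : Fin (M + 1)) : ((cnotGate : Matrix.unitaryGroup ((G × E) × Work E M) ℂ).1 *ᵥ v)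
      (h, ⟨a, b, q, q', j⟩) =
        v (h, ⟨a, b, q, if q = 1 then Equiv.swap 0 1 q' else q', j⟩) := by
  change ((onRegister regFlag _).1 *ᵥ v) (regFlag (q', (h, a, b, q, j))) = _
  rw [onRegister_mulVec]
  split_ifs with hc
  · simp only [hc, if_true]
    rw [permGate_mulVec]
    rfl
  · simp only [hc, if_false]
    rw [OneMemClass.coe_one, Matrix.one_mulVec]
    rfl

theorem join_mk (h : G × E) (a b : Option E) (q q' : Fin 2) (i : Fin 1) (j : Fin (M + 1)) :
    join (((h, ⟨a, b, q, q', i⟩) : Core G E), j) = (h, ⟨a, b, q, q', j⟩) := rfl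

/-- For M = 0 the phase register is trivial, so `Core` models all the other registers. This and the
following `_lift` lemmas move the analysis of V, S and Q there, once for all M and all values of the
phase register. -/
theorem shiftGate_lift : (shiftGate : Matrix.unitaryGroup ((G × E) × Work E M) ℂ) =
    lift fun _ => shiftGate := by
  refine unitary_ext_mulVec fun v b => ?_
  obtain ⟨⟨⟨h, ⟨a, b, q, q', i⟩⟩, j⟩, rfl⟩ := join.surjective b
  rw [onRegister_mulVec, join_mk, shiftGate_mulVec, shiftGate_mulVec]
  simp only [join_mk]

theorem truncGate_lift (s L H : ℝ) : (truncGate s L H : Matrix.unitaryGroup ((G × E) × Work E M) ℂ) =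
    lift fun _ => truncGate s L H := by
  refine unitary_ext_mulVec fun v b => ?_
  obtain ⟨⟨⟨h, ⟨a, b, q, q', i⟩⟩, j⟩, rfl⟩ := join.surjective b
  rw [onRegister_mulVec, join_mk, truncGate_mulVec, truncGate_mulVec]
  simp only [join_mk]

theorem rotGate_lift (s L H : ℝ) : (rotGate s L H : Matrix.unitaryGroup ((G × E) × Work E M) ℂ) =
    lift fun _ => rotGate s L H := by
  refine unitary_ext_mulVec fun v b => ?_
  obtain ⟨⟨⟨h, ⟨a, b, q, q', i⟩⟩, j⟩, rfl⟩ := join.surjective b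
  rw [onRegister_mulVec, join_mk, rotGate_mulVec, rotGate_mulVec]
  simp only [join_mk]

theorem cnotGate_lift : (cnotGate : Matrix.unitaryGroup ((G × E) × Work E M) ℂ) =
    lift fun _ => cnotGate := by
  refine unitary_ext_mulVec fun v b => ?_
  obtain ⟨⟨⟨h, ⟨a, b, q, q', i⟩⟩, j⟩, rfl⟩ := join.surjective b
  rw [onRegister_mulVec, join_mk, cnotGate_mulVec, cnotGate_mulVec]
  simp only [join_mk]

theorem phaseGate_lift (f : (G × E) × Work E M → ℝ) :
    phaseGate f = lift fun j => phaseGate fun b => f (join (b, j)) := by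
  refine unitary_ext_mulVec fun v b => ?_
  obtain ⟨⟨b, j⟩, rfl⟩ := join.surjective b
  rw [onRegister_mulVec, phaseGate_mulVec, phaseGate_mulVec]

variable (O : Fin T → Matrix.unitaryGroup (G × E) ℂ)

theorem query_lift (i : Fin T) (inverse : Bool) :
    Step.op O (.query i inverse fun _ => true : Step T (G × E) (Work E M)) =
      lift fun _ => Step.op O (.query i inverse fun _ => true) := by
  refine unitary_ext_mulVec ?_
  intro v b
  obtain ⟨⟨⟨h, w⟩, j⟩, rfl⟩ := join.surjective b
  rw [onRegister_mulVec]
  simp only [Step.op]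
  rw [onRegister_refl_mulVec]
  rw [onRegister_refl_mulVec]
  rfl

theorem circuitU_lift (s L H : ℝ) (i : Fin T) :
    Circuit.op O (circuitU s L H i : Circuit T (G × E) (Work E M)) =
      lift fun _ => Circuit.op O (circuitU s L H i) := by
  simp only [circuitU, truncatedOracle, shiftedOracle, Circuit.op_append, Circuit.op_cons,
    Circuit.op_nil, one_mul]
  rw [query_lift]
  simp only [Step.op]
  rw [shiftGate_lift, truncGate_lift, rotGate_lift, onRegister_mul, onRegister_mul, onRegister_mul]

theorem circuitV_lift (s L H : ℝ) (i : Fin T) :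
    Circuit.op O (circuitV s L H i : Circuit T (G × E) (Work E M)) =
      lift fun _ => Circuit.op O (circuitV s L H i) := by
  simp only [circuitV, Circuit.op_append, Circuit.op_inv, Circuit.op_singleton]
  rw [circuitU_lift]
  simp only [Step.op]
  rw [cnotGate_lift, onRegister_inv, onRegister_mul, onRegister_mul]

theorem circuitS_append_singleton (z : G × E) (s L H : ℝ) (ang : ℝ × ℝ) (angles : List (ℝ × ℝ)) (i : Fin T) :
    (circuitS z s L H (angles ++ [ang]) i : Circuit T (G × E) (Work E M)) =
      circuitS z s L H angles i ++
        ([.gate (phaseGate fun b => if IsZeroU z b then ang.2 else 0)] ++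
        (circuitV s L H i).inv ++
        [.gate (phaseGate fun b => if IsZeroV z b then -ang.1 else 0)] ++ circuitV s L H i) := by
  simp [circuitS]

theorem circuitS_lift (z : G × E) (s L H : ℝ) (angles : List (ℝ × ℝ)) (i : Fin T) :
    Circuit.op O (circuitS z s L H angles i : Circuit T (G × E) (Work E M)) =
      lift fun _ => Circuit.op O (circuitS z s L H angles i) := by
  induction angles using List.reverseRecOn with
  | nil => simpa [circuitS] using circuitV_lift O s L H i
  | append_singleton angles ang ih =>
    simp only [circuitS_append_singleton, Circuit.op_append, Circuit.op_inv, Circuit.op_singleton]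
    rw [ih, circuitV_lift]
    simp only [Step.op]
    rw [phaseGate_lift, phaseGate_lift, onRegister_inv, onRegister_mul, onRegister_mul,
      onRegister_mul, onRegister_mul]
    rfl

theorem phaseGate_zero {n : Type} [Fintype n] [DecidableEq n] :
    phaseGate (fun _ : n => (0 : ℝ)) = 1 := by
  refine unitary_ext_mulVec fun v b => ?_
  rw [phaseGate_mulVec]
  simp

/-- Only the two phase gates are controlled by the phase register. When j < k both are trivial and
S†, S cancel, so this controls the whole Grover operator. -/
theorem circuitQ_lift (z : G × E) (s L H : ℝ) (angles : List (ℝ × ℝ)) (k : ℕ) (i : Fin T) :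
    Circuit.op O (circuitQ z s L H angles k i : Circuit T (G × E) (Work E M)) =
      lift fun j => if k ≤ (j : ℕ) then Circuit.op O (circuitQ z s L H angles 0 i) else 1 := by
  simp only [circuitQ, Circuit.op_append, Circuit.op_inv, Circuit.op_singleton]
  rw [circuitS_lift]
  simp only [Step.op]
  rw [phaseGate_lift, phaseGate_lift, onRegister_inv, onRegister_mul, onRegister_mul,
    onRegister_mul]
  congr 1
  funext j
  have hj : ∀ b : Core G E, (join (b, j)).2.phase = j := fun _ => rfl
  simp only [hj]
  split_ifs with h
  · simp only [h, true_and, Nat.zero_le]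
    rfl
  · simp only [h, false_and, if_false, phaseGate_zero]
    group

/-- The unitary of the amplitude estimation between the Fourier transforms, when the phase register
is in the state `|j⟩`. -/
def groverOp (z : G × E) (s L H : ℝ) (angles : List (ℝ × ℝ)) (r : Fin (M + 1) → Fin T)
    (j : Fin (M + 1)) (l : List (Fin M)) : Matrix.unitaryGroup (Core G E) ℂ :=
  (l.map fun k : Fin M => if (k : ℕ) + 1 ≤ (j : ℕ) then
    Circuit.op O (circuitQ z s L H angles 0 (r k.succ)) else 1).reverse.prod *
    Circuit.op O (circuitS z s L H angles (r 0))

theorem groverOp_append (z : G × E) (s L H : ℝ) (angles : List (ℝ × ℝ)) (r : Fin (M + 1) → Fin T)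
    (j : Fin (M + 1)) (l : List (Fin M)) (k : Fin M) :
    groverOp O z s L H angles r j (l ++ [k]) = (if (k : ℕ) + 1 ≤ (j : ℕ) then
      Circuit.op O (circuitQ z s L H angles 0 (r k.succ)) else 1) *
      groverOp O z s L H angles r j l := by
  simp [groverOp, mul_assoc]

theorem op_grover_list (z : G × E) (s L H : ℝ) (angles : List (ℝ × ℝ)) (r : Fin (M + 1) → Fin T)
    (l : List (Fin M)) :
    Circuit.op O (circuitS z s L H angles (r 0) ++
      l.flatMap fun k : Fin M => circuitQ z s L H angles ((k : ℕ) + 1) (r k.succ) :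
      Circuit T (G × E) (Work E M)) = lift fun j => groverOp O z s L H angles r j l := by
  induction l using List.reverseRecOn with
  | nil =>
    simp only [groverOp, List.flatMap_nil, List.append_nil, List.map_nil, List.reverse_nil,
      List.prod_nil, one_mul]
    exact circuitS_lift O z s L H angles (r 0)
  | append_singleton l k ih =>
    rw [List.flatMap_append, ← List.append_assoc, Circuit.op_append, ih]
    simp only [List.flatMap_cons, List.flatMap_nil, List.append_nil]
    rw [circuitQ_lift, onRegister_mul]
    congr 1
    funext j
    rw [groverOp_append]

theorem ampCircuit_op (z : G × E) (s L H : ℝ) (angles : List (ℝ × ℝ)) (r : Fin (M + 1) → Fin T) :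
    Circuit.op O (ampCircuit z s L H angles r) =
      onRegister regPhase (fun _ => (qft M)⁻¹) *
        lift (fun j => groverOp O z s L H angles r j (List.finRange M)) *
        onRegister regPhase (fun _ => qft M) := by
  rw [ampCircuit, Circuit.op_append, List.append_assoc, Circuit.op_append, op_grover_list,
    Circuit.op_singleton, Circuit.op_singleton, Step.op, Step.op, mul_assoc]

theorem phase_mulVec (U : Matrix.unitaryGroup (Fin (M + 1)) ℂ) (v : (G × E) × Work E M → ℂ)
    (b : Core G E) (j : Fin (M + 1)) :
    ((onRegister regPhase (fun _ => U) : Matrix.unitaryGroup ((G × E) × Work E M) ℂ).1 *ᵥ v)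
      (join (b, j)) = (U.1 *ᵥ fun k => v (join (b, k))) j := by
  obtain ⟨h, ⟨a, b, q, q', i⟩⟩ := b
  exact onRegister_mulVec regPhase _ v j (h, a, b, q, q')

/-- The initial state of the registers other than the phase register, for the state `f` of the
second qubit. -/
def coreKet (z : G × E) (f : Fin 2) : Core G E → ℂ := ket (z, ⟨none, none, 0, f, 0⟩)

theorem ket_blank_join (z : G × E) (b : Core G E) (j : Fin (M + 1)) :
    (ket (z, blank E M) : (G × E) × Work E M → ℂ) (join (b, j)) =
      coreKet z 0 b * (Pi.single 0 1 : Fin (M + 1) → ℂ) j := by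
  have h0 : (z, blank E M) = join ((z, ⟨none, none, 0, 0, 0⟩), (0 : Fin (M + 1))) := rfl
  rw [h0]
  simp only [ket, coreKet, Pi.single_apply, join.apply_eq_iff_eq, Prod.mk.injEq]
  split_ifs <;> simp_all

theorem qft_apply_zero (j : Fin (M + 1)) : (qft M).1 j 0 = 1 / (√((M + 1 : ℕ) : ℝ) : ℂ) := by
  simp [qft]

/-- The final state of the amplitude estimation. -/
theorem run_ampCircuit (z : G × E) (s L H : ℝ) (angles : List (ℝ × ℝ)) (r : Fin (M + 1) → Fin T)
    (b : Core G E) (y : Fin (M + 1)) :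
    Circuit.run O (ampCircuit z s L H angles r) (ket (z, blank E M)) (join (b, y)) =
      ((qft M)⁻¹.1 *ᵥ fun j => 1 / (√((M + 1 : ℕ) : ℝ) : ℂ) *
        ((groverOp O z s L H angles r j (List.finRange M)).1 *ᵥ coreKet z 0) b) y := by
  rw [Circuit.run_eq, ampCircuit_op, Submonoid.coe_mul, Submonoid.coe_mul, ← Matrix.mulVec_mulVec,
    ← Matrix.mulVec_mulVec, phase_mulVec]
  congr 1
  funext j
  rw [onRegister_mulVec]
  have h : (fun a' => ((onRegister regPhase (fun _ => qft M) :
      Matrix.unitaryGroup ((G × E) × Work E M) ℂ).1 *ᵥ ket (z, blank E M)) (join (a', j))) =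
      (1 / (√((M + 1 : ℕ) : ℝ) : ℂ)) • coreKet z 0 := by
    funext b
    rw [phase_mulVec]
    simp only [ket_blank_join]
    have : (fun k => coreKet z 0 b * (Pi.single 0 1 : Fin (M + 1) → ℂ) k) =
        coreKet z 0 b • (Pi.single 0 1 : Fin (M + 1) → ℂ) := rfl
    rw [this, Matrix.mulVec_smul, Matrix.mulVec_single_one]
    simp only [Pi.smul_apply, smul_eq_mul, Matrix.col_apply, qft_apply_zero]
    ring
  rw [h, Matrix.mulVec_smul]
  rfl

end Lift

/-! ## The state prepared by the fixed-point search -/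

section Oracle

variable {T : ℕ} {G : Type} [Fintype G] [DecidableEq G] {E : Finset ℝ}

/-- The content of the register for the truncated value when the sample is `x`. -/
def truncReg (s L H : ℝ) (x : E) : Option E :=
  if L ≤ (x : ℝ) - s ∧ (x : ℝ) - s ≤ H then some x else none

/-- The expectation of the shifted and truncated random variable. -/
def truncMean (s L H : ℝ) (p : E → ℝ) : ℝ := ∑ x : E, p x * val s (truncReg s L H x)

theorem val_truncReg_mem {s L H : ℝ} (hL : L ≤ 0) (hH : 0 ≤ H) (x : E) :
    L ≤ val s (truncReg s L H x) ∧ val s (truncReg s L H x) ≤ H := by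
  unfold truncReg
  split_ifs with h
  · exact h
  · exact ⟨hL, hH⟩

theorem sum_core {α : Type*} [AddCommMonoid α] (F : Core G E → α) :
    ∑ b, F b = ∑ h, ∑ a, ∑ b, ∑ q, ∑ q', F (h, ⟨a, b, q, q', 0⟩) := by
  let e : ((G × E) × Option E × Option E × Fin 2 × Fin 2) ≃ Core G E :=
    { toFun := fun ⟨h, a, b, q, q'⟩ => ⟨h, ⟨a, b, q, q', 0⟩⟩
      invFun := fun ⟨h, ⟨a, b, q, q', _⟩⟩ => ⟨h, a, b, q, q'⟩
      left_inv := fun _ => rfl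
      right_inv := by
        rintro ⟨h, ⟨a, b, q, q', i⟩⟩
        have : i = 0 := Subsingleton.elim (α := Fin 1) _ _
        rw [this] }
  rw [← e.sum_comp]
  simp only [Fintype.sum_prod_type]
  rfl

theorem coreKet_apply (z h : G × E) (f : Fin 2) (a b : Option E) (q q' : Fin 2) (i : Fin 1) :
    coreKet z f (h, ⟨a, b, q, q', i⟩) =
      if a = none ∧ b = none ∧ q = 0 ∧ q' = f then (ket z : G × E → ℂ) h else 0 := by
  have : i = 0 := Subsingleton.elim (α := Fin 1) _ _
  subst this
  simp only [coreKet, ket, Pi.single_apply, Prod.mk.injEq, Work.mk.injEq]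
  split_ifs <;> simp_all

/-- The rotation angle for the sample `x`. -/
def rotAngle (s L H : ℝ) (x : E) : ℝ :=
  Real.arcsin √((val s (truncReg s L H x) - L) / (H - L))

theorem rotation_mulVec (ω : ℝ) (c : ℂ) (q : Fin 2) :
    ((rotation ω).1 *ᵥ fun k => if k = 0 then c else 0) q =
      c * (if q = 0 then (Real.cos ω : ℂ) else (Real.sin ω : ℂ)) := by
  fin_cases q <;> simp [rotation, Matrix.mulVec, dotProduct, mul_comm]

variable (O : Fin T → Matrix.unitaryGroup (G × E) ℂ) (i : Fin T)

theorem query_mulVec (v : (G × E) × Work E 0 → ℂ) (h : G × E) (w : Work E 0) :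
    ((Step.op O (.query i false fun _ => true : Step T (G × E) (Work E 0))).1 *ᵥ v) (h, w) =
      ((O i).1 *ᵥ fun h' => v (h', w)) h :=
  onRegister_refl_mulVec _ v h w

theorem Step.op_gate {H W : Type} [Fintype H] [DecidableEq H] [Fintype W] [DecidableEq W]
    (O : Fin T → Matrix.unitaryGroup H ℂ) (U : Matrix.unitaryGroup (H × W) ℂ) :
    Step.op O (.gate U) = U := rfl

/-- The two value registers are functions of the sample, so the state is supported on one choice of
their contents for each basis state of the oracle register. The second qubit, untouched by U, keeps
an arbitrary value f, which the inner products for V need. -/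
theorem circuitU_mulVec (z : G × E) (s L H : ℝ) (f : Fin 2) (h : G × E) (a b : Option E)
    (q q' : Fin 2) (j : Fin 1) :
    ((Circuit.op O (circuitU s L H i : Circuit T (G × E) (Work E 0))).1 *ᵥ coreKet z f)
      (h, ⟨a, b, q, q', j⟩) =
    if a = some h.2 ∧ b = truncReg s L H h.2 ∧ q' = f then
      ((O i).1 *ᵥ ket z) h * (if q = 0 then (Real.cos (rotAngle s L H h.2) : ℂ) else
        (Real.sin (rotAngle s L H h.2) : ℂ)) else 0 := by
  simp only [circuitU, truncatedOracle, shiftedOracle, Circuit.op_append, Circuit.op_cons,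
    Circuit.op_nil, one_mul, Submonoid.coe_mul, ← Matrix.mulVec_mulVec, Step.op_gate]
  have h1 : ∀ (a b : Option E) (q q' : Fin 2) (j : Fin 1),
      ((Step.op O (.query i false fun _ => true : Step T (G × E) (Work E 0))).1 *ᵥ coreKet z f)
        (h, ⟨a, b, q, q', j⟩) = if a = none ∧ b = none ∧ q = 0 ∧ q' = f then
          ((O i).1 *ᵥ ket z) h else 0 := by
    intro a b q q' j
    rw [query_mulVec]
    simp only [coreKet_apply]
    by_cases hc : a = none ∧ b = none ∧ q = 0 ∧ q' = f
    · simp only [if_pos hc]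
    · simp only [if_neg hc]
      exact congrFun (Matrix.mulVec_zero _) h
  have h2 : ∀ a : Option E, Equiv.swap none (some h.2) a = none ↔ a = some h.2 := by
    intro a
    rw [Equiv.swap_apply_eq_iff, Equiv.swap_apply_left]
  have h3 : ∀ b : Option E, (if L ≤ val s (some h.2) ∧ val s (some h.2) ≤ H then
      Equiv.swap none (some h.2) b else b) = none ↔ b = truncReg s L H h.2 := by
    intro b
    change (if L ≤ (h.2 : ℝ) - s ∧ (h.2 : ℝ) - s ≤ H then _ else _) = none ↔ _
    unfold truncReg
    split_ifs with hc
    · exact h2 b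
    · rfl
  rw [rotGate_mulVec]
  have h4 : (fun k => ((truncGate s L H).1 *ᵥ (shiftGate.1 *ᵥ ((Step.op O (.query i false fun _ =>
      true : Step T (G × E) (Work E 0))).1 *ᵥ coreKet z f))) (h, ⟨a, b, k, q', j⟩)) =
      fun k => if k = 0 then (if a = some h.2 ∧ b = truncReg s L H h.2 ∧ q' = f then
        ((O i).1 *ᵥ ket z) h else 0) else 0 := by
    funext k
    rw [truncGate_mulVec, shiftGate_mulVec, h1]
    rw [← ite_and]
    refine if_congr ?_ rfl rfl
    constructor
    · rintro ⟨e1, e2, e3, e4⟩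
      obtain rfl := (h2 a).1 e1
      exact ⟨e3, rfl, (h3 b).1 e2, e4⟩
    · rintro ⟨e3, rfl, e2, e4⟩
      exact ⟨(h2 _).2 rfl, (h3 b).2 e2, e3, e4⟩
  rw [h4, rotation_mulVec]
  split_ifs with hc hq hq
  · rw [rotAngle, hc.2.1]
  · rw [rotAngle, hc.2.1]
  · rw [zero_mul]
  · rw [zero_mul]

theorem coreKet_dotProduct (z : G × E) (f : Fin 2) (v : Core G E → ℂ) :
    star (coreKet z f) ⬝ᵥ v = v (z, ⟨none, none, 0, f, 0⟩) := by
  have : star (coreKet z f) = Pi.single (z, ⟨none, none, 0, f, 0⟩) 1 := by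
    rw [coreKet, ket, ← Pi.single_star, star_one]
  rw [this, single_one_dotProduct]

variable {p : E → ℝ}

/-- Here the garbage disappears: an observable of the value register sees only |√p(x)|², since each
ψₓ is a unit vector. -/
theorem sum_ket_sq {z : G × E} {U : Matrix.unitaryGroup (G × E) ℂ} (hp : p ∈ stdSimplex ℝ E)
    (hU : Encodes z U p) (F : E → ℝ) :
    ∑ h : G × E, star ((U.1 *ᵥ ket z) h) * (U.1 *ᵥ ket z) h * (F h.2 : ℂ) =
      ((∑ x, p x * F x : ℝ) : ℂ) := by
  obtain ⟨ψ, hψ, hUψ⟩ := hU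
  have h1 : ∀ h : G × E, star ((U.1 *ᵥ ket z) h) * (U.1 *ᵥ ket z) h * (F h.2 : ℂ) =
      ((p h.2 * F h.2 * ‖ψ h.2 h.1‖ ^ 2 : ℝ) : ℂ) := by
    rintro ⟨g, x⟩
    rw [hUψ, RCLike.star_def, Complex.conj_mul', norm_mul, Complex.norm_real,
      Real.norm_of_nonneg (Real.sqrt_nonneg _), ← Complex.ofReal_pow, mul_pow, Real.sq_sqrt (hp.1 x),
      ← Complex.ofReal_mul]
    congr 1
    ring
  simp only [h1]
  rw [← Complex.ofReal_sum, Fintype.sum_prod_type_right]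
  congr 1
  refine Finset.sum_congr rfl fun x _ => ?_
  simp only
  rw [← Finset.mul_sum, hψ, mul_one]

theorem sin_rotAngle_sq {s H : ℝ} (hH : 0 < H) (x : E) :
    Real.sin (rotAngle s (-H) H x) ^ 2 = (1 + val s (truncReg s (-H) H x) / H) / 2 := by
  obtain ⟨h1, h2⟩ := val_truncReg_mem (s := s) (neg_nonpos.2 hH.le) hH.le x
  have h0 : 0 ≤ (val s (truncReg s (-H) H x) - -H) / (H - -H) :=
    div_nonneg (by linarith) (by linarith)
  have h3 : (val s (truncReg s (-H) H x) - -H) / (H - -H) ≤ 1 :=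
    (div_le_one (by linarith)).2 (by linarith)
  rw [rotAngle, Real.sin_arcsin (by linarith [Real.sqrt_nonneg ((val s (truncReg s (-H) H x) - -H) / (H - -H))])
    (Real.sqrt_le_one.2 h3), Real.sq_sqrt h0]
  field_simp
  ring

/-- Moving U† to the left turns the entry into the overlap of U|𝟎⟩|f⟩ with CNOT U|𝟎⟩|0⟩. The CNOT
selects rotated qubit = f, leaving the expectation of cos² or sin² of the rotation angle, which is
affine in the truncated value. -/
theorem circuitV_entry {z : G × E} {s H : ℝ} (hH : 0 < H) (hp : p ∈ stdSimplex ℝ E)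
    (hU : Encodes z (O i) p) (f : Fin 2) :
    ((Circuit.op O (circuitV s (-H) H i : Circuit T (G × E) (Work E 0))).1 *ᵥ coreKet z 0)
      (z, ⟨none, none, 0, f, 0⟩) =
      (((if f = 0 then 1 - truncMean s (-H) H p / H else 1 + truncMean s (-H) H p / H) / 2 : ℝ) :
        ℂ) := by
  refine (coreKet_dotProduct z f _).symm.trans ?_
  simp only [circuitV, Circuit.op_append, Circuit.op_inv, Circuit.op_singleton]
  set U := Circuit.op O (circuitU s (-H) H i : Circuit T (G × E) (Work E 0)) with hUdef
  rw [← star_mulVec_dotProduct U, Matrix.mulVec_mulVec, ← Submonoid.coe_mul, mul_inv_cancel_left,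
    Submonoid.coe_mul, ← Matrix.mulVec_mulVec]
  simp only [Step.op]
  rw [dotProduct, sum_core]
  simp only [Pi.star_apply, cnotGate_mulVec, hUdef, circuitU_mulVec]
  have hS : ∑ x, p x * ((1 + val s (truncReg s (-H) H x) / H) / 2) =
      (1 + truncMean s (-H) H p / H) / 2 := by
    have : ∀ x, p x * ((1 + val s (truncReg s (-H) H x) / H) / 2) =
        p x / 2 + p x * val s (truncReg s (-H) H x) / (2 * H) := by
      intro x; field_simp
    simp only [this]
    rw [Finset.sum_add_distrib, ← Finset.sum_div, ← Finset.sum_div, hp.2]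
    change _ + truncMean s (-H) H p / (2 * H) = _
    field_simp
  have key : ∀ h : G × E, (∑ a : Option E, ∑ b : Option E, ∑ q : Fin 2, ∑ q' : Fin 2,
      star (if a = some h.2 ∧ b = truncReg s (-H) H h.2 ∧ q' = f then
        ((O i).1 *ᵥ ket z) h * (if q = 0 then (Real.cos (rotAngle s (-H) H h.2) : ℂ) else
          (Real.sin (rotAngle s (-H) H h.2) : ℂ)) else 0) *
      (if a = some h.2 ∧ b = truncReg s (-H) H h.2 ∧
          (if q = 1 then Equiv.swap 0 1 q' else q') = 0 then
        ((O i).1 *ᵥ ket z) h * (if q = 0 then (Real.cos (rotAngle s (-H) H h.2) : ℂ) else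
          (Real.sin (rotAngle s (-H) H h.2) : ℂ)) else 0)) =
      star (((O i).1 *ᵥ ket z) h) * ((O i).1 *ᵥ ket z) h *
        ((if f = 0 then Real.cos (rotAngle s (-H) H h.2) ^ 2 else
          Real.sin (rotAngle s (-H) H h.2) ^ 2 : ℝ) : ℂ) := by
    intro h
    rw [Finset.sum_eq_single (some h.2) (by intro a _ ha; simp [ha]) (by simp),
      Finset.sum_eq_single (truncReg s (-H) H h.2) (by intro b _ hb; simp [hb]) (by simp)]
    simp only [true_and, Fin.sum_univ_two]
    fin_cases f
    · simp [Complex.conj_ofReal, -Complex.ofReal_cos, -Complex.ofReal_sin]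
      ring
    · simp [Complex.conj_ofReal, -Complex.ofReal_cos, -Complex.ofReal_sin]
      ring
  rw [Finset.sum_congr rfl fun h _ => key h]
  fin_cases f
  · simp only [Fin.zero_eta, if_true]
    rw [sum_ket_sq hp hU (fun x => Real.cos (rotAngle s (-H) H x) ^ 2)]
    congr 1
    simp only [Real.cos_sq', sin_rotAngle_sq hH, mul_sub, Finset.sum_sub_distrib, hS, mul_one, hp.2]
    ring
  · simp only [Fin.mk_one, one_ne_zero, if_false]
    rw [sum_ket_sq hp hU (fun x => Real.sin (rotAngle s (-H) H x) ^ 2)]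
    congr 1
    simp only [sin_rotAngle_sq hH, hS]

/-- `(1 - x + i (1 + x)) / √(2 (1 + x²))`, the state of the second qubit prepared from a random
variable with values in `[-1, 1]` and expectation `x`. -/
def amp (x : ℝ) : ℂ := ⟨(1 - x) / √(2 * (1 + x ^ 2)), (1 + x) / √(2 * (1 + x ^ 2))⟩

/-- The state `Re c |0⟩ + Im c |1⟩` of the second qubit, the other registers being blank. -/
def qubitState (z : G × E) (c : ℂ) : Core G E → ℂ :=
  (c.re : ℂ) • coreKet z 0 + (c.im : ℂ) • coreKet z 1

theorem coreKet_dotProduct_coreKet (z : G × E) (f f' : Fin 2) :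
    star (coreKet z f) ⬝ᵥ coreKet z f' = if f = f' then 1 else 0 := by
  rw [coreKet_dotProduct, coreKet_apply]
  simp [ket]

theorem qubitState_dotProduct (z : G × E) (c d : ℂ) :
    star (qubitState z c) ⬝ᵥ qubitState z d = ((c.re * d.re + c.im * d.im : ℝ) : ℂ) := by
  simp [qubitState, star_add, star_smul, add_dotProduct, dotProduct_add, smul_dotProduct,
    dotProduct_smul, coreKet_dotProduct_coreKet, mul_comm]

theorem l2_qubitState (z : G × E) (c : ℂ) : l2 (qubitState z c) = ‖c‖ := by
  apply l2_eq_of_sq (norm_nonneg _)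
  have h := qubitState_dotProduct z c c
  rw [star_dotProduct_self] at h
  rw [Complex.sq_norm, Complex.normSq_apply]
  exact_mod_cast h

theorem norm_amp (x : ℝ) : ‖amp x‖ = 1 := by
  have h0 : 0 < 2 * (1 + x ^ 2) := by positivity
  have h : ‖amp x‖ ^ 2 = 1 := by
    rw [Complex.sq_norm, Complex.normSq_apply, amp]
    have := Real.mul_self_sqrt h0.le
    rw [div_mul_div_comm, div_mul_div_comm, this, ← add_div, div_eq_one_iff_eq h0.ne']
    ring
  exact (pow_eq_one_iff_of_nonneg (norm_nonneg _) two_ne_zero).1 h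

/-- The projector fixes the registers of U and leaves the second qubit free, so the target of the
search is a whole qubit state rather than a basis state. -/
theorem circuitS_mulVec {z : G × E} {s L H : ℝ} (angles : List (ℝ × ℝ)) :
    (Circuit.op O (circuitS z s L H angles i : Circuit T (G × E) (Work E 0))).1 *ᵥ coreKet z 0 =
      searchState (Circuit.op O (circuitV s L H i : Circuit T (G × E) (Work E 0)))
        (z, ⟨none, none, 0, 0, 0⟩) (Matrix.diagonal fun b => if IsZeroU z b then 1 else 0)
        angles := by
  induction angles using List.reverseRecOn with
  | nil => simp [circuitS, searchState, coreKet]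
  | append_singleton angles ang ih =>
    have h1 : searchState (Circuit.op O (circuitV s L H i : Circuit T (G × E) (Work E 0)))
        (z, ⟨none, none, 0, 0, 0⟩) (Matrix.diagonal fun b => if IsZeroU z b then 1 else 0)
        (angles ++ [ang]) =
        searchStep (Circuit.op O (circuitV s L H i : Circuit T (G × E) (Work E 0)))
        (z, ⟨none, none, 0, 0, 0⟩) (Matrix.diagonal fun b => if IsZeroU z b then 1 else 0) ang *ᵥ
        searchState (Circuit.op O (circuitV s L H i : Circuit T (G × E) (Work E 0)))
        (z, ⟨none, none, 0, 0, 0⟩) (Matrix.diagonal fun b => if IsZeroU z b then 1 else 0)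
        angles := by
      simp [searchState]
    have e1 : ∀ v : Core G E → ℂ, (phaseGate fun b => if IsZeroU z b then ang.2 else 0).1 *ᵥ v =
        (1 - (1 - Complex.exp (ang.2 * Complex.I)) •
          Matrix.diagonal fun b => if IsZeroU z b then (1 : ℂ) else 0) *ᵥ v := by
      intro v
      funext b
      rw [phaseGate_mulVec, Matrix.sub_mulVec, Matrix.smul_mulVec, Matrix.one_mulVec,
        Pi.sub_apply, Pi.smul_apply, Matrix.mulVec_diagonal]
      split_ifs <;> simp
      ring
    have e2 : ∀ v : Core G E → ℂ, (phaseGate fun b => if IsZeroV z b then -ang.1 else 0).1 *ᵥ v =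
        (1 - (1 - Complex.exp (-ang.1 * Complex.I)) •
          Matrix.single (z, ⟨none, none, 0, 0, 0⟩) (z, ⟨none, none, 0, 0, 0⟩) (1 : ℂ)) *ᵥ v := by
      intro v
      funext b
      rw [phaseGate_mulVec, Matrix.sub_mulVec, Matrix.smul_mulVec, Matrix.one_mulVec,
        Pi.sub_apply, Pi.smul_apply, Matrix.single_mulVec]
      have hb : IsZeroV z b ↔ b = (z, ⟨none, none, 0, 0, 0⟩) := by
        obtain ⟨h, ⟨a, b, q, q', j⟩⟩ := b
        have : j = 0 := Subsingleton.elim (α := Fin 1) _ _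
        subst this
        simp [IsZeroV, and_assoc]
      by_cases h : IsZeroV z b
      · rw [if_pos h, hb.1 h]
        simp
        ring
      · have h' := mt hb.2 h
        rw [if_neg h]
        simp [h']
    rw [h1, ← ih, circuitS_append_singleton]
    simp only [Circuit.op_append, Circuit.op_inv, Circuit.op_singleton, Submonoid.coe_mul,
      ← Matrix.mulVec_mulVec, Step.op_gate, searchStep]
    rw [e1, e2]

theorem diagonal_mulVec_circuitV {z : G × E} {s H : ℝ} (hH : 0 < H) (hp : p ∈ stdSimplex ℝ E)
    (hU : Encodes z (O i) p) :
    (Matrix.diagonal fun b => if IsZeroU z b then (1 : ℂ) else 0) *ᵥ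
      ((Circuit.op O (circuitV s (-H) H i : Circuit T (G × E) (Work E 0))).1 *ᵥ coreKet z 0) =
      ((√((1 + (truncMean s (-H) H p / H) ^ 2) / 2) : ℝ) : ℂ) •
        qubitState z (amp (truncMean s (-H) H p / H)) := by
  set x := truncMean s (-H) H p / H with hx
  have hr : √(2 * (1 + x ^ 2)) = 2 * √((1 + x ^ 2) / 2) := by
    rw [show 2 * (1 + x ^ 2) = 2 ^ 2 * ((1 + x ^ 2) / 2) by ring, Real.sqrt_mul (by norm_num),
      Real.sqrt_sq (by norm_num)]
  have hr0 : √((1 + x ^ 2) / 2) ≠ 0 := by positivity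
  have hre : √((1 + x ^ 2) / 2) * (amp x).re = (1 - x) / 2 := by
    simp only [amp, hr]; field_simp
  have him : √((1 + x ^ 2) / 2) * (amp x).im = (1 + x) / 2 := by
    simp only [amp, hr]; field_simp
  funext b
  obtain ⟨h, ⟨a, b, q, q', j⟩⟩ := b
  have hj : j = 0 := Subsingleton.elim (α := Fin 1) _ _
  subst hj
  rw [Matrix.mulVec_diagonal, qubitState, smul_add, smul_smul, smul_smul, ← Complex.ofReal_mul,
    ← Complex.ofReal_mul, hre, him]
  simp only [Pi.add_apply, Pi.smul_apply, coreKet_apply, smul_eq_mul]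
  by_cases hz : IsZeroU z ((h, ⟨a, b, q, q', 0⟩) : Core G E)
  · rw [if_pos hz]
    obtain ⟨h1, h2, h3, h4⟩ := hz
    simp only at h1 h2 h3 h4
    subst h1 h2 h3 h4
    rw [one_mul, circuitV_entry O i hH hp hU, ← hx]
    fin_cases q' <;> simp [ket]
  · rw [if_neg hz, zero_mul]
    by_cases hh : h = z
    · have : ¬ (a = none ∧ b = none ∧ q = 0) := fun hc => hz ⟨hh, hc⟩
      rw [if_neg (fun hc => this ⟨hc.1, hc.2.1, hc.2.2.1⟩),
        if_neg (fun hc => this ⟨hc.1, hc.2.1, hc.2.2.1⟩)]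
      simp
    · simp [ket, hh]

/-- The fixed-point search prepares the state of the second qubit given by `amp`. -/
theorem circuitS_close {fix : ℝ → List (ℝ × ℝ)} (hfix : IsFixedPointSearch fix) {η : ℝ}
    (h0 : 0 < η) (h1 : η ≤ 1 / 2) {z : G × E} {s H : ℝ} (hH : 0 < H) (hp : p ∈ stdSimplex ℝ E)
    (hU : Encodes z (O i) p) :
    ∃ ω : ℂ, ‖ω‖ = 1 ∧ l2 (ω • qubitState z (amp (truncMean s (-H) H p / H)) -
      (Circuit.op O (circuitS z s (-H) H (fix η) i : Circuit T (G × E) (Work E 0))).1 *ᵥ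
        coreKet z 0) ≤ η := by
  rw [circuitS_mulVec]
  refine hfix.2 η h0 h1 _ _ _ _ _ _ ?_ ?_ ?_ ?_ (diagonal_mulVec_circuitV O i hH hp hU)
  · rw [Matrix.IsHermitian, Matrix.diagonal_conjTranspose]
    congr 1
    funext b
    simp only [Pi.star_apply]
    split_ifs <;> simp
  · rw [Matrix.diagonal_mul_diagonal]
    congr 1
    funext b
    split_ifs <;> simp
  -- The amplitude is √((1 + x²)/2), at least 1/√2 whatever the mean: no prior knowledge of x is
  -- needed for the search.
  · rw [one_div, ← Real.sqrt_inv]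
    apply Real.sqrt_le_sqrt
    nlinarith [sq_nonneg (truncMean s (-H) H p / H)]
  · exact (l2_qubitState z _).trans (norm_amp _)

end Oracle

/-! ## The Grover iterations -/

section GroverIterations

variable {T : ℕ} {G : Type} [Fintype G] [DecidableEq G] {E : Finset ℝ}
  (O : Fin T → Matrix.unitaryGroup (G × E) ℂ)

/-- The reflection `I - 2 |s⟩⟨s|`. -/
def reflect {n : Type} [Fintype n] (s v : n → ℂ) : n → ℂ := v - (2 * (star s ⬝ᵥ v)) • s

/-- The rank-one term depends on its axis twice, as a bra and as a ket; each replacement costs 2η.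
-/
theorem reflect_sub_le {n : Type} [Fintype n] {s φ x : n → ℂ} {η : ℝ} (hs : l2 s = 1)
    (hφ : l2 φ = 1) (hx : l2 x = 1) (h : l2 (φ - s) ≤ η) :
    l2 (reflect s x - reflect φ x) ≤ 4 * η := by
  have e : reflect s x - reflect φ x =
      (2 * (star s ⬝ᵥ x)) • (φ - s) + (2 * (star (φ - s) ⬝ᵥ x)) • φ := by
    rw [reflect, reflect, star_sub, sub_dotProduct]
    module
  rw [e]
  refine (l2_add_le _ _).trans ?_
  rw [l2_smul, l2_smul, norm_mul, norm_mul, Complex.norm_ofNat, hφ, mul_one]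
  have h1 := norm_star_dotProduct_le s x
  have h2 := norm_star_dotProduct_le (φ - s) x
  rw [hx, hs] at h1
  rw [hx] at h2
  nlinarith [l2_nonneg (φ - s), norm_nonneg (star s ⬝ᵥ x)]

/-- Conjugation by S carries the reflection in |𝟎⟩ to the one in S|𝟎⟩. The global minus sign of Q is
absorbed by flipping the |0⟩ component instead of the |1⟩ component. -/
theorem circuitQ_mulVec (z : G × E) (s L H : ℝ) (angles : List (ℝ × ℝ)) (i : Fin T)
    (v : Core G E → ℂ) :
    (Circuit.op O (circuitQ z s L H angles 0 i : Circuit T (G × E) (Work E 0))).1 *ᵥ v =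
      reflect ((Circuit.op O (circuitS z s L H angles i :
        Circuit T (G × E) (Work E 0))).1 *ᵥ coreKet z 0)
        (fun b => if b.2.flag = 0 then -v b else v b) := by
  simp only [circuitQ, Circuit.op_append, Circuit.op_inv, Circuit.op_singleton, Submonoid.coe_mul,
    ← Matrix.mulVec_mulVec, Step.op_gate]
  generalize Circuit.op O (circuitS z s L H angles i : Circuit T (G × E) (Work E 0)) = S
  have e1 : (phaseGate fun b : Core G E =>
      if 0 ≤ (b.2.phase : ℕ) ∧ b.2.flag = 0 then Real.pi else 0).1 *ᵥ v =
      fun b => if b.2.flag = 0 then -v b else v b := by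
    funext b
    rw [phaseGate_mulVec]
    simp only [Nat.zero_le, true_and]
    split_ifs <;> simp
  have e2 : ∀ x : Core G E → ℂ, (phaseGate fun b : Core G E =>
      if 0 ≤ (b.2.phase : ℕ) ∧ IsZeroV z b then Real.pi else 0).1 *ᵥ x = reflect (coreKet z 0) x := by
    intro x
    funext b
    rw [phaseGate_mulVec, reflect, coreKet_dotProduct]
    obtain ⟨h, ⟨a, b, q, q', j⟩⟩ := b
    have hj : j = 0 := Subsingleton.elim (α := Fin 1) _ _
    subst hj
    simp only [Pi.sub_apply, Pi.smul_apply, coreKet_apply, IsZeroV, IsZeroU, Nat.zero_le, true_and,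
      smul_eq_mul]
    by_cases hc : (h = z ∧ a = none ∧ b = none ∧ q = 0) ∧ q' = 0
    · rw [if_pos hc]
      obtain ⟨⟨rfl, rfl, rfl, rfl⟩, rfl⟩ := hc
      simp [ket]
      ring
    · rw [if_neg hc]
      by_cases hh : h = z
      · rw [if_neg (fun hd => hc ⟨⟨hh, hd.1, hd.2.1, hd.2.2.1⟩, hd.2.2.2⟩)]
        simp
      · simp [ket, hh]
  rw [e1, e2]
  generalize (fun b : Core G E => if b.2.flag = 0 then -v b else v b) = x
  rw [reflect, reflect, Matrix.mulVec_sub, Matrix.mulVec_smul, Matrix.mulVec_mulVec,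
    ← Submonoid.coe_mul, mul_inv_cancel, OneMemClass.coe_one, Matrix.one_mulVec]
  rw [← star_mulVec_dotProduct S, Matrix.mulVec_mulVec, ← Submonoid.coe_mul, mul_inv_cancel,
    OneMemClass.coe_one, Matrix.one_mulVec]

theorem flip_qubitState (z : G × E) (ω c : ℂ) :
    (fun b : Core G E => if b.2.flag = 0 then -(ω • qubitState z c) b else (ω • qubitState z c) b) =
      ω • qubitState z ⟨-c.re, c.im⟩ := by
  funext b
  obtain ⟨h, ⟨a, b, q, q', j⟩⟩ := b
  simp only [qubitState, Pi.add_apply, Pi.smul_apply, coreKet_apply, smul_eq_mul]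
  fin_cases q'
  · simp only [Fin.zero_eta, if_true]
    split_ifs <;> simp_all
  · simp

/-- In complex notation the flip is c ↦ -c̄ and the reflection with axis u is v ↦ -u²v̄; two
reflections compose to the rotation c ↦ u²c. The phase ω of the axis cancels, and the phase ω' of
the state is only carried along. -/
theorem reflect_qubitState (z : G × E) {ω : ℂ} (hω : ‖ω‖ = 1) {u : ℂ} (hu : ‖u‖ = 1)
    (ω' c : ℂ) : reflect (ω • qubitState z u) (ω' • qubitState z ⟨-c.re, c.im⟩) =
      ω' • qubitState z (u ^ 2 * c) := by
  have h1 : star ω * ω = 1 := by simp [Complex.conj_mul', hω]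
  have h2 : u.re * u.re + u.im * u.im = 1 := by
    have := Complex.sq_norm u
    rw [hu, Complex.normSq_apply] at this
    linarith
  rw [reflect, star_smul, smul_dotProduct, dotProduct_smul, qubitState_dotProduct, smul_smul]
  have h3 : 2 * (star ω • ω' • ((u.re * -c.re + u.im * c.im : ℝ) : ℂ)) * ω =
      ω' * ((2 * (u.re * -c.re + u.im * c.im) : ℝ) : ℂ) := by
    simp only [smul_eq_mul]
    push_cast
    linear_combination (2 * ω' * (u.re * -c.re + u.im * c.im)) * h1
  rw [h3, ← smul_smul, ← smul_sub]
  congr 1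
  have h4 : (u ^ 2 * c).re = -c.re - 2 * (u.re * -c.re + u.im * c.im) * u.re := by
    simp only [pow_two, Complex.mul_re, Complex.mul_im]
    linear_combination (-c.re) * h2
  have h5 : (u ^ 2 * c).im = c.im - 2 * (u.re * -c.re + u.im * c.im) * u.im := by
    simp only [pow_two, Complex.mul_re, Complex.mul_im]
    linear_combination (c.im) * h2
  simp only [qubitState, h4, h5]
  push_cast
  module

variable {z : G × E} {s L H : ℝ} {angles : List (ℝ × ℝ)} {x : Fin T → ℝ} {η : ℝ}

/-- The error already present is preserved by unitarity; the new 4η comes from the inexact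
reflection axis. -/
theorem circuitQ_close (i : Fin T)
    (hS : ∃ ω : ℂ, ‖ω‖ = 1 ∧ l2 (ω • qubitState z (amp (x i)) -
      (Circuit.op O (circuitS z s L H angles i : Circuit T (G × E) (Work E 0))).1 *ᵥ
        coreKet z 0) ≤ η)
    (v : Core G E → ℂ) {ω c : ℂ} (hω : ‖ω‖ = 1) (hc : ‖c‖ = 1) :
    l2 ((Circuit.op O (circuitQ z s L H angles 0 i : Circuit T (G × E) (Work E 0))).1 *ᵥ v -
      ω • qubitState z (amp (x i) ^ 2 * c)) ≤ l2 (v - ω • qubitState z c) + 4 * η := by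
  obtain ⟨ω', hω', hclose⟩ := hS
  refine (l2_sub_le _ ((Circuit.op O (circuitQ z s L H angles 0 i :
    Circuit T (G × E) (Work E 0))).1 *ᵥ (ω • qubitState z c)) _).trans ?_
  rw [← Matrix.mulVec_sub, l2_unitary]
  gcongr
  rw [circuitQ_mulVec, flip_qubitState, ← reflect_qubitState z hω' (norm_amp _)]
  refine reflect_sub_le ?_ ?_ ?_ hclose
  · rw [l2_unitary]; exact l2_ket _
  · rw [l2_smul, hω', l2_qubitState, norm_amp, one_mul]
  · rw [l2_smul, hω, l2_qubitState, one_mul]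
    have h1 : ‖(⟨-c.re, c.im⟩ : ℂ)‖ ^ 2 = 1 := by
      rw [Complex.sq_norm, Complex.normSq_mk, neg_mul_neg, ← Complex.normSq_apply, ← Complex.sq_norm,
        hc, one_pow]
    exact (pow_eq_one_iff_of_nonneg (norm_nonneg _) two_ne_zero).1 h1

variable {M : ℕ}

/-- The state of the second qubit after the Grover operators of the list `l`, when the phase
register is in the state `|j⟩` and the searches are exact. -/
def idealAmp (x : Fin T → ℝ) (r : Fin (M + 1) → Fin T) (j : Fin (M + 1)) (l : List (Fin M)) : ℂ :=
  (l.map fun k : Fin M => if (k : ℕ) + 1 ≤ (j : ℕ) then amp (x (r k.succ)) ^ 2 else 1).prod *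
    amp (x (r 0))

theorem norm_idealAmp (x : Fin T → ℝ) (r : Fin (M + 1) → Fin T) (j : Fin (M + 1))
    (l : List (Fin M)) : ‖idealAmp x r j l‖ = 1 := by
  induction l with
  | nil => simp [idealAmp, norm_amp]
  | cons k l ih =>
    have : idealAmp x r j (k :: l) =
        (if (k : ℕ) + 1 ≤ (j : ℕ) then amp (x (r k.succ)) ^ 2 else 1) * idealAmp x r j l := by
      simp [idealAmp, mul_assoc]
    rw [this, norm_mul, ih, mul_one]
    split_ifs <;> simp [norm_amp]

theorem idealAmp_append (x : Fin T → ℝ) (r : Fin (M + 1) → Fin T) (j : Fin (M + 1))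
    (l : List (Fin M)) (k : Fin M) : idealAmp x r j (l ++ [k]) =
      (if (k : ℕ) + 1 ≤ (j : ℕ) then amp (x (r k.succ)) ^ 2 else 1) * idealAmp x r j l := by
  simp only [idealAmp, List.map_append, List.map_cons, List.map_nil, List.prod_append,
    List.prod_cons, List.prod_nil]
  ring

/-- The phase ω is that of the first preparation alone, because later phases cancel in the
reflections. It is therefore the same for all j and does not disturb the interference between
branches of the phase register. -/
theorem groverOp_close (r : Fin (M + 1) → Fin T)
    (hS : ∀ i, ∃ ω : ℂ, ‖ω‖ = 1 ∧ l2 (ω • qubitState z (amp (x i)) -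
      (Circuit.op O (circuitS z s L H angles i : Circuit T (G × E) (Work E 0))).1 *ᵥ
        coreKet z 0) ≤ η) :
    ∃ ω : ℂ, ‖ω‖ = 1 ∧ ∀ (j : Fin (M + 1)) (l : List (Fin M)),
      l2 ((groverOp O z s L H angles r j l).1 *ᵥ coreKet z 0 -
        ω • qubitState z (idealAmp x r j l)) ≤ η * (1 + 4 * l.length) := by
  obtain ⟨ω, hω, h⟩ := hS (r 0)
  have hη : 0 ≤ η := (l2_nonneg _).trans h
  refine ⟨ω, hω, fun j l => ?_⟩
  induction l using List.reverseRecOn with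
  | nil =>
    rw [l2_sub_comm]
    simpa [groverOp, idealAmp] using h
  | append_singleton l k ih =>
    rw [groverOp_append, idealAmp_append, List.length_append, List.length_singleton,
      Submonoid.coe_mul, ← Matrix.mulVec_mulVec]
    push_cast
    split_ifs with hk
    · refine (circuitQ_close O _ (hS (r k.succ)) _ hω (norm_idealAmp x r j l)).trans ?_
      linarith
    · rw [OneMemClass.coe_one, Matrix.one_mulVec, one_mul]
      linarith

end GroverIterations

/-! ## Fourier analysis -/

section Fourier

variable {M : ℕ}

/-- `exp (2πi y / (M + 1))`. -/
def unitRoot (y : Fin (M + 1)) : ℂ :=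
  Complex.exp (2 * Real.pi * Complex.I * (y : ℕ) / ((M + 1 : ℕ) : ℂ))

theorem unitRoot_eq (y : Fin (M + 1)) :
    unitRoot y = Complex.exp ((2 * (Real.pi * (y : ℕ) / ((M + 1 : ℕ) : ℝ)) : ℝ) * Complex.I) := by
  rw [unitRoot]
  congr 1
  push_cast
  ring

theorem norm_unitRoot (y : Fin (M + 1)) : ‖unitRoot y‖ = 1 := by
  rw [unitRoot_eq]
  exact Complex.norm_exp_ofReal_mul_I _

theorem unitRoot_pow (y : Fin (M + 1)) : unitRoot y ^ (M + 1) = 1 := by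
  rw [unitRoot, ← Complex.exp_nat_mul, Complex.exp_eq_one_iff]
  refine ⟨(y : ℕ), ?_⟩
  have hN : ((M + 1 : ℕ) : ℂ) ≠ 0 := by exact_mod_cast Nat.succ_ne_zero M
  rw [mul_div_cancel₀ _ hN]
  push_cast
  ring

theorem qft_apply (j y : Fin (M + 1)) :
    (qft M).1 j y = unitRoot y ^ (j : ℕ) / (√((M + 1 : ℕ) : ℝ) : ℂ) := by
  rw [unitRoot, ← Complex.exp_nat_mul]
  simp only [qft, Matrix.of_apply]
  congr 2
  ring

theorem qft_inv_mulVec (v : Fin (M + 1) → ℂ) (y : Fin (M + 1)) :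
    ((qft M)⁻¹.1 *ᵥ v) y = ∑ j, star ((qft M).1 j y) * v j := rfl

/-- The Fourier transform diagonalises the cyclic shift; the wrap-around is harmless because
`unitRoot y` is an (M+1)-st root of unity. -/
theorem qft_inv_shift (v : Fin (M + 1) → ℂ) (y : Fin (M + 1)) :
    ((qft M)⁻¹.1 *ᵥ fun j => v (j + 1)) y = unitRoot y * ((qft M)⁻¹.1 *ᵥ v) y := by
  rw [qft_inv_mulVec, qft_inv_mulVec, Finset.mul_sum, ← Equiv.sum_comp (Equiv.addRight (1 : Fin (M + 1)))
    fun j => unitRoot y * (star ((qft M).1 j y) * v j)]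
  refine Finset.sum_congr rfl fun j _ => ?_
  rw [Equiv.coe_addRight, ← mul_assoc]
  congr 1
  have h1 : unitRoot y ^ ((j + 1 : Fin (M + 1)) : ℕ) = unitRoot y * unitRoot y ^ (j : ℕ) := by
    rw [Fin.val_add, ← pow_succ', Fin.val_one', Nat.add_mod_mod]
    conv_rhs => rw [← Nat.mod_add_div (j + 1) (M + 1), pow_add, pow_mul, unitRoot_pow, one_pow,
      mul_one]
  have h2 : unitRoot y * star (unitRoot y) = 1 := by
    simp [Complex.mul_conj', norm_unitRoot]
  rw [qft_apply, qft_apply, h1, star_div₀, star_div₀, star_mul', ← mul_div_assoc, ← mul_assoc, h2,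
    one_mul]

/-- A function on `ℤ/(M+1)` that is nearly multiplied by `ζ` under a shift has little Fourier weight
away from `ζ`. -/
theorem sum_qft_inv_le {Bad : Finset (Fin (M + 1))} {ζ : ℂ} {d B : ℝ} (hd : 0 < d)
    (hBad : ∀ y ∈ Bad, d ≤ ‖unitRoot y - ζ‖) {b : Fin (M + 1) → ℂ}
    (hb : ∀ j, ‖b (j + 1) - ζ * b j‖ ≤ B) :
    ∑ y ∈ Bad, ‖((qft M)⁻¹.1 *ᵥ b) y‖ ^ 2 ≤ ((M + 1 : ℕ) : ℝ) * (B / d) ^ 2 := by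
  -- The defect b(j+1) - ζ b(j) transforms into (χ_y - ζ) times the transform of b. Parseval bounds
  -- its total weight, and on `Bad` the factor is at least d.
  have h1 : ∀ y, ((qft M)⁻¹.1 *ᵥ fun j => b (j + 1) - ζ * b j) y =
      (unitRoot y - ζ) * ((qft M)⁻¹.1 *ᵥ b) y := by
    intro y
    have e : (fun j => b (j + 1) - ζ * b j) = (fun j => b (j + 1)) - ζ • b := rfl
    rw [e, Matrix.mulVec_sub, Pi.sub_apply, qft_inv_shift, Matrix.mulVec_smul, Pi.smul_apply,
      smul_eq_mul]
    ring
  have h2 : ∑ y, ‖(unitRoot y - ζ) * ((qft M)⁻¹.1 *ᵥ b) y‖ ^ 2 ≤ ((M + 1 : ℕ) : ℝ) * B ^ 2 := by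
    simp only [← h1]
    rw [← l2_sq, l2_unitary, l2_sq]
    calc ∑ j, ‖b (j + 1) - ζ * b j‖ ^ 2 ≤ ∑ _j : Fin (M + 1), B ^ 2 := by
          gcongr with j
          exact hb j
      _ = _ := by simp
  have h3 : d ^ 2 * ∑ y ∈ Bad, ‖((qft M)⁻¹.1 *ᵥ b) y‖ ^ 2 ≤
      ∑ y, ‖(unitRoot y - ζ) * ((qft M)⁻¹.1 *ᵥ b) y‖ ^ 2 := by
    rw [Finset.mul_sum]
    refine le_trans (Finset.sum_le_sum fun y hy => ?_)
      (Finset.sum_le_univ_sum_of_nonneg fun y => sq_nonneg _)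
    rw [norm_mul, mul_pow]
    gcongr
    exact hBad y hy
  rw [div_pow, ← mul_div_assoc, le_div_iff₀ (by positivity)]
  linarith

/-- The trapezoidal window on `{0, …, N}` with ramps of length `R`. -/
def window (N R : ℝ) (t : ℝ) : ℝ := min 1 (min t (N - t) / R)

theorem abs_window_sub_le {N R : ℝ} (hR : 0 < R) (t : ℝ) :
    |window N R (t + 1) - window N R t| ≤ 1 / R := by
  have h1 : |min 1 (min (t + 1) (N - (t + 1)) / R) - min 1 (min t (N - t) / R)| ≤
      |min (t + 1) (N - (t + 1)) / R - min t (N - t) / R| := by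
    simpa using abs_min_sub_min_le_max 1 (min (t + 1) (N - (t + 1)) / R) 1 (min t (N - t) / R)
  refine h1.trans ?_
  rw [← sub_div, abs_div, abs_of_pos hR]
  gcongr
  refine (abs_min_sub_min_le_max _ _ _ _).trans ?_
  simp

theorem window_nonneg {N R t : ℝ} (hR : 0 < R) (h0 : 0 ≤ t) (h1 : t ≤ N) : 0 ≤ window N R t :=
  le_min zero_le_one (div_nonneg (le_min h0 (by linarith)) hR.le)

theorem window_le_one (N R t : ℝ) : window N R t ≤ 1 := min_le_left _ _

theorem window_le {N R t : ℝ} (hR : 0 < R) : window N R t ≤ (N - t) / R :=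
  (min_le_right _ _).trans (by gcongr; exact min_le_right _ _)

theorem window_zero {N R : ℝ} (hN : 0 ≤ N) : window N R 0 = 0 := by
  simp [window, hN]

/-- A windowed sequence is nearly multiplied by `ζ` under a cyclic shift. -/
theorem window_shift_le {R B : ℝ} (hR : 0 < R) (hB : 0 ≤ B) {ζ : ℂ} (hζ : ‖ζ‖ = 1)
    {c : Fin (M + 1) → ℂ} (hc : ∀ j, ‖c j‖ = 1)
    (hcB : ∀ k : Fin M, ‖c k.succ - ζ * c k.castSucc‖ ≤ B) (j : Fin (M + 1)) :
    ‖(window ((M + 1 : ℕ) : ℝ) R ((j + 1 : Fin (M + 1)) : ℕ) : ℂ) * c (j + 1) -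
      ζ * ((window ((M + 1 : ℕ) : ℝ) R (j : ℕ) : ℂ) * c j)‖ ≤ B + 1 / R := by
  have hR1 : 0 ≤ 1 / R := by positivity
  induction j using Fin.lastCases with
  | last =>
    rw [Fin.last_add_one]
    -- At the wrap-around c₀ and ζ c_M are unrelated, but the window is 0 at the index 0 and at most
    -- 1/R at M.
    have h0 : window ((M + 1 : ℕ) : ℝ) R ((0 : Fin (M + 1)) : ℕ) = 0 := by
      simpa using window_zero (R := R) (Nat.cast_nonneg (M + 1))
    rw [h0, Complex.ofReal_zero, zero_mul, zero_sub, norm_neg, norm_mul, norm_mul, hζ, hc,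
      Complex.norm_real, one_mul, mul_one, Real.norm_of_nonneg
      (window_nonneg hR (Nat.cast_nonneg _) (by simp))]
    have := window_le (N := ((M + 1 : ℕ) : ℝ)) (t := ((Fin.last M : Fin (M + 1)) : ℕ)) hR
    simp only [Fin.val_last] at this ⊢
    push_cast at this ⊢
    rw [add_sub_cancel_left] at this
    linarith
  | cast k =>
    rw [Fin.coeSucc_eq_succ]
    have hcast : (((k.succ : Fin (M + 1)) : ℕ) : ℝ) = ((k.castSucc : Fin (M + 1)) : ℕ) + 1 := by
      simp
    set w' := window ((M + 1 : ℕ) : ℝ) R ((k.succ : Fin (M + 1)) : ℕ) with hw'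
    set w := window ((M + 1 : ℕ) : ℝ) R ((k.castSucc : Fin (M + 1)) : ℕ) with hw
    have e : (w' : ℂ) * c k.succ - ζ * ((w : ℂ) * c k.castSucc) =
        (w' : ℂ) * (c k.succ - ζ * c k.castSucc) + ((w' - w : ℝ) : ℂ) * (ζ * c k.castSucc) := by
      push_cast; ring
    rw [e]
    refine (norm_add_le _ _).trans ?_
    rw [norm_mul, norm_mul, norm_mul, hζ, hc, Complex.norm_real, Complex.norm_real, mul_one, mul_one]
    have h0 : 0 ≤ w' := window_nonneg hR (Nat.cast_nonneg _) (by
      exact_mod_cast k.succ.is_lt.le)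
    have h1 : w' ≤ 1 := window_le_one _ _ _
    have h2 : ‖w' - w‖ ≤ 1 / R := by
      rw [Real.norm_eq_abs, hw', hw, hcast]
      exact abs_window_sub_le hR _
    rw [Real.norm_of_nonneg h0]
    have h3 := hcB k
    nlinarith [norm_nonneg (c k.succ - ζ * c k.castSucc)]

theorem sum_one_sub_window_le {R : ℕ} (hR : 0 < R) :
    ∑ j : Fin (M + 1), (1 - window ((M + 1 : ℕ) : ℝ) R (j : ℕ)) ^ 2 ≤ 2 * (R : ℝ) := by
  have hR' : (0 : ℝ) < R := by exact_mod_cast hR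
  have key : ∀ j : Fin (M + 1), (1 - window ((M + 1 : ℕ) : ℝ) R (j : ℕ)) ^ 2 ≤
      (if (j : ℕ) < R then (1 : ℝ) else 0) + (if M + 1 - (j : ℕ) ≤ R then (1 : ℝ) else 0) := by
    intro j
    have h0 : 0 ≤ window ((M + 1 : ℕ) : ℝ) R (j : ℕ) :=
      window_nonneg hR' (Nat.cast_nonneg _) (by exact_mod_cast j.is_lt.le)
    have h1 : window ((M + 1 : ℕ) : ℝ) R (j : ℕ) ≤ 1 := window_le_one _ _ _
    have h2 : (1 - window ((M + 1 : ℕ) : ℝ) R (j : ℕ)) ^ 2 ≤ 1 := by nlinarith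
    by_cases ha : (j : ℕ) < R
    · rw [if_pos ha]
      split_ifs <;> linarith
    · by_cases hb : M + 1 - (j : ℕ) ≤ R
      · rw [if_neg ha, if_pos hb, zero_add]
        exact h2
      · rw [if_neg ha, if_neg hb]
        have hw : window ((M + 1 : ℕ) : ℝ) R (j : ℕ) = 1 := by
          refine min_eq_left ((one_le_div hR').2 (le_min ?_ ?_))
          · exact_mod_cast not_lt.1 ha
          · have : R + (j : ℕ) ≤ M + 1 := by omega
            have : ((R : ℝ) + (j : ℕ)) ≤ ((M + 1 : ℕ) : ℝ) := by exact_mod_cast this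
            linarith
        rw [hw]
        norm_num
  refine (Finset.sum_le_sum fun j _ => key j).trans ?_
  rw [Finset.sum_add_distrib]
  have hA : ∑ j : Fin (M + 1), (if (j : ℕ) < R then (1 : ℝ) else 0) ≤ R := by
    rw [Fin.sum_univ_eq_sum_range (fun j => if j < R then (1 : ℝ) else 0), ← Finset.sum_filter,
      Finset.sum_const, nsmul_eq_mul, mul_one]
    have : (Finset.range (M + 1)).filter (· < R) ⊆ Finset.range R := by
      intro j hj
      simp at hj ⊢
      exact hj.2
    exact_mod_cast (Finset.card_le_card this).trans_eq (Finset.card_range R)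
  have hB : ∑ j : Fin (M + 1), (if M + 1 - (j : ℕ) ≤ R then (1 : ℝ) else 0) ≤ R := by
    rw [Fin.sum_univ_eq_sum_range (fun j => if M + 1 - j ≤ R then (1 : ℝ) else 0),
      ← Finset.sum_filter, Finset.sum_const, nsmul_eq_mul, mul_one]
    have : (Finset.range (M + 1)).filter (fun j => M + 1 - j ≤ R) ⊆
        Finset.Ico (M + 1 - R) (M + 1) := by
      intro j hj
      simp at hj ⊢
      omega
    have h := (Finset.card_le_card this).trans_eq (Nat.card_Ico _ _)
    have h' : M + 1 - (M + 1 - R) ≤ R := by omega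
    exact_mod_cast h.trans h'
  linarith

end Fourier

/-! ## Geometry of the amplitudes -/

section Chord

/-- Since (1 - x) + i(1 + x) = (1 + i)(1 + ix), the square is the Cayley transform i(1 + ix)/(1 -
ix), a stereographic parametrisation of the circle. The next lemma is its chord formula. -/
theorem amp_sq (x : ℝ) : amp x ^ 2 = ⟨-2 * x / (1 + x ^ 2), (1 - x ^ 2) / (1 + x ^ 2)⟩ := by
  have h0 : (1 + x ^ 2) ≠ 0 := by positivity
  have h2 : √(2 * (1 + x ^ 2)) * √(2 * (1 + x ^ 2)) = 2 * (1 + x ^ 2) :=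
    Real.mul_self_sqrt (by positivity)
  rw [pow_two]
  apply Complex.ext
  · simp only [amp, Complex.mul_re, div_mul_div_comm, h2]
    field_simp
    ring
  · simp only [amp, Complex.mul_im, div_mul_div_comm, h2]
    field_simp
    ring

theorem norm_amp_sq_sub (x y : ℝ) :
    ‖amp x ^ 2 - amp y ^ 2‖ ^ 2 = 4 * (x - y) ^ 2 / ((1 + x ^ 2) * (1 + y ^ 2)) := by
  have hx : (1 + x ^ 2) ≠ 0 := by positivity
  have hy : (1 + y ^ 2) ≠ 0 := by positivity
  rw [Complex.sq_norm, Complex.normSq_apply, amp_sq, amp_sq]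
  simp only [Complex.sub_re, Complex.sub_im]
  field_simp
  ring

theorem norm_amp_sq_sub_le (x y : ℝ) : ‖amp x ^ 2 - amp y ^ 2‖ ≤ 2 * |x - y| := by
  apply le_of_sq_le_sq _ (by positivity)
  rw [norm_amp_sq_sub, mul_pow, sq_abs]
  refine (div_le_self (by positivity) ?_).trans_eq (by ring)
  nlinarith [sq_nonneg x, sq_nonneg y, mul_nonneg (sq_nonneg x) (sq_nonneg y)]

/-- The chord formula gives 4/(2 · 1.01) ≥ (7/5)². For general |y| ≤ 1 the factor would drop to 1,
and B/d = 0.52 would be too large for success probability 3/4; this is why x₀ is kept near 0. -/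
theorem le_norm_amp_sq_sub {x y : ℝ} (hx : |x| ≤ 1) (hy : |y| ≤ 1 / 10) :
    7 / 5 * |x - y| ≤ ‖amp x ^ 2 - amp y ^ 2‖ := by
  apply le_of_sq_le_sq _ (norm_nonneg _)
  rw [norm_amp_sq_sub, mul_pow, sq_abs, le_div_iff₀ (by positivity)]
  have h1 : x ^ 2 ≤ 1 := (sq_le_one_iff_abs_le_one x).2 hx
  have h2 : y ^ 2 ≤ 1 / 100 := by
    rw [← sq_abs]; nlinarith [abs_nonneg y]
  have h3 : (1 + x ^ 2) * (1 + y ^ 2) ≤ 2 * (101 / 100) := by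
    gcongr <;> linarith
  nlinarith [sq_nonneg (x - y)]

theorem invAmp_sin_sq (θ : ℝ) :
    invAmp (Real.sin θ ^ 2) = |Real.sin θ| / (|Real.sin θ| + |Real.cos θ|) := by
  rw [invAmp, ← Real.cos_sq', Real.sqrt_sq_eq_abs, Real.sqrt_sq_eq_abs]

theorem abs_sin_add_abs_cos_pos (θ : ℝ) : 0 < |Real.sin θ| + |Real.cos θ| := by
  have h := Real.sin_sq_add_cos_sq θ
  rw [← sq_abs, ← sq_abs (Real.cos θ)] at h
  rcases (abs_nonneg (Real.sin θ)).lt_or_eq with h1 | h1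
  · linarith [abs_nonneg (Real.cos θ)]
  · nlinarith [abs_nonneg (Real.cos θ)]

theorem abs_invAmp_le (θ : ℝ) : |2 * invAmp (Real.sin θ ^ 2) - 1| ≤ 1 := by
  have h0 := abs_sin_add_abs_cos_pos θ
  rw [invAmp_sin_sq, abs_le]
  have h1 : 0 ≤ |Real.sin θ| / (|Real.sin θ| + |Real.cos θ|) := by positivity
  have h2 : |Real.sin θ| / (|Real.sin θ| + |Real.cos θ|) ≤ 1 :=
    (div_le_one h0).2 (by linarith [abs_nonneg (Real.cos θ)])
  constructor <;> linarith

/-- The final formula of the algorithm inverts x ↦ `amp x ^ 2`: the estimate from the angle θ has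
eigenvalue exp(2iθ), up to complex conjugation. -/
theorem amp_invAmp_sq (θ : ℝ) :
    amp (2 * invAmp (Real.sin θ ^ 2) - 1) ^ 2 = ⟨Real.cos (2 * θ), |Real.sin (2 * θ)|⟩ := by
  have h0 := abs_sin_add_abs_cos_pos θ
  have h := Real.sin_sq_add_cos_sq θ
  have hx : 2 * invAmp (Real.sin θ ^ 2) - 1 =
      (|Real.sin θ| - |Real.cos θ|) / (|Real.sin θ| + |Real.cos θ|) := by
    rw [invAmp_sin_sq]; field_simp; ring
  rw [amp_sq, hx, Real.cos_two_mul', Real.sin_two_mul, abs_mul, abs_mul, abs_two]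
  rw [← sq_abs, ← sq_abs (Real.cos θ)] at h
  rw [← sq_abs (Real.cos θ), ← sq_abs (Real.sin θ)]
  set a := |Real.sin θ|
  set b := |Real.cos θ|
  have hs : 1 + ((a - b) / (a + b)) ^ 2 = 2 / (a + b) ^ 2 := by
    field_simp; linear_combination 2 * h
  rw [hs]
  apply Complex.ext
  · simp only
    field_simp
    ring
  · simp only
    field_simp
    ring

theorem norm_sub_le_of_im_nonneg {w ζ : ℂ} (hw : 0 ≤ w.im) (hζ : 0 ≤ ζ.im) :
    ‖w - ζ‖ ≤ ‖star w - ζ‖ := by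
  apply le_of_sq_le_sq _ (norm_nonneg _)
  rw [Complex.sq_norm, Complex.sq_norm, Complex.normSq_apply, Complex.normSq_apply]
  simp only [Complex.sub_re, Complex.sub_im, RCLike.star_def, Complex.conj_re, Complex.conj_im]
  nlinarith

/-- A measured value whose estimate is far from `x₀` belongs to a far eigenvalue. -/
theorem le_norm_unitRoot_sub {M : ℕ} {x₀ D : ℝ} (hx₀ : |x₀| ≤ 1 / 10) (y : Fin (M + 1))
    (hy : D < |2 * invAmp (Real.sin (Real.pi * (y : ℕ) / ((M + 1 : ℕ) : ℝ)) ^ 2) - 1 - x₀|) :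
    7 / 5 * D ≤ ‖unitRoot y - amp x₀ ^ 2‖ ∧ 7 / 5 * D ≤ ‖unitRoot y - star (amp x₀ ^ 2)‖ := by
  set θ := Real.pi * (y : ℕ) / ((M + 1 : ℕ) : ℝ) with hθ
  have h1 := le_norm_amp_sq_sub (abs_invAmp_le θ) hx₀
  set w := amp (2 * invAmp (Real.sin θ ^ 2) - 1) ^ 2 with hw
  have hw' : w = ⟨Real.cos (2 * θ), |Real.sin (2 * θ)|⟩ := amp_invAmp_sq θ
  have hwim : 0 ≤ w.im := by rw [hw']; exact abs_nonneg _
  have hζim : 0 ≤ (amp x₀ ^ 2).im := by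
    rw [amp_sq]
    refine div_nonneg ?_ (by positivity)
    nlinarith [abs_le.1 hx₀, sq_abs x₀, abs_nonneg x₀]
  have h2 : 7 / 5 * D ≤ ‖w - amp x₀ ^ 2‖ := by linarith
  have h3 := h2.trans (norm_sub_le_of_im_nonneg hwim hζim)
  have hχ : unitRoot y = ⟨Real.cos (2 * θ), Real.sin (2 * θ)⟩ := by
    rw [unitRoot_eq, ← hθ, Complex.exp_mul_I, ← Complex.ofReal_cos, ← Complex.ofReal_sin]
    exact Complex.mk_eq_add_mul_I _ _ |>.symm
  have hstar : ∀ a b : ℂ, ‖star a - b‖ = ‖a - star b‖ := by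
    intro a b
    rw [← norm_star (a - star b), star_sub, star_star]
  rcases le_total 0 (Real.sin (2 * θ)) with h | h
  · have : unitRoot y = w := by rw [hχ, hw', abs_of_nonneg h]
    rw [this, ← hstar]
    exact ⟨h2, h3⟩
  · have : unitRoot y = star w := by
      rw [hχ, hw', abs_of_nonpos h]
      apply Complex.ext <;> simp
    rw [this, hstar w (star (amp x₀ ^ 2)), star_star]
    exact ⟨h3, h2⟩

end Chord

/-! ## Amplitude estimation with non-identical oracles -/

section Estimation

variable {M : ℕ} {n : Type} [Fintype n]

/-- The part of the inverse Fourier transform of `f` on which the phase register is in `Bad`. -/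
def badPart (Bad : Finset (Fin (M + 1))) (f : Fin (M + 1) → n → ℂ) : Fin (M + 1) × n → ℂ :=
  fun a => if a.1 ∈ Bad then ((qft M)⁻¹.1 *ᵥ fun j => f j a.2) a.1 else 0

theorem badPart_add (Bad : Finset (Fin (M + 1))) (f g : Fin (M + 1) → n → ℂ) :
    badPart Bad (f + g) = badPart Bad f + badPart Bad g := by
  funext a
  simp only [badPart, Pi.add_apply]
  split_ifs
  · rw [← Pi.add_apply (i := a.1), ← Matrix.mulVec_add]
    rfl
  · simp

theorem l2_badPart_sq (Bad : Finset (Fin (M + 1))) (f : Fin (M + 1) → n → ℂ) :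
    l2 (badPart Bad f) ^ 2 = ∑ y ∈ Bad, ∑ b, ‖((qft M)⁻¹.1 *ᵥ fun j => f j b) y‖ ^ 2 := by
  rw [l2_sq, Fintype.sum_prod_type, ← Finset.sum_filter_add_sum_filter_not Finset.univ (· ∈ Bad),
    Finset.sum_eq_zero (s := Finset.univ.filter (· ∉ Bad)), add_zero, Finset.filter_univ_mem]
  · refine Finset.sum_congr rfl fun y hy => ?_
    simp [badPart, hy]
  · intro y hy
    simp only [Finset.mem_filter, Finset.mem_univ, true_and] at hy
    simp [badPart, hy]

theorem l2_badPart_le (Bad : Finset (Fin (M + 1))) (f : Fin (M + 1) → n → ℂ) :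
    l2 (badPart Bad f) ^ 2 ≤ ∑ j, l2 (f j) ^ 2 := by
  rw [l2_badPart_sq]
  refine (Finset.sum_le_univ_sum_of_nonneg fun y => Finset.sum_nonneg fun b _ =>
    sq_nonneg _).trans_eq ?_
  rw [Finset.sum_comm]
  simp only [← l2_sq, l2_unitary]
  simp only [l2_sq]
  rw [Finset.sum_comm]

variable {T : ℕ} {G : Type} [Fintype G] [DecidableEq G] {E : Finset ℝ}

theorem l2_comb_sq (z : G × E) (α β : ℂ) :
    l2 (α • coreKet z 0 + β • coreKet z 1) ^ 2 = ‖α‖ ^ 2 + ‖β‖ ^ 2 := by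
  have h : star (α • coreKet z 0 + β • coreKet z 1) ⬝ᵥ (α • coreKet z 0 + β • coreKet z 1) =
      star α * α + star β * β := by
    simp [star_add, star_smul, add_dotProduct, dotProduct_add, smul_dotProduct,
      dotProduct_smul, coreKet_dotProduct_coreKet, mul_comm]
  rw [star_dotProduct_self, RCLike.star_def, Complex.conj_mul', Complex.conj_mul'] at h
  exact_mod_cast h

/-- The Fourier weight far from `ζ` and its conjugate of a real qubit state that rotates with angular
velocity near that of `ζ`. -/
theorem badPart_window_le (z : G × E) {Bad : Finset (Fin (M + 1))} {ζ : ℂ} (hζ : ‖ζ‖ = 1)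
    {d B R : ℝ} (hd : 0 < d) (hB : 0 ≤ B) (hR : 0 < R)
    (hBad : ∀ y ∈ Bad, d ≤ ‖unitRoot y - ζ‖ ∧ d ≤ ‖unitRoot y - star ζ‖)
    {c : Fin (M + 1) → ℂ} (hc : ∀ j, ‖c j‖ = 1)
    (hcB : ∀ k : Fin M, ‖c k.succ - ζ * c k.castSucc‖ ≤ B) {κ : ℂ}
    (hκ : ‖κ‖ ^ 2 * ((M + 1 : ℕ) : ℝ) = 1) :
    l2 (badPart Bad fun j => (κ * (window ((M + 1 : ℕ) : ℝ) R (j : ℕ) : ℂ)) • qubitState z (c j)) ≤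
      (B + 1 / R) / d := by
  apply le_of_sq_le_sq _ (by positivity)
  set w : Fin (M + 1) → ℂ := fun j => (window ((M + 1 : ℕ) : ℝ) R (j : ℕ) : ℂ) with hw
  set P := (qft M)⁻¹.1 *ᵥ fun j => w j * c j with hP
  set N := (qft M)⁻¹.1 *ᵥ fun j => w j * star (c j) with hN
  have hPsum : ∑ y ∈ Bad, ‖P y‖ ^ 2 ≤ ((M + 1 : ℕ) : ℝ) * ((B + 1 / R) / d) ^ 2 :=
    sum_qft_inv_le hd (fun y hy => (hBad y hy).1) (window_shift_le hR hB hζ hc hcB)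
  have hNsum : ∑ y ∈ Bad, ‖N y‖ ^ 2 ≤ ((M + 1 : ℕ) : ℝ) * ((B + 1 / R) / d) ^ 2 := by
    have hstar : ∀ k : Fin M, ‖star (c k.succ) - star ζ * star (c k.castSucc)‖ ≤ B := by
      intro k
      rw [← star_mul', ← star_sub, norm_star]
      exact hcB k
    have hζ' : ‖star ζ‖ = 1 := by rw [norm_star, hζ]
    have hc' : ∀ j, ‖star (c j)‖ = 1 := fun j => by rw [norm_star, hc]
    have h := window_shift_le (c := fun j => star (c j)) hR hB hζ' hc' hstar
    exact sum_qft_inv_le (b := fun j => w j * star (c j)) hd (fun y hy => (hBad y hy).2) h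
  -- Real and imaginary parts are combinations of c and its conjugate. The first transforms to `P`,
  -- concentrated near ζ, and the second to `N`, concentrated near the conjugate of ζ; the
  -- parallelogram law recombines their weights.
  have hcomb : ∀ y b, ((qft M)⁻¹.1 *ᵥ fun j => ((κ * w j) • qubitState z (c j)) b) y =
      ((κ * ((P y + N y) / 2)) • coreKet z 0 + (κ * ((P y - N y) / (2 * Complex.I))) •
        coreKet z 1) b := by
    intro y b
    have e : (fun j => ((κ * w j) • qubitState z (c j)) b) =
        (κ * coreKet z 0 b / 2) • ((fun j => w j * c j) + fun j => w j * star (c j)) +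
        (κ * coreKet z 1 b / (2 * Complex.I)) •
          ((fun j => w j * c j) - fun j => w j * star (c j)) := by
      funext j
      have h1 := Complex.add_conj (c j)
      have h2 := Complex.sub_conj (c j)
      have h3 : c j + star (c j) = 2 * (c j).re := by rw [RCLike.star_def, h1]; push_cast; rfl
      have h4 : c j - star (c j) = 2 * (c j).im * Complex.I := by
        rw [RCLike.star_def, h2]; push_cast; rfl
      simp only [qubitState, Pi.smul_apply, Pi.add_apply, Pi.sub_apply, smul_eq_mul,
        ← mul_add, ← mul_sub, h3, h4]
      field_simp [Complex.I_ne_zero]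
    rw [e, Matrix.mulVec_add, Matrix.mulVec_smul, Matrix.mulVec_smul, Matrix.mulVec_add,
      Matrix.mulVec_sub]
    simp only [Pi.smul_apply, Pi.add_apply, Pi.sub_apply, smul_eq_mul, ← hP, ← hN]
    ring
  rw [l2_badPart_sq]
  have hterm : ∀ y, ∑ b, ‖((qft M)⁻¹.1 *ᵥ fun j => ((κ * w j) • qubitState z (c j)) b) y‖ ^ 2 =
      ‖κ‖ ^ 2 * ((‖P y‖ ^ 2 + ‖N y‖ ^ 2) / 2) := by
    intro y
    simp only [hcomb]
    rw [← l2_sq, l2_comb_sq]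
    simp only [norm_mul, norm_div, Complex.norm_ofNat, Complex.norm_I, mul_one]
    have := parallelogram_law_with_norm ℂ (P y) (N y)
    ring_nf at this ⊢
    nlinarith
  rw [Finset.sum_congr rfl fun y _ => hterm y, ← Finset.mul_sum, ← Finset.sum_div,
    Finset.sum_add_distrib]
  have h5 : (∑ y ∈ Bad, ‖P y‖ ^ 2 + ∑ y ∈ Bad, ‖N y‖ ^ 2) / 2 ≤
      ((M + 1 : ℕ) : ℝ) * ((B + 1 / R) / d) ^ 2 := by linarith
  calc ‖κ‖ ^ 2 * ((∑ y ∈ Bad, ‖P y‖ ^ 2 + ∑ y ∈ Bad, ‖N y‖ ^ 2) / 2) ≤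
        ‖κ‖ ^ 2 * (((M + 1 : ℕ) : ℝ) * ((B + 1 / R) / d) ^ 2) := by gcongr
    _ = ((B + 1 / R) / d) ^ 2 := by rw [← mul_assoc, hκ, one_mul]

/-- The branches k and k + 1 differ in exactly one Grover operator, so only the ratio of neighbours
is ever compared with ζ. -/
theorem idealAmp_succ (x : Fin T → ℝ) (r : Fin (M + 1) → Fin T) (k : Fin M) :
    idealAmp x r k.succ (List.finRange M) =
      amp (x (r k.succ)) ^ 2 * idealAmp x r k.castSucc (List.finRange M) := by
  rw [idealAmp, idealAmp, ← mul_assoc, ← Fin.prod_univ_def, ← Fin.prod_univ_def]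
  congr 1
  have h1 : ∏ k' : Fin M, (if k' = k then amp (x (r k'.succ)) ^ 2 else 1) =
      amp (x (r k.succ)) ^ 2 := by simp
  rw [← h1, ← Finset.prod_mul_distrib]
  refine Finset.prod_congr rfl fun k' _ => ?_
  by_cases h : k' = k
  · subst h
    simp
  · have h' : (k' : ℕ) ≠ k := fun e => h (Fin.ext e)
    rw [if_neg h, one_mul]
    refine if_congr ?_ rfl rfl
    simp only [Fin.val_succ, Fin.val_castSucc]
    omega

variable (O : Fin T → Matrix.unitaryGroup (G × E) ℂ)

/-- The probability that amplitude estimation with non-identical oracles measures a value of the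
phase register far from the common value. -/
theorem sum_bad_le {z : G × E} {s L H : ℝ} {angles : List (ℝ × ℝ)} {x : Fin T → ℝ} {η : ℝ}
    (r : Fin (M + 1) → Fin T)
    (hS : ∀ i, ∃ ω : ℂ, ‖ω‖ = 1 ∧ l2 (ω • qubitState z (amp (x i)) -
      (Circuit.op O (circuitS z s L H angles i : Circuit T (G × E) (Work E 0))).1 *ᵥ
        coreKet z 0) ≤ η)
    {Bad : Finset (Fin (M + 1))} {ζ : ℂ} (hζ : ‖ζ‖ = 1) {d B : ℝ} {R : ℕ} (hd : 0 < d) (hR : 0 < R)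
    (hBad : ∀ y ∈ Bad, d ≤ ‖unitRoot y - ζ‖ ∧ d ≤ ‖unitRoot y - star ζ‖)
    (hB : ∀ i, ‖amp (x i) ^ 2 - ζ‖ ≤ B) :
    ∑ y ∈ Bad, ∑ b, ‖Circuit.run O (ampCircuit z s L H angles r) (ket (z, blank E M))
      (join (b, y))‖ ^ 2 ≤
      ((B + 1 / R) / d + √(2 * R / ((M + 1 : ℕ) : ℝ)) + η * (1 + 4 * M)) ^ 2 := by
  obtain ⟨ω, hω, hclose⟩ := groverOp_close O r hS
  have hR' : (0 : ℝ) < R := by exact_mod_cast hR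
  have hN : (0 : ℝ) < ((M + 1 : ℕ) : ℝ) := by positivity
  have hB0 : 0 ≤ B := (norm_nonneg _).trans (hB (r 0))
  set N : ℝ := ((M + 1 : ℕ) : ℝ) with hNdef
  set κ : ℂ := 1 / (√N : ℂ) with hκdef
  have hκ : ‖κ‖ ^ 2 = 1 / N := by
    rw [hκdef, norm_div, norm_one, Complex.norm_real, Real.norm_of_nonneg (Real.sqrt_nonneg _),
      div_pow, one_pow, Real.sq_sqrt hN.le]
  have hκN : ‖κ‖ ^ 2 * N = 1 := by rw [hκ]; field_simp
  set c : Fin (M + 1) → ℂ := fun j => idealAmp x r j (List.finRange M) with hcdef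
  have hc : ∀ j, ‖c j‖ = 1 := fun j => norm_idealAmp x r j _
  set V : Fin (M + 1) → Core G E → ℂ := fun j =>
    (groverOp O z s L H angles r j (List.finRange M)).1 *ᵥ coreKet z 0 with hV
  have hVc : ∀ j, l2 (V j - ω • qubitState z (c j)) ≤ η * (1 + 4 * M) := by
    intro j
    have := hclose j (List.finRange M)
    rwa [List.length_finRange] at this
  set w : Fin (M + 1) → ℝ := fun j => window N R (j : ℕ) with hw
  set f₁ : Fin (M + 1) → Core G E → ℂ := fun j => (κ * ω * (w j : ℂ)) • qubitState z (c j) with hf₁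
  set f₂ : Fin (M + 1) → Core G E → ℂ := fun j => (κ * ω * ((1 - w j : ℝ) : ℂ)) •
    qubitState z (c j) with hf₂
  set f₃ : Fin (M + 1) → Core G E → ℂ := fun j => κ • (V j - ω • qubitState z (c j)) with hf₃
  -- Three contributions: the windowed ideal state, handled by the shift argument; the part cut off
  -- by the window, of small norm; and the error of the searches.
  have hsum : f₁ + f₂ + f₃ = fun j => κ • V j := by
    funext j
    simp only [Pi.add_apply, hf₁, hf₂, hf₃]
    push_cast
    module
  have hrun : ∑ y ∈ Bad, ∑ b, ‖Circuit.run O (ampCircuit z s L H angles r) (ket (z, blank E M))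
      (join (b, y))‖ ^ 2 = l2 (badPart Bad (f₁ + f₂ + f₃)) ^ 2 := by
    rw [l2_badPart_sq, hsum]
    simp only [run_ampCircuit]
    rfl
  have h₁ : l2 (badPart Bad f₁) ≤ (B + 1 / R) / d := by
    refine badPart_window_le z hζ hd hB0 hR' hBad hc (fun k => ?_) ?_
    · simp only [hcdef]
      rw [idealAmp_succ, ← sub_mul, norm_mul, norm_idealAmp, mul_one]
      exact hB _
    · rw [norm_mul, hω, mul_one]
      exact hκN
  have h₂ : l2 (badPart Bad f₂) ≤ √(2 * R / N) := by
    apply Real.le_sqrt_of_sq_le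
    refine (l2_badPart_le Bad f₂).trans ?_
    have : ∀ j, l2 (f₂ j) ^ 2 = 1 / N * (1 - w j) ^ 2 := by
      intro j
      rw [hf₂, l2_smul, l2_qubitState, hc, mul_one, norm_mul, norm_mul, hω, mul_one,
        Complex.norm_real, mul_pow, hκ, Real.norm_eq_abs, sq_abs]
    rw [Finset.sum_congr rfl fun j _ => this j, ← Finset.mul_sum, one_div_mul_eq_div]
    gcongr
    exact sum_one_sub_window_le hR
  have hη : 0 ≤ η * (1 + 4 * M) := (l2_nonneg _).trans (hVc 0)
  have h₃ : l2 (badPart Bad f₃) ≤ η * (1 + 4 * M) := by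
    apply le_of_sq_le_sq _ hη
    refine (l2_badPart_le Bad f₃).trans ?_
    calc ∑ j, l2 (f₃ j) ^ 2 ≤ ∑ _j : Fin (M + 1), 1 / N * (η * (1 + 4 * M)) ^ 2 := by
          refine Finset.sum_le_sum fun j _ => ?_
          rw [hf₃, l2_smul, mul_pow, hκ]
          have := hVc j
          gcongr
          exact l2_nonneg _
      _ = (η * (1 + 4 * M)) ^ 2 := by
          rw [Finset.sum_const, Finset.card_univ, Fintype.card_fin, nsmul_eq_mul, ← mul_assoc,
            ← hNdef, mul_one_div_cancel hN.ne', one_mul]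
  rw [hrun]
  apply pow_le_pow_left₀ (l2_nonneg _)
  rw [badPart_add, badPart_add]
  refine (l2_add_le _ _).trans (add_le_add ((l2_add_le _ _).trans (add_le_add h₁ h₂)) h₃)

end Estimation

/-! ## Moments of sub-Gaussian random variables -/

section Moments

variable {E : Finset ℝ} {p : E → ℝ} {K : ℝ}

/-- The exponent satisfies 3(j + 1)²/8 - j²/2 ≤ 3 - j/4, the difference being ((j - 4)² + 5)/8; then
e³ ≤ 25 and exp(-1/4) ≤ 4/5. -/
theorem exp_layer_le (j : ℕ) :
    Real.exp (3 * ((j : ℝ) + 1) ^ 2 / 8) * (2 * Real.exp (-((j : ℝ) ^ 2 / 2))) ≤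
      50 * (4 / 5) ^ j := by
  have h1 : Real.exp (3 * ((j : ℝ) + 1) ^ 2 / 8) * Real.exp (-((j : ℝ) ^ 2 / 2)) ≤
      Real.exp 3 * Real.exp (-(1 / 4)) ^ j := by
    rw [← Real.exp_add, ← Real.exp_nat_mul, ← Real.exp_add]
    apply Real.exp_le_exp.2
    nlinarith [sq_nonneg ((j : ℝ) - 4)]
  have h2 : Real.exp 3 ≤ 25 := by
    have : Real.exp 3 = Real.exp 1 ^ 3 := by rw [← Real.exp_nat_mul]; norm_num
    rw [this]
    have := Real.exp_one_lt_d9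
    calc Real.exp 1 ^ 3 ≤ 2.8 ^ 3 := by gcongr; linarith
      _ ≤ 25 := by norm_num
  have h3 : Real.exp (-(1 / 4)) ≤ 4 / 5 := by
    rw [Real.exp_neg, inv_le_comm₀ (Real.exp_pos _) (by norm_num)]
    have := Real.add_one_le_exp (1 / 4 : ℝ)
    norm_num at this ⊢
    linarith
  have h4 : Real.exp (-(1 / 4)) ^ j ≤ (4 / 5) ^ j := by gcongr
  have h5 : Real.exp 3 * Real.exp (-(1 / 4)) ^ j ≤ 25 * (4 / 5) ^ j := by gcongr
  linarith

theorem expMoment_le (hK : 0 < K) (hp : p ∈ stdSimplex ℝ E) (hsub : SubGaussian K p) :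
    ∑ x : E, p x * Real.exp (3 * ((x : ℝ) - mean p) ^ 2 / (8 * K ^ 2)) ≤ 250 := by
  set Y : E → ℝ := fun x => |(x : ℝ) - mean p| with hY
  set n : ℕ := (Finset.univ.sup fun x : E => ⌊Y x / K⌋₊) + 1 with hn
  set a : ℕ → ℝ := fun j => Real.exp (3 * ((j : ℝ) + 1) ^ 2 / 8) with ha
  -- A discrete layer cake: the single term j = ⌊Y/K⌋ already dominates, and the finiteness of E
  -- makes the range of j finite.
  have hpt : ∀ x : E, Real.exp (3 * ((x : ℝ) - mean p) ^ 2 / (8 * K ^ 2)) ≤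
      ∑ j ∈ Finset.range n, a j * if (j : ℝ) * K ≤ Y x then 1 else 0 := by
    intro x
    have hk : ⌊Y x / K⌋₊ ∈ Finset.range n := by
      rw [Finset.mem_range, hn, Nat.lt_succ_iff]
      exact Finset.le_sup (f := fun x : E => ⌊Y x / K⌋₊) (Finset.mem_univ x)
    have hY0 : 0 ≤ Y x / K := div_nonneg (abs_nonneg _) hK.le
    have h1 : (⌊Y x / K⌋₊ : ℝ) * K ≤ Y x := by
      rw [← le_div_iff₀ hK]; exact Nat.floor_le hY0
    refine le_trans ?_ (Finset.single_le_sum (fun j _ => ?_) hk)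
    · rw [if_pos h1, mul_one]
      apply Real.exp_le_exp.2
      have h2 : Y x / K ≤ (⌊Y x / K⌋₊ : ℝ) + 1 := (Nat.lt_floor_add_one _).le
      have h3 : 3 * ((x : ℝ) - mean p) ^ 2 / (8 * K ^ 2) = 3 * (Y x / K) ^ 2 / 8 := by
        rw [hY, div_pow, sq_abs]; field_simp
      rw [h3]
      gcongr
    · exact mul_nonneg (Real.exp_pos _).le (by split_ifs <;> norm_num)
  calc ∑ x : E, p x * Real.exp (3 * ((x : ℝ) - mean p) ^ 2 / (8 * K ^ 2))
      ≤ ∑ x : E, p x * ∑ j ∈ Finset.range n, a j * if (j : ℝ) * K ≤ Y x then 1 else 0 :=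
        Finset.sum_le_sum fun x _ => mul_le_mul_of_nonneg_left (hpt x) (hp.1 x)
    _ = ∑ j ∈ Finset.range n, a j * tail p (j * K) := by
        simp only [Finset.mul_sum, tail]
        rw [Finset.sum_comm]
        refine Finset.sum_congr rfl fun j _ => Finset.sum_congr rfl fun x _ => ?_
        change p x * (a j * if (j : ℝ) * K ≤ |(x : ℝ) - mean p| then 1 else 0) = _
        split_ifs <;> ring
    _ ≤ ∑ j ∈ Finset.range n, 50 * (4 / 5 : ℝ) ^ j := by
        refine Finset.sum_le_sum fun j _ => ?_
        have h := hsub (j * K) (by positivity)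
        have h2 : -((j : ℝ) * K) ^ 2 / (2 * K ^ 2) = -((j : ℝ) ^ 2 / 2) := by
          field_simp
        rw [h2] at h
        exact (mul_le_mul_of_nonneg_left h (Real.exp_pos _).le).trans (exp_layer_le j)
    _ ≤ 250 := by
        rw [← Finset.mul_sum, geom_sum_eq (by norm_num)]
        have h1 : (0 : ℝ) ≤ (4 / 5) ^ n := by positivity
        have h2 : (4 / 5 - 1 : ℝ) = -(1 / 5) := by norm_num
        rw [h2]
        linarith

theorem variance_le (hK : 0 < K) (hp : p ∈ stdSimplex ℝ E) (hsub : SubGaussian K p) :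
    ∑ x : E, p x * ((x : ℝ) - mean p) ^ 2 ≤ 700 * K ^ 2 := by
  have h1 : ∀ x : E, p x * ((x : ℝ) - mean p) ^ 2 ≤
      8 / 3 * K ^ 2 * (p x * Real.exp (3 * ((x : ℝ) - mean p) ^ 2 / (8 * K ^ 2))) := by
    intro x
    have h2 := Real.add_one_le_exp (3 * ((x : ℝ) - mean p) ^ 2 / (8 * K ^ 2))
    have h3 : ((x : ℝ) - mean p) ^ 2 =
        8 / 3 * K ^ 2 * (3 * ((x : ℝ) - mean p) ^ 2 / (8 * K ^ 2)) := by
      field_simp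
    rw [mul_left_comm]
    refine mul_le_mul_of_nonneg_left ?_ (hp.1 x)
    nth_rewrite 1 [h3]
    gcongr
    linarith
  refine (Finset.sum_le_sum fun x _ => h1 x).trans ?_
  rw [← Finset.mul_sum]
  have := expMoment_le hK hp hsub
  nlinarith [sq_nonneg K]

/-- The bias due to truncation. -/
theorem abs_truncMean_sub_le (hK : 0 < K) (hp : p ∈ stdSimplex ℝ E) (hsub : SubGaussian K p)
    {s H D : ℝ} (hs : |mean p - s| ≤ D) (hD : D ≤ H - D) :
    |truncMean s (-H) H p - (mean p - s)| ≤
      1000 * K * Real.exp (-(5 * (H - D) ^ 2 / (16 * K ^ 2))) := by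
  have hD0 : 0 ≤ D := (abs_nonneg _).trans hs
  have hm : mean p - s = ∑ x : E, p x * ((x : ℝ) - s) := by
    simp only [mul_sub, Finset.sum_sub_distrib, ← Finset.sum_mul, hp.2, one_mul]
    rfl
  have hpt : ∀ x : E, |val s (truncReg s (-H) H x) - ((x : ℝ) - s)| ≤
      4 * K * Real.exp (-(5 * (H - D) ^ 2 / (16 * K ^ 2))) *
        Real.exp (3 * ((x : ℝ) - mean p) ^ 2 / (8 * K ^ 2)) := by
    intro x
    unfold truncReg
    split_ifs with h
    · simp only [val, sub_self, abs_zero]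
      positivity
    · simp only [val, zero_sub, abs_neg]
      have h1 : H < |(x : ℝ) - s| := by
        by_contra hc
        exact h (abs_le.1 (not_lt.1 hc))
      set Y := |(x : ℝ) - mean p| with hY
      have h2 : |(x : ℝ) - s| ≤ Y + D :=
        (abs_sub_le (x : ℝ) (mean p) s).trans (by linarith)
      have h3 : H - D < Y := by linarith
      have hY2 : ((x : ℝ) - mean p) ^ 2 = Y ^ 2 := (sq_abs _).symm
      -- The budget 3/8 = 6/16 in the exponential moment is split: 1/16 pays for the linear factor
      -- Y, and 5/16 becomes decay at the threshold H - D. The hypothesis D ≤ H - D gives |x - s| ≤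
      -- 2Y on the truncated part.
      have h4 : Y ≤ 2 * K * Real.exp (Y ^ 2 / (16 * K ^ 2)) := by
        have e1 := Real.add_one_le_exp (Y ^ 2 / (16 * K ^ 2))
        have e2 : Y ≤ 2 * K * (Y ^ 2 / (16 * K ^ 2) + 1) := by
          have : 2 * K * (Y ^ 2 / (16 * K ^ 2) + 1) - Y = (Y - 4 * K) ^ 2 / (8 * K) := by
            field_simp; ring
          have : 0 ≤ (Y - 4 * K) ^ 2 / (8 * K) := by positivity
          linarith
        exact e2.trans (by gcongr)
      have h5 : Real.exp (Y ^ 2 / (16 * K ^ 2)) ≤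
          Real.exp (-(5 * (H - D) ^ 2 / (16 * K ^ 2))) *
            Real.exp (3 * Y ^ 2 / (8 * K ^ 2)) := by
        rw [← Real.exp_add]
        apply Real.exp_le_exp.2
        have : -(5 * (H - D) ^ 2 / (16 * K ^ 2)) + 3 * Y ^ 2 / (8 * K ^ 2) - Y ^ 2 / (16 * K ^ 2) =
            5 * (Y ^ 2 - (H - D) ^ 2) / (16 * K ^ 2) := by
          field_simp; ring
        have : 0 ≤ 5 * (Y ^ 2 - (H - D) ^ 2) / (16 * K ^ 2) := by
          apply div_nonneg _ (by positivity)
          nlinarith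
        linarith
      rw [hY2]
      have h6 : 2 * K * Real.exp (Y ^ 2 / (16 * K ^ 2)) ≤
          2 * K * (Real.exp (-(5 * (H - D) ^ 2 / (16 * K ^ 2))) *
            Real.exp (3 * Y ^ 2 / (8 * K ^ 2))) := by gcongr
      linarith
  rw [hm, truncMean, ← Finset.sum_sub_distrib]
  simp only [← mul_sub]
  refine (Finset.abs_sum_le_sum_abs _ _).trans ?_
  calc ∑ x : E, |p x * (val s (truncReg s (-H) H x) - ((x : ℝ) - s))|
      ≤ ∑ x : E, 4 * K * Real.exp (-(5 * (H - D) ^ 2 / (16 * K ^ 2))) *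
          (p x * Real.exp (3 * ((x : ℝ) - mean p) ^ 2 / (8 * K ^ 2))) := by
        refine Finset.sum_le_sum fun x _ => ?_
        rw [abs_mul, abs_of_nonneg (hp.1 x), mul_left_comm]
        exact mul_le_mul_of_nonneg_left (hpt x) (hp.1 x)
    _ ≤ 4 * K * Real.exp (-(5 * (H - D) ^ 2 / (16 * K ^ 2))) * 250 := by
        rw [← Finset.mul_sum]
        exact mul_le_mul_of_nonneg_left (expMoment_le hK hp hsub) (by positivity)
    _ = _ := by ring

end Moments

/-! ## Probabilities of the algorithm -/

section Probability

variable {T : ℕ} {G : Type} [Fintype G] [DecidableEq G] {E : Finset ℝ} {M : ℕ}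
  (O : Fin T → Matrix.unitaryGroup (G × E) ℂ)

theorem Algorithm.prob_nonneg {H W : Type} [Fintype H] [DecidableEq H] [Fintype W] [DecidableEq W]
    (O : Fin T → Matrix.unitaryGroup H ℂ) (b₀ : H × W) (S : Set ℝ) (A : Algorithm T H W) :
    0 ≤ A.prob O b₀ S := by
  induction A with
  | output r => exact Set.indicator_nonneg (fun _ _ => zero_le_one) r
  | round C next ih => exact Finset.sum_nonneg fun b _ => mul_nonneg (sq_nonneg _) (ih b)

theorem run_query (i : Fin T) (z h : G × E) (w : Work E M) :
    Circuit.run O ([.query i false fun _ => true] : Circuit T (G × E) (Work E M))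
      (ket (z, blank E M)) (h, w) = if w = blank E M then ((O i).1 *ᵥ ket z) h else 0 := by
  rw [Circuit.run_eq, Circuit.op_singleton]
  refine (onRegister_refl_mulVec _ _ h w).trans ?_
  change ((O i).1 *ᵥ fun h' => (ket (z, blank E M) : (G × E) × Work E M → ℂ) (h', w)) h = _
  have hk : (fun h' => (ket (z, blank E M) : (G × E) × Work E M → ℂ) (h', w)) =
      if w = blank E M then ket z else 0 := by
    funext h'
    by_cases hw : w = blank E M
    · simp [ket, Pi.single_apply, hw]
    · simp [ket, hw]
  rw [hk]
  split_ifs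
  · rfl
  · exact congrFun (Matrix.mulVec_zero _) h

theorem sum_run_query (i : Fin T) {z : G × E} {p : E → ℝ} (hp : p ∈ stdSimplex ℝ E)
    (hU : Encodes z (O i) p) (F : E → ℝ) :
    ∑ b, ‖Circuit.run O ([.query i false fun _ => true] : Circuit T (G × E) (Work E M))
      (ket (z, blank E M)) b‖ ^ 2 * F b.1.2 = ∑ x, p x * F x := by
  have h := sum_ket_sq hp hU F
  have h' : ∑ h : G × E, ‖((O i).1 *ᵥ ket z) h‖ ^ 2 * F h.2 = ∑ x, p x * F x := by
    simp only [RCLike.star_def, Complex.conj_mul'] at h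
    exact_mod_cast h
  rw [← h', Fintype.sum_prod_type]
  refine Finset.sum_congr rfl fun a _ => ?_
  simp only [run_query]
  rw [Finset.sum_eq_single (blank E M)]
  · simp
  · intro w _ hw
    simp [hw]
  · simp

/-- A quadratic lower bound on the success probability, as a function of the sum of the samples,
survives averaging over the samples, up to their variance. -/
theorem le_prob_sampleSum {z : G × E} {p : Fin T → E → ℝ} (hp : ∀ i, p i ∈ stdSimplex ℝ E)
    (hU : ∀ i, Encodes z (O i) (p i)) {S : Set ℝ} {α β a : ℝ}
    {next : ℝ → Algorithm T (G × E) (Work E M)}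
    (hnext : ∀ t, α - β * (t - a) ^ 2 ≤ (next t).prob O (z, blank E M) S)
    (l : List (Fin T)) (acc : ℝ) :
    α - β * ((acc + (l.map fun i => mean (p i)).sum - a) ^ 2 +
      (l.map fun i => ∑ x : E, p i x * ((x : ℝ) - mean (p i)) ^ 2).sum) ≤
      (sampleSum l acc next).prob O (z, blank E M) S := by
  induction l generalizing acc with
  | nil => simpa [sampleSum] using hnext acc
  | cons i l ih =>
    simp only [sampleSum, Algorithm.prob, List.map_cons, List.sum_cons]
    set m := (l.map fun i => mean (p i)).sum
    set v := (l.map fun i => ∑ x : E, p i x * ((x : ℝ) - mean (p i)) ^ 2).sum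
    calc α - β * ((acc + (mean (p i) + m) - a) ^ 2 +
          (∑ x : E, p i x * ((x : ℝ) - mean (p i)) ^ 2 + v))
        = ∑ x : E, p i x * (α - β * ((acc + (x : ℝ) + m - a) ^ 2 + v)) := by
          have h1 : ∑ x : E, p i x = 1 := (hp i).2
          have h2 : ∑ x : E, p i x * ((x : ℝ) - mean (p i)) = 0 := by
            simp only [mul_sub, Finset.sum_sub_distrib, ← Finset.sum_mul, h1, one_mul]
            exact sub_self _
          -- Expansion about the mean: the cross term averages to zero, and the square adds the
          -- variance of this sample.
          have h3 : ∀ x : E, p i x * (α - β * ((acc + (x : ℝ) + m - a) ^ 2 + v)) =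
              p i x * (α - β * ((acc + (mean (p i) + m) - a) ^ 2 + v)) -
              p i x * ((x : ℝ) - mean (p i)) * (2 * β * (acc + (mean (p i) + m) - a)) -
              β * (p i x * ((x : ℝ) - mean (p i)) ^ 2) := by
            intro x; ring
          simp only [h3]
          rw [Finset.sum_sub_distrib, Finset.sum_sub_distrib, ← Finset.sum_mul, ← Finset.sum_mul,
            ← Finset.mul_sum, h1, h2]
          ring
      _ = ∑ b, ‖Circuit.run O ([.query i false fun _ => true] : Circuit T (G × E) (Work E M))
            (ket (z, blank E M)) b‖ ^ 2 * (α - β * ((acc + (b.1.2 : ℝ) + m - a) ^ 2 + v)) :=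
          (sum_run_query O i (hp i) (hU i)
            fun x => α - β * ((acc + (x : ℝ) + m - a) ^ 2 + v)).symm
      _ ≤ _ := Finset.sum_le_sum fun b _ => mul_le_mul_of_nonneg_left (ih _) (sq_nonneg _)

/-- The probability of an event on the phase register. -/
theorem prob_round_phase (C : Circuit T (G × E) (Work E M)) (b₀ : (G × E) × Work E M)
    (f : Fin (M + 1) → ℝ) (S : Set ℝ) [DecidablePred fun y => f y ∉ S] :
    (Algorithm.round C fun b => .output (f b.2.phase)).prob O b₀ S =
      1 - ∑ y with f y ∉ S, ∑ b : Core G E, ‖Circuit.run O C (ket b₀) (join (b, y))‖ ^ 2 := by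
  have h1 : ∑ b, ‖Circuit.run O C (ket b₀) b‖ ^ 2 = 1 := by
    rw [← l2_sq, Circuit.run_eq, l2_unitary, l2_ket, one_pow]
  rw [← join.sum_comp, Fintype.sum_prod_type_right] at h1
  simp only [Algorithm.prob]
  rw [← join.sum_comp, Fintype.sum_prod_type_right, Finset.sum_filter]
  refine Eq.trans ?_ (congrArg₂ (· - ·) h1 rfl)
  simp only [← Finset.sum_sub_distrib]
  refine Finset.sum_congr rfl fun y _ => ?_
  have hy : ∀ b : Core G E, (join (b, y)).2.phase = y := fun _ => rfl
  simp only [hy]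
  split_ifs with h
  · rw [Set.indicator_of_mem h]
    simp
  · rw [Set.indicator_of_notMem h]
    simp

end Probability

/-! ## Numbers of quantum experiments -/

section Cost

variable {T : ℕ}

/-- Number of quantum experiments in a step, those on oracle `j` being counted `w j` times. -/
def Step.cost {H W : Type} [Fintype H] [DecidableEq H] [Fintype W] [DecidableEq W]
    (w : Fin T → ℕ) : Step T H W → ℕ
  | .gate _ => 0
  | .query j _ _ => w j

/-- Number of quantum experiments in a circuit, those on oracle `j` being counted `w j` times. -/
def Circuit.cost {H W : Type} [Fintype H] [DecidableEq H] [Fintype W] [DecidableEq W]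
    (w : Fin T → ℕ) (C : Circuit T H W) : ℕ := (C.map (Step.cost w)).sum

section Circuit

variable {H W : Type} [Fintype H] [DecidableEq H] [Fintype W] [DecidableEq W] (w : Fin T → ℕ)

theorem Circuit.cost_append (C D : Circuit T H W) :
    Circuit.cost w (C ++ D) = Circuit.cost w C + Circuit.cost w D := by
  simp [Circuit.cost]

theorem Circuit.cost_inv (C : Circuit T H W) : Circuit.cost w C.inv = Circuit.cost w C := by
  rw [Circuit.cost, Circuit.cost, Circuit.inv, List.map_reverse, List.sum_reverse, List.map_map]
  congr 2
  funext s
  cases s <;> rfl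

theorem Circuit.cost_gate (U : Matrix.unitaryGroup (H × W) ℂ) :
    Circuit.cost w ([.gate U] : Circuit T H W) = 0 := rfl

theorem Step.queriesTo_eq (i : Fin T) :
    (Step.queriesTo i : Step T H W → ℕ) = Step.cost fun j => if j = i then 1 else 0 := by
  funext s
  cases s <;> rfl

theorem Step.queries_eq : (Step.queries : Step T H W → ℕ) = Step.cost fun _ => 1 := by
  funext s
  cases s <;> rfl

end Circuit

variable {G : Type} [Fintype G] [DecidableEq G] {E : Finset ℝ} {M : ℕ} (w : Fin T → ℕ)

theorem cost_circuitV (s L H : ℝ) (i : Fin T) :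
    Circuit.cost w (circuitV s L H i : Circuit T (G × E) (Work E M)) = 2 * w i := by
  have hU : Circuit.cost w (circuitU s L H i : Circuit T (G × E) (Work E M)) = w i := by
    simp [Circuit.cost, circuitU, truncatedOracle, shiftedOracle, Step.cost]
  rw [circuitV, Circuit.cost_append, Circuit.cost_append, Circuit.cost_inv, hU, Circuit.cost_gate]
  ring

theorem cost_circuitS (z : G × E) (s L H : ℝ) (angles : List (ℝ × ℝ)) (i : Fin T) :
    Circuit.cost w (circuitS z s L H angles i : Circuit T (G × E) (Work E M)) =
      2 * (2 * angles.length + 1) * w i := by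
  induction angles using List.reverseRecOn with
  | nil => simpa [circuitS] using cost_circuitV w s L H i
  | append_singleton angles ang ih =>
    rw [circuitS_append_singleton]
    simp only [Circuit.cost_append, Circuit.cost_inv, Circuit.cost_gate, cost_circuitV, ih,
      List.length_append, List.length_singleton]
    ring

/-- The initial S is charged like a full Grover operator, twice its cost, so that all M + 1
positions are treated alike. The weight w serves both for the count per oracle and for the total. -/
theorem cost_ampCircuit_le (z : G × E) (s L H : ℝ) (angles : List (ℝ × ℝ))
    (r : Fin (M + 1) → Fin T) :
    Circuit.cost w (ampCircuit z s L H angles r : Circuit T (G × E) (Work E M)) ≤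
      4 * (2 * angles.length + 1) * ∑ k, w (r k) := by
  have h1 : ∀ l : List (Fin M), Circuit.cost w (l.flatMap fun k : Fin M =>
      circuitQ z s L H angles ((k : ℕ) + 1) (r k.succ) : Circuit T (G × E) (Work E M)) =
      (l.map fun k => 4 * (2 * angles.length + 1) * w (r k.succ)).sum := by
    intro l
    induction l with
    | nil => rfl
    | cons k l ih =>
      rw [List.flatMap_cons, Circuit.cost_append, ih, List.map_cons, List.sum_cons, circuitQ]
      simp only [Circuit.cost_append, Circuit.cost_inv, Circuit.cost_gate, cost_circuitS]
      ring
  simp only [ampCircuit, Circuit.cost_append, Circuit.cost_gate, cost_circuitS, h1]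
  rw [← Fin.sum_univ_def, ← Finset.mul_sum, Fin.sum_univ_succ]
  nlinarith [Nat.zero_le ((2 * angles.length + 1) * w (r 0))]

theorem queriesTo_sampleSum_le {i : Fin T} {n : ℕ} {next : ℝ → Algorithm T (G × E) (Work E M)}
    (h : ∀ t, (next t).queriesTo i ≤ n) (l : List (Fin T)) (acc : ℝ) :
    (sampleSum l acc next).queriesTo i ≤ l.count i + n := by
  induction l generalizing acc with
  | nil => simpa [sampleSum] using h acc
  | cons j l ih =>
    simp only [sampleSum, Algorithm.queriesTo, List.map_cons, List.map_nil, List.sum_cons,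
      List.sum_nil, Step.queriesTo, List.count_cons, beq_iff_eq]
    have := Finset.sup_le (s := Finset.univ)
      (f := fun b : (G × E) × Work E M => (sampleSum l (acc + (b.1.2 : ℝ)) next).queriesTo i)
      fun b _ => ih (acc + (b.1.2 : ℝ))
    omega

theorem queries_sampleSum_le {n : ℕ} {next : ℝ → Algorithm T (G × E) (Work E M)}
    (h : ∀ t, (next t).queries ≤ n) (l : List (Fin T)) (acc : ℝ) :
    (sampleSum l acc next).queries ≤ l.length + n := by
  induction l generalizing acc with
  | nil => simpa [sampleSum] using h acc
  | cons j l ih =>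
    simp only [sampleSum, Algorithm.queries, List.map_cons, List.map_nil, List.sum_cons,
      List.sum_nil, Step.queries, List.length_cons]
    have := Finset.sup_le (s := Finset.univ)
      (f := fun b : (G × E) × Work E M => (sampleSum l (acc + (b.1.2 : ℝ)) next).queries)
      fun b _ => ih (acc + (b.1.2 : ℝ))
    omega

theorem sup_zero {α : Type*} (s : Finset α) : (s.sup fun _ => (0 : ℕ)) = 0 := Finset.sup_bot s

variable (fix : ℝ → List (ℝ × ℝ)) (κM κS K ε : ℝ) (z : G × E)

theorem queriesTo_subGaussianAlgorithm_le {c : Fin numSamples → Fin T}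
    {r : Fin (phaseDim κM K ε + 1) → Fin T} (hc : Function.Injective c)
    (hr : Function.Injective r) (i : Fin T) :
    (subGaussianAlgorithm fix κM κS K ε z c r).queriesTo i ≤
      1 + 4 * (2 * (fix (searchPrecision κS K ε)).length + 1) := by
  refine (queriesTo_sampleSum_le (n := 4 * (2 * (fix (searchPrecision κS K ε)).length + 1))
    (fun t => ?_) _ _).trans (Nat.add_le_add_right ?_ _)
  · simp only [Algorithm.queriesTo]
    rw [sup_zero, add_zero, Step.queriesTo_eq]
    refine (cost_ampCircuit_le _ _ _ _ _ _ _).trans ?_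
    have : ∑ k, (if r k = i then 1 else 0) ≤ 1 := by
      rw [← Finset.card_filter]
      exact Finset.card_le_one.2 fun a ha b hb => hr (by simp_all)
    nlinarith
  · exact List.nodup_iff_count_le_one.1 (List.nodup_ofFn.2 hc) i

theorem queries_subGaussianAlgorithm_le (c : Fin numSamples → Fin T)
    (r : Fin (phaseDim κM K ε + 1) → Fin T) :
    (subGaussianAlgorithm fix κM κS K ε z c r).queries ≤ numSamples +
      4 * (2 * (fix (searchPrecision κS K ε)).length + 1) * (phaseDim κM K ε + 1) := by
  refine (queries_sampleSum_le (n := 4 * (2 * (fix (searchPrecision κS K ε)).length + 1) *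
    (phaseDim κM K ε + 1)) (fun t => ?_) _ _).trans_eq (by rw [List.length_ofFn])
  simp only [Algorithm.queries]
  rw [sup_zero, add_zero, Step.queries_eq]
  refine (cost_ampCircuit_le _ _ _ _ _ _ _).trans ?_
  simp

end Cost

/-! ## Numerical estimates -/

section Numerics

variable {K ε : ℝ}

/-- The choice c = exp(-10⁶) makes log(K/ε) ≥ 10⁶, so its square root exceeds 1000. All the crude
constants of this part rest on that room. -/
theorem exp_neg_million_le : Real.exp (-10 ^ 6) ≤ 1 / 10 ^ 6 := by
  rw [Real.exp_neg, ← one_div]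
  apply one_div_le_one_div_of_le (by norm_num)
  linarith [Real.add_one_le_exp (10 ^ 6 : ℝ)]

theorem pos_of_le_exp_mul (hε : 0 < ε) (h : ε ≤ Real.exp (-10 ^ 6) * K) : 0 < K := by
  have := Real.exp_pos (-10 ^ 6 : ℝ)
  by_contra hK
  nlinarith [not_lt.1 hK]

theorem le_div_million (hε : 0 < ε) (h : ε ≤ Real.exp (-10 ^ 6) * K) : ε ≤ K / 10 ^ 6 := by
  refine h.trans ((mul_le_mul_of_nonneg_right exp_neg_million_le
    (pos_of_le_exp_mul hε h).le).trans_eq ?_)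
  ring

theorem million_le_log (hε : 0 < ε) (h : ε ≤ Real.exp (-10 ^ 6) * K) :
    10 ^ 6 ≤ Real.log (K / ε) := by
  have hK := pos_of_le_exp_mul hε h
  rw [Real.le_log_iff_exp_le (by positivity), le_div_iff₀ hε]
  calc Real.exp (10 ^ 6) * ε ≤ Real.exp (10 ^ 6) * (Real.exp (-10 ^ 6) * K) := by gcongr
    _ = K := by rw [← mul_assoc, ← Real.exp_add]; norm_num

theorem log_mul_div (hK : 0 < K) (hε : 0 < ε) :
    Real.log (128 * K / ε) = Real.log 128 + Real.log (K / ε) := by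
  rw [mul_div_assoc, Real.log_mul (by norm_num) (by positivity)]

theorem bound_eq (hε : 0 < ε) (h : ε ≤ Real.exp (-10 ^ 6) * K) :
    bound K ε = K * (1 + 2 * √(Real.log (128 * K / ε))) := by
  have hK := pos_of_le_exp_mul hε h
  have hlog := million_le_log hε h
  have h128 : 0 < Real.log 128 := Real.log_pos (by norm_num)
  have h1 := log_mul_div hK hε
  have h2 : Real.log (32 * K / ε) ≤ Real.log (128 * K / ε) := by
    apply Real.log_le_log (by positivity)
    gcongr
    norm_num
  have h3 : √(4 * Real.log (128 * K / ε)) = 2 * √(Real.log (128 * K / ε)) := by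
    rw [Real.sqrt_mul (by norm_num), show (4 : ℝ) = 2 ^ 2 by norm_num, Real.sqrt_sq (by norm_num)]
  rw [bound, truncWidth, max_eq_left (Real.sqrt_le_sqrt (by linarith)), h3]
  ring

theorem thousand_le_sqrt_log (hε : 0 < ε) (h : ε ≤ Real.exp (-10 ^ 6) * K) :
    1000 ≤ √(Real.log (128 * K / ε)) := by
  have hK := pos_of_le_exp_mul hε h
  apply Real.le_sqrt_of_sq_le
  rw [log_mul_div hK hε]
  have h128 : 0 < Real.log 128 := Real.log_pos (by norm_num)
  linarith [million_le_log hε h]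

theorem le_bound (hε : 0 < ε) (h : ε ≤ Real.exp (-10 ^ 6) * K) : 2001 * K ≤ bound K ε := by
  have hK := pos_of_le_exp_mul hε h
  rw [bound_eq hε h]
  nlinarith [thousand_le_sqrt_log hε h]

theorem bias_le (hε : 0 < ε) (h : ε ≤ Real.exp (-10 ^ 6) * K) :
    1000 * K * Real.exp (-(5 * (bound K ε - 40 * K) ^ 2 / (16 * K ^ 2))) ≤ ε / 100 := by
  have hK := pos_of_le_exp_mul hε h
  have hlog := million_le_log hε h
  have h128 : 0 < Real.log 128 := Real.log_pos (by norm_num)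
  have hσ := thousand_le_sqrt_log hε h
  set σ := √(Real.log (128 * K / ε)) with hσdef
  have hσ2 : σ ^ 2 = Real.log (128 * K / ε) :=
    Real.sq_sqrt (by rw [log_mul_div hK hε]; linarith)
  have hε2 : ε = 128 * K * Real.exp (-σ ^ 2) := by
    rw [hσ2, Real.exp_neg, Real.exp_log (by positivity)]
    field_simp
  have e1 : 5 * (bound K ε - 40 * K) ^ 2 / (16 * K ^ 2) = 5 * (2 * σ - 39) ^ 2 / 16 := by
    rw [bound_eq hε h, ← hσdef]
    field_simp
    ring
  -- The leading coefficient 5 · 4/16 = 5/4 exceeds 1, so for σ ≥ 1000 the decay beats exp(-σ²) =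
  -- ε/(128K) with room for the prefactor 1000K.
  have e2 : Real.exp (-(5 * (2 * σ - 39) ^ 2 / 16)) ≤ Real.exp (-1000 + -σ ^ 2) := by
    apply Real.exp_le_exp.2
    nlinarith
  have e3 : Real.exp (-1000 + -σ ^ 2) = Real.exp (-1000) * Real.exp (-σ ^ 2) := by
    rw [← Real.exp_add]
  have e4 : Real.exp (-1000) ≤ 1 / 1000 := by
    rw [Real.exp_neg, ← one_div]
    apply one_div_le_one_div_of_le (by norm_num)
    linarith [Real.add_one_le_exp (1000 : ℝ)]
  rw [e1]
  calc 1000 * K * Real.exp (-(5 * (2 * σ - 39) ^ 2 / 16))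
      ≤ 1000 * K * (1 / 1000 * Real.exp (-σ ^ 2)) := by
        rw [e3] at e2
        have := Real.exp_pos (-σ ^ 2)
        gcongr
        exact e2.trans (by gcongr)
    _ ≤ ε / 100 := by
        have := mul_pos hK (Real.exp_pos (-σ ^ 2))
        nlinarith

theorem phaseDim_le {κ : ℝ} (hκ : 0 < κ) (hε : 0 < ε) (hb : 0 < bound K ε) :
    (phaseDim κ K ε : ℝ) ≤ κ * (2 * bound K ε) / ε :=
  Nat.floor_le (by positivity)

theorem lt_phaseDim_add_one {κ : ℝ} : κ * (2 * bound K ε) / ε < (phaseDim κ K ε + 1 : ℕ) := by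
  push_cast
  exact Nat.lt_floor_add_one _

/-- In units of t = ε/(2H), the factor 10⁴ in M makes 1/R ≤ t/50, the ramps occupying about 1/200 of
the window each. The three summands are then at most 0.38, 0.102 and 0.001. -/
theorem error_le {ε H : ℝ} {M R : ℕ} (hε : 0 < ε) (hH : 4 * 10 ^ 9 * ε ≤ 2 * H)
    (hM : (M : ℝ) ≤ 10 ^ 4 * (2 * H) / ε) (hM' : 10 ^ 4 * (2 * H) / ε < ((M + 1 : ℕ) : ℝ))
    (hR : ((M + 1 : ℕ) : ℝ) / 200 ≤ R) (hR' : (R : ℝ) < ((M + 1 : ℕ) : ℝ) / 200 + 1) :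
    ((52 / 100 * (ε / H) + 1 / R) / (7 / 5 * (ε / H)) + √(2 * R / ((M + 1 : ℕ) : ℝ)) +
      1 * (ε ^ 2 / (2 * H) ^ 2) * (1 + 4 * M)) ^ 2 ≤ 1 / 4 := by
  have hH0 : 0 < H := by linarith
  set N : ℝ := ((M + 1 : ℕ) : ℝ) with hN
  set t : ℝ := ε / (2 * H) with ht
  have ht0 : 0 < t := by positivity
  have ht1 : t ≤ 1 / (4 * 10 ^ 9) := by
    rw [ht, div_le_div_iff₀ (by positivity) (by norm_num)]
    linarith
  have e1 : 10 ^ 4 * (2 * H) / ε = 10 ^ 4 / t := by rw [ht]; field_simp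
  have e2 : ε / H = 2 * t := by rw [ht]; field_simp
  have e3 : ε ^ 2 / (2 * H) ^ 2 = t ^ 2 := by rw [ht, div_pow]
  rw [e1] at hM hM'
  rw [e2, e3]
  have hNt : 10 ^ 4 < N * t := (div_lt_iff₀ ht0).1 hM'
  have hMt : (M : ℝ) * t ≤ 10 ^ 4 := (le_div_iff₀ ht0).1 hM
  have hN0 : 0 < N := by positivity
  have hR0 : (0 : ℝ) < R := lt_of_lt_of_le (by positivity) hR
  have a1 : 1 / (R : ℝ) ≤ 2 / 100 * t := by
    rw [div_le_iff₀ hR0]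
    nlinarith
  have a2 : (52 / 100 * (2 * t) + 1 / R) / (7 / 5 * (2 * t)) ≤ 38 / 100 := by
    rw [div_le_iff₀ (by positivity)]
    linarith
  have a3 : √(2 * R / N) ≤ 102 / 1000 := by
    refine Real.sqrt_le_iff.2 ⟨by norm_num, ?_⟩
    rw [div_le_iff₀ hN0]
    nlinarith
  have a4 : 1 * t ^ 2 * (1 + 4 * M) ≤ 1 / 1000 := by
    nlinarith
  have a5 : 0 ≤ (52 / 100 * (2 * t) + 1 / R) / (7 / 5 * (2 * t)) := by positivity
  have a6 : 0 ≤ 1 * t ^ 2 * (1 + 4 * (M : ℝ)) := by positivity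
  calc _ ≤ (38 / 100 + 102 / 1000 + 1 / 1000 : ℝ) ^ 2 := by
        apply pow_le_pow_left₀ (by positivity)
        linarith
    _ ≤ 1 / 4 := by norm_num

end Numerics

/-! ## Correctness -/

section Correctness

variable {T : ℕ} {G : Type} [Fintype G] [DecidableEq G] {E : Finset ℝ}
  (O : Fin T → Matrix.unitaryGroup (G × E) ℂ) {K ε : ℝ} {fix : ℝ → List (ℝ × ℝ)}

/-- Amplitude estimation succeeds with probability at least `3/4` when the shift is good. -/
theorem three_quarters_le_prob (hε : 0 < ε) (h : ε ≤ Real.exp (-10 ^ 6) * K)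
    (hfix : IsFixedPointSearch fix) {z : G × E} {p : Fin T → E → ℝ}
    (hp : ∀ i, p i ∈ stdSimplex ℝ E) (hU : ∀ i, Encodes z (O i) (p i))
    (hsub : ∀ i, SubGaussian K (p i)) {μ : ℝ} (hmean : ∀ i, |mean (p i) - μ| ≤ ε / 4) {s : ℝ}
    (hs : |s - μ| ≤ 39 * K) (r : Fin (phaseDim (10 ^ 4) K ε + 1) → Fin T) :
    3 / 4 ≤ (Algorithm.round (ampCircuit z s (-bound K ε) (bound K ε)
      (fix (searchPrecision 1 K ε)) r) fun b =>
      .output (boundedEstimate (-bound K ε) (bound K ε) b.2.phase + s)).prob O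
      (z, blank E (phaseDim (10 ^ 4) K ε)) {x | |x - μ| ≤ ε} := by
  classical
  have hK := pos_of_le_exp_mul hε h
  have hb := le_bound hε h
  have hbias := bias_le hε h
  have hεK := le_div_million hε h
  have hM := phaseDim_le (K := K) (κ := 10 ^ 4) (by norm_num) hε (by linarith)
  have hM' := lt_phaseDim_add_one (K := K) (ε := ε) (κ := 10 ^ 4)
  rw [searchPrecision]
  generalize phaseDim (10 ^ 4) K ε = M at *
  generalize bound K ε = H at *
  have hH : 0 < H := by linarith
  have hη0 : 0 < 1 * (ε ^ 2 / (2 * H) ^ 2) := by positivity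
  have hη1 : 1 * (ε ^ 2 / (2 * H) ^ 2) ≤ 1 / 2 := by
    rw [one_mul, div_le_div_iff₀ (by positivity) (by norm_num)]
    nlinarith
  set x : Fin T → ℝ := fun i => truncMean s (-H) H (p i) / H with hx
  set x₀ : ℝ := (μ - s) / H with hx₀
  have hx₀1 : |x₀| ≤ 1 / 10 := by
    rw [hx₀, abs_div, abs_of_pos hH, div_le_div_iff₀ hH (by norm_num), abs_sub_comm]
    linarith
  -- The sum of 1/4 from the differing means and 1/100 from the truncation bias.
  have hxx₀ : ∀ i, |x i - x₀| ≤ 26 / 100 * (ε / H) := by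
    intro i
    have h1 : |mean (p i) - s| ≤ 40 * K := by
      have := abs_sub_le (mean (p i)) μ s
      rw [abs_sub_comm μ s] at this
      linarith [hmean i]
    have h2 := (abs_truncMean_sub_le hK (hp i) (hsub i) h1 (by linarith)).trans hbias
    have h3 : x i - x₀ = ((truncMean s (-H) H (p i) - (mean (p i) - s)) + (mean (p i) - μ)) / H := by
      rw [hx, hx₀]; field_simp; ring
    rw [h3, abs_div, abs_of_pos hH, ← mul_div_assoc]
    gcongr
    refine (abs_add_le _ _).trans ?_
    linarith [hmean i]
  set R : ℕ := ⌈((M + 1 : ℕ) : ℝ) / 200⌉₊ with hR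
  have hR0 : 0 < R := Nat.ceil_pos.2 (by positivity)
  refine le_of_le_of_eq ?_ (prob_round_phase O _ _ (fun y => boundedEstimate (-H) H y + s) _).symm
  have key := sum_bad_le O (x := x) r
    (Bad := Finset.univ.filter fun y => boundedEstimate (-H) H y + s ∉ {x | |x - μ| ≤ ε})
    (ζ := amp x₀ ^ 2) (d := 7 / 5 * (ε / H)) (B := 52 / 100 * (ε / H)) (R := R)
    (fun i => circuitS_close O i hfix hη0 hη1 hH (hp i) (hU i))
    (by rw [norm_pow, norm_amp, one_pow]) (by positivity) hR0
    (fun y hy => le_norm_unitRoot_sub hx₀1 y ?_)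
    (fun i => (norm_amp_sq_sub_le _ _).trans (by linarith [hxx₀ i]))
  · have herr := error_le (R := R) hε (by linarith) hM hM' (Nat.le_ceil _)
      (Nat.ceil_lt_add_one (by positivity))
    linarith [key.trans herr]
  · simp only [Finset.mem_filter, Finset.mem_univ, true_and, Set.mem_ofPred_eq, not_le] at hy
    rw [boundedEstimate] at hy
    rw [div_lt_iff₀ hH, ← abs_of_pos hH, ← abs_mul]
    refine hy.trans_eq (congrArg abs ?_)
    rw [hx₀]
    field_simp
    ring

theorem two_thirds_le_prob (hε : 0 < ε) (h : ε ≤ Real.exp (-10 ^ 6) * K)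
    (hfix : IsFixedPointSearch fix) {z : G × E} {p : Fin T → E → ℝ}
    (hp : ∀ i, p i ∈ stdSimplex ℝ E) (hU : ∀ i, Encodes z (O i) (p i))
    (hsub : ∀ i, SubGaussian K (p i)) {μ : ℝ} (hmean : ∀ i, |mean (p i) - μ| ≤ ε / 4)
    (c : Fin numSamples → Fin T) (r : Fin (phaseDim (10 ^ 4) K ε + 1) → Fin T) :
    2 / 3 ≤ (subGaussianAlgorithm fix (10 ^ 4) 1 K ε z c r).prob O
      (z, blank E (phaseDim (10 ^ 4) K ε)) {x | |x - μ| ≤ ε} := by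
  have hK := pos_of_le_exp_mul hε h
  have hεK := le_div_million hε h
  have hn : (8 : ℝ) ≤ (numSamples : ℝ) := by
    have h1 : (1 : ℝ) ≤ Real.log 20 := by
      rw [Real.le_log_iff_exp_le (by norm_num)]
      linarith [Real.exp_one_lt_d9]
    exact le_trans (by linarith) (Nat.le_ceil _)
  set n : ℝ := (numSamples : ℝ) with hndef
  -- The parabola is at most 3/4 everywhere and nonpositive once |t/n - μ| > 39K, so it bounds the
  -- success probability from below in both cases. With variance 700K² and n ≥ 8, averaging loses
  -- about 0.044, less than 3/4 - 2/3.
  have hnext := fun t => (show 3 / 4 - 3 / 4 / (n * (39 * K)) ^ 2 * (t - n * μ) ^ 2 ≤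
      (Algorithm.round (ampCircuit z (t / n) (-bound K ε) (bound K ε)
      (fix (searchPrecision 1 K ε)) r) fun b =>
      .output (boundedEstimate (-bound K ε) (bound K ε) b.2.phase + t / n)).prob O
      (z, blank E (phaseDim (10 ^ 4) K ε)) {x | |x - μ| ≤ ε} by
    by_cases ht : |t / n - μ| ≤ 39 * K
    · refine le_trans ?_ (three_quarters_le_prob O hε h hfix hp hU hsub hmean ht r)
      have : 0 ≤ 3 / 4 / (n * (39 * K)) ^ 2 * (t - n * μ) ^ 2 := by positivity
      linarith
    · refine le_trans ?_ (Algorithm.prob_nonneg O _ _ _)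
      have h1 : t - n * μ = n * (t / n - μ) := by field_simp
      have h2 : (n * (39 * K)) ^ 2 ≤ (t - n * μ) ^ 2 := by
        rw [h1, mul_pow, mul_pow n (t / n - μ), ← sq_abs (t / n - μ)]
        gcongr
        exact (not_le.1 ht).le
      rw [div_mul_eq_mul_div, mul_div_assoc, sub_nonpos]
      have h3 : 1 ≤ (t - n * μ) ^ 2 / (n * (39 * K)) ^ 2 := (one_le_div (by positivity)).2 h2
      linarith)
  have hmain := le_prob_sampleSum O hp hU hnext (List.ofFn c) 0
  refine le_trans ?_ hmain
  have hm : |(List.map (fun i => mean (p i)) (List.ofFn c)).sum - n * μ| ≤ n * (ε / 4) := by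
    rw [List.map_ofFn, List.sum_ofFn]
    have h1 : n * μ = ∑ _k : Fin numSamples, μ := by simp [hndef]
    rw [h1, ← Finset.sum_sub_distrib]
    refine (Finset.abs_sum_le_sum_abs _ _).trans ((Finset.sum_le_sum fun k _ => hmean (c k)).trans ?_)
    simp [hndef]
  have hv : (List.map (fun i => ∑ x : E, p i x * ((x : ℝ) - mean (p i)) ^ 2) (List.ofFn c)).sum ≤
      n * (700 * K ^ 2) := by
    rw [List.map_ofFn, List.sum_ofFn]
    refine (Finset.sum_le_sum fun k _ => variance_le hK (hp (c k)) (hsub (c k))).trans ?_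
    simp [hndef]
  set m := (List.map (fun i => mean (p i)) (List.ofFn c)).sum
  set v := (List.map (fun i => ∑ x : E, p i x * ((x : ℝ) - mean (p i)) ^ 2) (List.ofFn c)).sum
  have h4 : (0 + m - n * μ) ^ 2 ≤ (n * (ε / 4)) ^ 2 := by
    rw [zero_add, ← sq_abs]
    gcongr
  have h5 : (n * (ε / 4)) ^ 2 ≤ n ^ 2 * K ^ 2 := by
    rw [mul_pow]
    gcongr
    linarith
  have h6 : n * (700 * K ^ 2) ≤ 700 / 8 * (n ^ 2 * K ^ 2) := by
    have := mul_pos (show 0 < n by linarith) (pow_pos hK 2)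
    nlinarith
  have h7 : 3 / 4 / (n * (39 * K)) ^ 2 * ((0 + m - n * μ) ^ 2 + v) ≤
      3 / 4 / (n * (39 * K)) ^ 2 * ((1 + 700 / 8) * (n ^ 2 * K ^ 2)) := by
    gcongr
    linarith
  have h8 : 3 / 4 / (n * (39 * K)) ^ 2 * ((1 + 700 / 8) * (n ^ 2 * K ^ 2)) =
      3 / 4 / 39 ^ 2 * (1 + 700 / 8) := by
    field_simp
  rw [h8] at h7
  norm_num at h7 ⊢
  linarith

end Correctness

/-! ## Query complexity -/

section Complexity

variable {K ε : ℝ}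

theorem rate_facts (hε : 0 < ε) (h : ε ≤ Real.exp (-10 ^ 6) * K) :
    10 ^ 6 ≤ Real.log (rate K ε) ∧ 1 ≤ rate K ε ∧ 2 * bound K ε / ε ≤ 10 * rate K ε := by
  have hK := pos_of_le_exp_mul hε h
  have hlog := million_le_log hε h
  have hs1 : 1000 ≤ √(Real.log (K / ε)) := Real.le_sqrt_of_sq_le (by linarith)
  have hrate : rate K ε = K / ε * √(Real.log (K / ε)) := by rw [rate]; ring
  have hKε : 0 < K / ε := by positivity
  have h1 : K / ε ≤ rate K ε := by
    rw [hrate]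
    nlinarith
  have hl := Real.log_le_log hKε h1
  have h2 : 10 ^ 6 ≤ Real.log (rate K ε) := hlog.trans hl
  refine ⟨h2, ?_, ?_⟩
  · have := Real.log_le_sub_one_of_pos (hKε.trans_le h1)
    linarith
  · have h3 : √(Real.log (128 * K / ε)) ≤ 2 * √(Real.log (K / ε)) := by
      refine Real.sqrt_le_iff.2 ⟨by positivity, ?_⟩
      rw [mul_pow, Real.sq_sqrt (by linarith), log_mul_div hK hε]
      have := Real.log_le_sub_one_of_pos (show (0 : ℝ) < 128 by norm_num)
      linarith
    rw [bound_eq hε h, hrate, div_le_iff₀ hε]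
    have h4 : 10 * (K / ε * √(Real.log (K / ε))) * ε = 10 * K * √(Real.log (K / ε)) := by
      field_simp
    rw [h4]
    nlinarith

/-- Here log(1/η) = 2 log(2H/ε) ≤ 2(log 10 + log `rate`), and log 10 is absorbed because log `rate`
≥ 10⁶. -/
theorem length_fix_le {fix : ℝ → List (ℝ × ℝ)} {κ : ℝ} (hκ : 0 < κ)
    (hfix : ∀ η : ℝ, 0 < η → η ≤ 1 / 2 → ((fix η).length : ℝ) ≤ κ * Real.log (1 / η))
    (hε : 0 < ε) (h : ε ≤ Real.exp (-10 ^ 6) * K) :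
    ((fix (searchPrecision 1 K ε)).length : ℝ) ≤ 4 * κ * Real.log (rate K ε) := by
  have hK := pos_of_le_exp_mul hε h
  have hb := le_bound hε h
  obtain ⟨h1, h2, h3⟩ := rate_facts hε h
  have hb0 : 0 < bound K ε := by linarith
  have hεK := le_div_million hε h
  have hη1 : searchPrecision 1 K ε ≤ 1 / 2 := by
    rw [searchPrecision, one_mul, div_le_div_iff₀ (by positivity) (by norm_num)]
    nlinarith
  refine (hfix _ (by rw [searchPrecision]; positivity) hη1).trans ?_
  have h4 : 1 / searchPrecision 1 K ε = (2 * bound K ε / ε) ^ 2 := by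
    rw [searchPrecision]; field_simp
  have h5 : Real.log (2 * bound K ε / ε) ≤ Real.log 10 + Real.log (rate K ε) := by
    rw [← Real.log_mul (by norm_num) (by linarith)]
    exact Real.log_le_log (by positivity) h3
  have h6 := Real.log_le_sub_one_of_pos (show (0 : ℝ) < 10 by norm_num)
  rw [h4, Real.log_pow]
  push_cast
  nlinarith

end Complexity

end QMean

end

/-! ### Choice of the constants and assembly -/

theorem theorem3p2 :
    ∃ (c C C' κM κS : ℝ) (fix : ℝ → List (ℝ × ℝ)),
      0 < c ∧ 0 < C ∧ 0 < C' ∧ 0 < κM ∧ 0 < κS ∧ QMean.IsFixedPointSearch fix ∧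
      ∀ (K ε : ℝ), 0 < ε → ε ≤ c * K →
      0 < Real.log (QMean.rate K ε) ∧
      ∀ (m T : ℕ), C * Real.log (QMean.rate K ε) ≤ m → C * QMean.rate K ε ≤ T →
      ∀ (G : Type) [Fintype G] [DecidableEq G] (E : Finset ℝ) (z : G × E),
        (∃ (a : Fin QMean.numSamples → Fin T) (r : Fin (QMean.phaseDim κM K ε + 1) → Fin T),
          ∀ i, (QMean.subGaussianAlgorithm fix κM κS K ε z a r).queriesTo i ≤ m) ∧
        ∀ (a : Fin QMean.numSamples → Fin T) (r : Fin (QMean.phaseDim κM K ε + 1) → Fin T),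
          (∀ i, (QMean.subGaussianAlgorithm fix κM κS K ε z a r).queriesTo i ≤ m) →
          ((QMean.subGaussianAlgorithm fix κM κS K ε z a r).queries : ℝ) ≤
            C' * (QMean.rate K ε * Real.log (QMean.rate K ε)) ∧
          ∀ δ : ℝ, δ < ε / 4 →
            QMean.SolvesSubGaussian z (QMean.subGaussianAlgorithm fix κM κS K ε z a r) m ε δ K := by
  obtain ⟨fix, hfix⟩ := QMean.exists_isFixedPointSearch
  obtain ⟨κ, hκ, hlen⟩ := hfix.1
  obtain ⟨n, hn⟩ : ∃ n : ℝ, n = (QMean.numSamples : ℝ) := ⟨_, rfl⟩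
  have hn0 : 0 ≤ n := hn ▸ Nat.cast_nonneg _
  -- One summand for each demand: T ≥ n for distinct samples, T ≥ M + 1 for distinct Grover oracles
  -- (as M ≤ 10⁵ `rate`), and m ≥ 1 + 4(2 · length + 1) for the experiments on one oracle.
  set C : ℝ := n + (10 ^ 5 + 1) + (32 * κ + 5) with hC
  set C' : ℝ := n + (32 * κ + 4) * (10 ^ 5 + 1) with hC'
  refine ⟨Real.exp (-10 ^ 6), C, C', 10 ^ 4, 1, fix, Real.exp_pos _, by positivity, by positivity,
    by norm_num, one_pos, hfix, fun K ε hε h => ?_⟩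
  obtain ⟨hlog, hrate, hbound⟩ := QMean.rate_facts hε h
  have hl := QMean.length_fix_le hκ hlen hε h
  have hM : ((QMean.phaseDim (10 ^ 4) K ε : ℕ) : ℝ) ≤ 10 ^ 5 * QMean.rate K ε := by
    refine (QMean.phaseDim_le (by norm_num) hε ?_).trans ?_
    · have := QMean.pos_of_le_exp_mul hε h
      linarith [QMean.le_bound hε h]
    · rw [mul_div_assoc]
      linarith
  set ℓ := Real.log (QMean.rate K ε) with hℓ
  set q := QMean.rate K ε with hq
  set len := (fix (QMean.searchPrecision 1 K ε)).length with hlen_def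
  have hcost : 4 * (2 * (len : ℝ) + 1) ≤ (32 * κ + 4) * ℓ := by linarith
  refine ⟨by linarith, fun m T hm hT G _ _ E z => ⟨?_, fun a r hquery => ⟨?_, fun δ hδ =>
    ⟨hquery, fun μ p O hp hU hsub hmean => ?_⟩⟩⟩⟩
  · have hnT : QMean.numSamples ≤ T := by
      have : n ≤ T := le_trans (by nlinarith) hT
      rw [hn] at this
      exact_mod_cast this
    have hMT : QMean.phaseDim (10 ^ 4) K ε + 1 ≤ T := by
      have : ((QMean.phaseDim (10 ^ 4) K ε : ℕ) : ℝ) + 1 ≤ T := le_trans (by nlinarith) hT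
      exact_mod_cast this
    refine ⟨Fin.castLE hnT, Fin.castLE hMT, fun i => ?_⟩
    refine (QMean.queriesTo_subGaussianAlgorithm_le fix _ _ K ε z (Fin.castLE_injective hnT)
      (Fin.castLE_injective hMT) i).trans ?_
    have : 1 + 4 * (2 * (len : ℝ) + 1) ≤ m := le_trans (by nlinarith) hm
    exact_mod_cast this
  · have h1 : ((QMean.subGaussianAlgorithm fix (10 ^ 4) 1 K ε z a r).queries : ℝ) ≤
        n + 4 * (2 * (len : ℝ) + 1) * ((QMean.phaseDim (10 ^ 4) K ε : ℕ) + 1) := by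
      have h0 := Nat.cast_le (α := ℝ).2
        (QMean.queries_subGaussianAlgorithm_le fix (10 ^ 4) 1 K ε z a r)
      push_cast at h0
      rwa [← hn] at h0
    refine h1.trans ?_
    have h2 : ((QMean.phaseDim (10 ^ 4) K ε : ℕ) : ℝ) + 1 ≤ (10 ^ 5 + 1) * q := by linarith
    have h3 : 4 * (2 * (len : ℝ) + 1) * ((QMean.phaseDim (10 ^ 4) K ε : ℕ) + 1) ≤
        (32 * κ + 4) * ℓ * ((10 ^ 5 + 1) * q) := by
      have : 0 ≤ (32 * κ + 4) * ℓ := by positivity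
      gcongr
    have h4 : n ≤ n * (q * ℓ) := by
      have : 1 ≤ q * ℓ := by nlinarith
      nlinarith
    rw [hC']
    linarith
  · exact QMean.two_thirds_le_prob O hε h hfix hp hU hsub
      (fun i => (hmean i).trans hδ.le) a r
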